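/- Write $e_1,e_2,e_3$ for the canonical basis, $C_c=\prod_i[c_i,c_i+1]$ for $c\in\mathbb Z^3$, and $U_0=(-\infty,0]^3$. A stepped solid is a union $U$ of cubes $C_c$; it is monotone if $C_c\subset U$ and $d\le c$ coordinatewise imply $C_d\subset U$, and regular if $U\subset U_0$ and $U_0\setminus U$ is composed of finitely many cubes. Let $U$ be a regular monotone stepped solid. Its stepped surface $\partial U$ is an infinite planar quadrangulation $G(U)$ with vertex set $V(U)=\{x\in U\cap\mathbb Z^3: x+e_1+e_2+e_3\notin U\}$, with the edges of the form $\{x,x+e_i\}$ between such vertices, and with set of faces $F(U)$, the unit lattice squares of $\partial U$. A $C_2^{(1)}$ loop configuration $\sigma$ on $G(U)$ chooses in every face two coloured (red or blue) arcs that join the four sides of the face in pairs, where two arcs that cross in a face have different colours, so that the colours agree on every side shared by two faces. The arcs form infinite simple paths and finite closed curves; the latter are called loops, and $N_\sigma$ is their number. Let $\sigma_0$ be the configuration on $G(U_0)$ that is everywhere blue and in which, in each face $(x,x+e_i,x+e_i+e_j,x+e_j)$, one arc turns around the corner $x+e_i$ and the other around $x+e_j$. A configuration $\sigma$ on $G(U)$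 is taut if there is a ball centred at the origin outside which $G(U)$ coincides with $G(U_0)$ and $\sigma$ coincides with $\sigma_0$, and such that any two edges outside the ball whose arcs belong to the same path of $\sigma_0$ belong to the same path of $\sigma$. Let $\Sigma(U)$ be the set of taut configurations. Let $g_x>0$ for $x\in V(U)$. At a face $f$ with pairs of opposite corners $\{x,y\}$ and $\{u,v\}$, the local weight $w^f(\sigma)$ is: $g_xg_y$, resp. $\sqrt{g_xg_y}\sqrt{g_xg_y+g_ug_v}$, if the arcs turn around $u$ and $v$ and have equal, resp. different, colours; $g_ug_v$, resp. $\sqrt{g_ug_v}\sqrt{g_xg_y+g_ug_v}$, if they turn around $x$ and $y$ and have equal, resp. different, colours; and $\sqrt{g_xg_yg_ug_v}$ if they cross. Then $\Sigma(U)$ is finite and, for each $\sigma\in\Sigma(U)$, $N_\sigma$ is finite and all but finitely many of the vertex variables $g_x$ and of the face variables $\sqrt{g_xg_y+g_ug_v}$ have total exponent $0$ in the formal product below, so that $$\mathcal Y^U_{\mathrm{taut}}(g)=\sum_{\sigma\in\Sigma(U)}2^{N_\sigma}\Big(\prod_{f\in F(U)}w^f(\sigma)\Big)\Big(\prod_{x\in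 V(U)}g_x^{-2}\Big)$$ is well defined. Theorem. The values $(g_x)_{x\in V(U)}$ extend to the points of $\mathbb Z_{\le 0}^3\setminus U$ by Kashaev's recurrence: for every cube $C_c\subset U_0$ that is not in $U$, with the notation $g=g_c$, $g_i=g_{c+e_i}$, $g_{ij}=g_{c+e_i+e_j}$, $g_{123}=g_{c+e_1+e_2+e_3}$, $$g_{123}=\frac{2g_1g_2g_3+g(g_1g_{23}+g_2g_{13}+g_3g_{12})+2XYZ}{g^2},$$ where $X=\sqrt{gg_{23}+g_2g_3}$, $Y=\sqrt{gg_{13}+g_1g_3}$, $Z=\sqrt{gg_{12}+g_1g_2}$. For every such extension, the value at the origin is $$g_{(0,0,0)}=\mathcal Y^U_{\mathrm{taut}}(g).$$ -/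

import Mathlib

namespace KashaevLoops

/-- The lattice of integer points of three-space. -/
abbrev Point : Type := Fin 3 → ℤ

/-- The canonical basis vectors. -/
def e (i : Fin 3) : Point := Pi.single i 1

/-- A stepped solid is a union of unit cubes `C_c = ∏ i, [c i, c i + 1]`.  It is encoded by the
set of the lower corners `c` of its cubes. -/
abbrev SteppedSolid : Type := Set Point

/-- If a cube is in the solid, so is every cube that is coordinatewise below it. -/
def IsMonotone (U : SteppedSolid) : Prop :=
  ∀ c ∈ U, ∀ d : Point, (∀ i, d i ≤ c i) → d ∈ U

/-- The cubes of the negative corner `(-∞, 0]³`. -/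
def negativeCorner : SteppedSolid := {c | ∀ i, c i + 1 ≤ 0}

/-- The solid is contained in the negative corner and misses only finitely many of its cubes. -/
def IsRegular (U : SteppedSolid) : Prop :=
  U ⊆ negativeCorner ∧ (negativeCorner \ U).Finite

/-- The integer point `x` belongs to (some closed unit cube of) the solid. -/
def HasPoint (U : SteppedSolid) (x : Point) : Prop :=
  ∃ c ∈ U, ∀ i, c i ≤ x i ∧ x i ≤ c i + 1

/-- The vertices of the stepped surface. -/
def vertices (U : SteppedSolid) : Set Point :=
  {x | HasPoint U x ∧ ¬ HasPoint U (x + e 0 + e 1 + e 2)}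

/-- The lattice edge `{x, x + e i}` is encoded by `(x, i)`. -/
abbrev LatticeEdge : Type := Point × Fin 3

/-- The edges of the stepped surface; they are also the dual edges, which the loops use. -/
def edges (U : SteppedSolid) : Set LatticeEdge :=
  {a | a.1 ∈ vertices U ∧ a.1 + e a.2 ∈ vertices U}

/-- The lattice square orthogonal to `e k` with lowest corner `x` is encoded by `(x, k)`. Its
corners are `x`, `x + e (k+1)`, `x + e (k+2)` and `x + e (k+1) + e (k+2)`, with the indices
modulo `3`. -/
abbrev LatticeSquare : Type := Point × Fin 3

/-- The faces of the stepped surface of a monotone solid: the squares `(x, k)` of its topological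
boundary, that is, those that separate a cube `x - e k` of the solid from a cube `x` outside. -/
def faces (U : SteppedSolid) : Set LatticeSquare :=
  {f | f.1 - e f.2 ∈ U ∧ f.1 ∉ U}

/-- The four corners of a square: lowest, the two intermediate ones, and highest. -/
inductive Corner
  | low | first | second | high
  deriving DecidableEq

instance : Fintype Corner where
  elems := {.low, .first, .second, .high}
  complete := by rintro (_ | _ | _ | _) <;> simp

/-- The position of a corner of a square orthogonal to `e k`, relative to the lowest corner. -/
def Corner.offset (k : Fin 3) : Corner → Point
  | .low => 0
  | .first => e (k + 1)
  | .second => e (k + 2)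
  | .high => e (k + 1) + e (k + 2)

/-- A corner of a square as a lattice point. -/
def corner (f : LatticeSquare) (v : Corner) : Point := f.1 + v.offset f.2

/-- The four sides of a square, named by their two endpoints. -/
inductive Side
  | lowFirst | lowSecond | firstHigh | secondHigh
  deriving DecidableEq

/-- A side of a square as a lattice edge. -/
def side (f : LatticeSquare) : Side → LatticeEdge
  | .lowFirst => (f.1, f.2 + 1)
  | .lowSecond => (f.1, f.2 + 2)
  | .firstHigh => (f.1 + e (f.2 + 1), f.2 + 2)
  | .secondHigh => (f.1 + e (f.2 + 2), f.2 + 1)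

/-- The two colours of the loops. -/
inductive Colour
  | red | blue
  deriving DecidableEq

/-- The other colour. -/
def Colour.swap : Colour → Colour
  | .red => .blue
  | .blue => .red

/-- The ten local configurations at a face. The four sides are joined in pairs by two coloured
arcs inside the face; arcs that cross have different colours.
* `turnLowHigh c d`: one arc of colour `c` turns around the lowest corner and one arc of colour
  `d` turns around the highest corner.
* `turnMiddle c d`: one arc of colour `c` turns around the corner `first` and one arc of colour
  `d` turns around the corner `second`.
* `cross c`: opposite sides are joined; the arc from `lowFirst` to `secondHigh` has colour `c`
  and the arc from `lowSecond` to `firstHigh` has the other colour. -/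
inductive LocalConfig
  | turnLowHigh (c d : Colour)
  | turnMiddle (c d : Colour)
  | cross (c : Colour)
  deriving DecidableEq

/-- The colour of the arc that ends at a given side. -/
def LocalConfig.colour : LocalConfig → Side → Colour
  | .turnLowHigh c _, .lowFirst => c
  | .turnLowHigh c _, .lowSecond => c
  | .turnLowHigh _ d, .firstHigh => d
  | .turnLowHigh _ d, .secondHigh => d
  | .turnMiddle c _, .lowFirst => c
  | .turnMiddle c _, .firstHigh => c
  | .turnMiddle _ d, .lowSecond => d
  | .turnMiddle _ d, .secondHigh => d
  | .cross c, .lowFirst => c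
  | .cross c, .secondHigh => c
  | .cross c, .lowSecond => c.swap
  | .cross c, .firstHigh => c.swap

/-- The other end of the arc that starts at a given side. -/
def LocalConfig.partner : LocalConfig → Side → Side
  | .turnLowHigh _ _, .lowFirst => .lowSecond
  | .turnLowHigh _ _, .lowSecond => .lowFirst
  | .turnLowHigh _ _, .firstHigh => .secondHigh
  | .turnLowHigh _ _, .secondHigh => .firstHigh
  | .turnMiddle _ _, .lowFirst => .firstHigh
  | .turnMiddle _ _, .firstHigh => .lowFirst
  | .turnMiddle _ _, .lowSecond => .secondHigh
  | .turnMiddle _ _, .secondHigh => .lowSecond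
  | .cross _, .lowFirst => .secondHigh
  | .cross _, .secondHigh => .lowFirst
  | .cross _, .lowSecond => .firstHigh
  | .cross _, .firstHigh => .lowSecond

/-- A choice of a local configuration at every face. -/
abbrev FaceLabelling (U : SteppedSolid) : Type := faces U → LocalConfig

/-- A face labelling is a two-colour loop configuration when the colours agree along every edge
at which two faces are glued. -/
def IsLoopConfig {U : SteppedSolid} (σ : FaceLabelling U) : Prop :=
  ∀ (f h : faces U) (s t : Side), side f.1 s = side h.1 t → (σ f).colour s = (σ h).colour t

/-- The graph on the dual edges in which two dual edges are adjacent when an arc of `σ` inside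
some face joins them. Its connected components are the paths and loops of `σ`. -/
def linkGraph {U : SteppedSolid} (σ : FaceLabelling U) : SimpleGraph (edges U) :=
  SimpleGraph.fromRel fun a b =>
    ∃ (f : faces U) (s : Side), a.1 = side f.1 s ∧ b.1 = side f.1 ((σ f).partner s)

/-- The loops of `σ`: the finite ones among its connected curves. -/
def loops {U : SteppedSolid} (σ : FaceLabelling U) : Set (linkGraph σ).ConnectedComponent :=
  {K | K.supp.Finite}

/-- The two dual edges lie on the surface and are connected by a path of `σ`. -/
def ConnectedIn {U : SteppedSolid} (σ : FaceLabelling U) (a b : LatticeEdge) : Prop :=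
  ∃ (ha : a ∈ edges U) (hb : b ∈ edges U), (linkGraph σ).Reachable ⟨a, ha⟩ ⟨b, hb⟩

/-- The initial configuration on the surface of the negative corner: everything is blue, and in
every face the two arcs turn around the two intermediate corners. -/
def initialConfig : FaceLabelling negativeCorner :=
  fun _ => .turnMiddle .blue .blue

/-- The point `x` is outside the closed Euclidean ball of radius `R` around the origin. -/
def OutsideBall (R : ℝ) (x : Point) : Prop := R ^ 2 < ∑ i, (x i : ℝ) ^ 2

/-- A loop configuration is taut if, for some ball outside which the surface is that of the
negative corner, it is equal to the initial configuration outside the ball, and any two edges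
outside the ball that are connected in the initial configuration are connected in it. -/
def IsTaut {U : SteppedSolid} (σ : FaceLabelling U) : Prop :=
  IsLoopConfig σ ∧ ∃ R : ℝ, 0 ≤ R ∧
    (∀ x, OutsideBall R x → (x ∈ vertices U ↔ x ∈ vertices negativeCorner)) ∧
    (∀ (f : LatticeSquare) (hf : f ∈ faces U) (hf0 : f ∈ faces negativeCorner),
      (∀ v, OutsideBall R (corner f v)) → σ ⟨f, hf⟩ = initialConfig ⟨f, hf0⟩) ∧
    (∀ a b : LatticeEdge, OutsideBall R a.1 → OutsideBall R (a.1 + e a.2) →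
      OutsideBall R b.1 → OutsideBall R (b.1 + e b.2) →
      ConnectedIn initialConfig a b → ConnectedIn σ a b)

/-- The taut configurations. -/
def tautConfigs (U : SteppedSolid) : Set (FaceLabelling U) := {σ | IsTaut σ}

/-- The face variable `√(g_x g_y + g_u g_v)`, with `x, y` and `u, v` the opposite corners. -/
noncomputable def faceVar (g : Point → ℝ) (f : LatticeSquare) : ℝ :=
  √(g (corner f .low) * g (corner f .high) + g (corner f .first) * g (corner f .second))

/-- The local weight of a local configuration at a face. -/
noncomputable def localWeight (g : Point → ℝ) (f : LatticeSquare) : LocalConfig → ℝ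
  | .turnLowHigh c d =>
      if c = d then g (corner f .first) * g (corner f .second)
      else √(g (corner f .first) * g (corner f .second)) * faceVar g f
  | .turnMiddle c d =>
      if c = d then g (corner f .low) * g (corner f .high)
      else √(g (corner f .low) * g (corner f .high)) * faceVar g f
  | .cross _ =>
      √(g (corner f .low) * g (corner f .high) * g (corner f .first) * g (corner f .second))

/-- Twice the exponent with which the variable at a corner occurs in the local weight. -/
def LocalConfig.cornerExp : LocalConfig → Corner → ℕ
  | .turnLowHigh c d, .first => if c = d then 2 else 1
  | .turnLowHigh c d, .second => if c = d then 2 else 1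
  | .turnLowHigh _ _, .low => 0
  | .turnLowHigh _ _, .high => 0
  | .turnMiddle c d, .low => if c = d then 2 else 1
  | .turnMiddle c d, .high => if c = d then 2 else 1
  | .turnMiddle _ _, .first => 0
  | .turnMiddle _ _, .second => 0
  | .cross _, _ => 1

/-- The exponent with which the face variable occurs in the local weight. -/
def LocalConfig.faceExp : LocalConfig → ℕ
  | .turnLowHigh c d => if c = d then 0 else 1
  | .turnMiddle c d => if c = d then 0 else 1
  | .cross _ => 0

/-- The exponents above are those of the local weights. -/
theorem localWeight_eq (g : Point → ℝ) (f : LatticeSquare) (hg : ∀ v, 0 ≤ g (corner f v))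
    (c : LocalConfig) :
    localWeight g f c = (∏ v, √(g (corner f v)) ^ c.cornerExp v) * faceVar g f ^ c.faceExp := by
  have key : ∀ F : Corner → ℝ, ∏ v, F v = F .low * F .first * F .second * F .high := by
    intro F
    have h : (Finset.univ : Finset Corner) = {.low, .first, .second, .high} := rfl
    rw [h]
    simp [mul_assoc]
  rw [key]
  have h1 := hg .low
  have h2 := hg .first
  have h3 := hg .second
  have h4 := hg .high
  cases c with
  | turnLowHigh c d =>
    by_cases h : c = d <;>
      simp [localWeight, LocalConfig.cornerExp, LocalConfig.faceExp, Real.sq_sqrt, *]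
  | turnMiddle c d =>
    by_cases h : c = d <;>
      simp [localWeight, LocalConfig.cornerExp, LocalConfig.faceExp, Real.sq_sqrt, *]
  | cross c =>
    simp only [localWeight, LocalConfig.cornerExp, LocalConfig.faceExp, pow_one, pow_zero, mul_one]
    rw [Real.sqrt_mul (by positivity), Real.sqrt_mul (by positivity), Real.sqrt_mul h1]
    ring

open Classical in
/-- Twice the exponent of the variable `g x` in the formal product of all the local weights of
`σ` and of all the factors `g x ^ (-2)`. The sum runs over the faces that have `x` as a corner. -/
noncomputable def vertexExp {U : SteppedSolid} (σ : FaceLabelling U) (x : Point) : ℤ :=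
  (∑ k : Fin 3, ∑ v : Corner,
    if h : ((x - v.offset k, k) : LatticeSquare) ∈ faces U then
      ((σ ⟨(x - v.offset k, k), h⟩).cornerExp v : ℤ)
    else 0) - 4

/-- The weight `2 ^ (number of loops) * ∏ f, w f * ∏ x, g x ^ (-2)` of a taut configuration. The
two infinite products are multiplied formally: the exponents of each vertex variable and of each
face variable are collected, and all but finitely many of them are zero. -/
noncomputable def tautWeight {U : SteppedSolid} (g : Point → ℝ) (σ : FaceLabelling U) : ℝ :=
  2 ^ (loops σ).ncard * (∏ᶠ x : vertices U, √(g x) ^ vertexExp σ x) *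
    ∏ᶠ f : faces U, faceVar g f ^ (σ f).faceExp

/-- The renormalized partition function of the taut configurations. It depends only on the
values of `g` at the vertices of the stepped surface. -/
noncomputable def tautPartition (U : SteppedSolid) (g : Point → ℝ) : ℝ :=
  ∑ᶠ σ ∈ tautConfigs U, tautWeight g σ

/-- The recurrence that gives the value at the highest corner of the cube `c` from the values at
the seven other corners. -/
def RecurrenceAt (G : Point → ℝ) (c : Point) : Prop :=
  let g := G c
  let g1 := G (c + e 0)
  let g2 := G (c + e 1)
  let g3 := G (c + e 2)
  let g12 := G (c + e 0 + e 1)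
  let g13 := G (c + e 0 + e 2)
  let g23 := G (c + e 1 + e 2)
  let X := √(g * g23 + g2 * g3)
  let Y := √(g * g13 + g1 * g3)
  let Z := √(g * g12 + g1 * g2)
  G (c + e 0 + e 1 + e 2) =
    (2 * g1 * g2 * g3 + g * (g1 * g23 + g2 * g13 + g3 * g12) + 2 * X * Y * Z) / g ^ 2

/-- `G` extends the initial values `g` on the vertices of the stepped surface by means of the
recurrence at all cubes of the negative corner that are missing in the solid. (The values of `G`
at other points than the corners of these cubes and the vertices play no role.) -/
def IsSolution (U : SteppedSolid) (g G : Point → ℝ) : Prop :=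
  (∀ x ∈ vertices U, G x = g x) ∧ ∀ c ∈ negativeCorner \ U, RecurrenceAt G c

end KashaevLoops

/-! The missing cubes are added one at a time. Adding a minimal missing cube `c` (a flip) replaces
the three faces around the vertex `c` by the three faces around the opposite vertex `c + 1`, without
changing the hexagon that bounds them. The partition function is invariant under a flip if the value
at `c + 1` is given by the recurrence, so an induction on the number of missing cubes reduces
everything to the negative corner. There the only taut configuration is `initialConfig`, whose
weight is the value at the origin. Finiteness of all the sums and products is carried back along the
flips.

Flip invariance. Fix the configuration outside the hexagon. The outside sees only the colours of the
six boundary edges and the way in which the three inner faces connect them. These data determine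
tautness (`IsFlip.isTaut_glueLabelling_congr`) and, up to a possible loop inside the hexagon, the
number of loops (`IsGluing.encard_finiteClasses`). It remains to compare, for fixed boundary data,
the sums of the local weights below and above the cube. In terms of the square roots of the values
and of the face variables these are sums of monomials, and an exhaustive check
(`allTriples_isMultiple`) shows that each comparison is a monomial multiple of one of sixteen basic
identities. These are consequences of the recurrence (`CubeRelations.single`,
`CubeRelations.double`, `CubeRelations.triple`, `CubeRelations.kashaev_true`). `sum_triples`
assembles the local statement, and `IsFlip.wellDefined_and_tautPartition` the global one.

The corner. Outside a large box a taut configuration is initial: its arcs follow diagonals, which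
enter the box at the far edges. Tautness joins each far edge to a far edge of another coordinate
plane. As a curve has at most two ends, two far edges of the same plane are never joined. To reach
another plane, the curve of a far edge must meet each level `p + q = l` of its own plane, completed
to a cut by far edges and axis edges. The cut has exactly as many edges as the plane has far edges,
so by counting each edge lies on the curve of a far edge, and the edges of one level lie on
different curves. Hence all edges are blue, so no arcs cross, and no arc joins two edges of the same
level. Only `initialConfig` remains (`eq_initialConfig`). -/

namespace KashaevLoops

/-! ### The hexagon around a cube: combinatorics -/

/-- The edges of the three visible faces of a cube. The pair `(i, j)` with `i ≠ j` is the edge of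
direction `j` that starts at the `i`-th neighbour of the lowest corner; these six edges form the
boundary of the hexagon. The pair `(i, i)` is the inner edge of direction `i`. -/
abbrev LocalEdge : Type := Fin 3 × Fin 3

/-- The sides of the `k`-th visible face of a cube, seen from below (`false`) or above (`true`). -/
def localSide : Bool → Fin 3 → Side → LocalEdge
  | false, k, .lowFirst => (k + 1, k + 1)
  | false, k, .lowSecond => (k + 2, k + 2)
  | false, k, .firstHigh => (k + 1, k + 2)
  | false, k, .secondHigh => (k + 2, k + 1)
  | true, k, .lowFirst => (k, k + 1)
  | true, k, .lowSecond => (k, k + 2)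
  | true, k, .firstHigh => (k + 2, k + 2)
  | true, k, .secondHigh => (k + 1, k + 1)

/-- The other occurrence of an inner side. -/
def across : Bool → Fin 3 → Side → Fin 3 × Side
  | false, k, .lowFirst => (k + 2, .lowSecond)
  | false, k, .lowSecond => (k + 1, .lowFirst)
  | true, k, .firstHigh => (k + 1, .secondHigh)
  | true, k, .secondHigh => (k + 2, .firstHigh)
  | _, k, t => (k, t)

/-- An occurrence of a local edge as the side of a face. -/
def occurrence : Bool → LocalEdge → Fin 3 × Side
  | false, (i, j) =>
      if i = j then (i + 2, .lowFirst)
      else if j = i + 1 then (i + 2, .firstHigh) else (i + 1, .secondHigh)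
  | true, (i, j) =>
      if i = j then (i + 1, .firstHigh)
      else if j = i + 1 then (i, .lowFirst) else (i, .lowSecond)

/-- A triple of local configurations at the three visible faces of a cube. -/
abbrev Triple : Type := Fin 3 → LocalConfig

/-- The local edge at which an arc entering a face leaves the hexagon, for `n` large enough. -/
def exitEdge (b : Bool) (s : Triple) : ℕ → Fin 3 → Side → LocalEdge
  | 0, k, t => localSide b k t
  | n + 1, k, t =>
      let l := localSide b k ((s k).partner t)
      if l.1 = l.2 then
        let p := across b k ((s k).partner t)
        exitEdge b s n p.1 p.2
      else l

/-- An injective numbering of the boundary edges of the hexagon. -/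
def rank (l : LocalEdge) : ℕ := 3 * l.1.val + l.2.val

/-- A number that characterizes the arc of the hexagon to which a local edge belongs; it is `9`
for the edges of an inner loop. -/
def arcLabel (b : Bool) (s : Triple) (l : LocalEdge) : ℕ :=
  let p := occurrence b l
  let o := exitEdge b s 4 p.1 p.2
  if l.1 = l.2 then
    if o.1 = o.2 then 9
    else
      let q := occurrence b o
      min (rank o) (rank (exitEdge b s 4 q.1 q.2))
  else min (rank l) (rank o)

/-- The colour of a triple at a local edge. -/
def localColour (b : Bool) (s : Triple) (l : LocalEdge) : Colour :=
  (s (occurrence b l).1).colour (occurrence b l).2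

/-- The colours of a triple agree along the inner edges. -/
def LocalValid (b : Bool) (s : Triple) : Prop :=
  ∃ γ : LocalEdge → Colour, ∀ k t, (s k).colour t = γ (localSide b k t)

/-- The list of the local configurations. -/
def localConfigs : List LocalConfig :=
  [.turnLowHigh .red .red, .turnLowHigh .red .blue, .turnLowHigh .blue .red,
    .turnLowHigh .blue .blue, .turnMiddle .red .red, .turnMiddle .red .blue,
    .turnMiddle .blue .red, .turnMiddle .blue .blue, .cross .red, .cross .blue]

instance : Fintype LocalConfig where
  elems := ⟨localConfigs, by decide⟩
  complete := by rintro (⟨_ | _, _ | _⟩ | ⟨_ | _, _ | _⟩ | ⟨_ | _⟩) <;> decide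

/-- A colour as a Boolean. -/
def Colour.isRed : Colour → Bool
  | .red => true
  | .blue => false

/-- The local configurations of a face whose sides have given colours. -/
def configsWith (b : Bool) (γ : LocalEdge → Colour) (k : Fin 3) : List LocalConfig :=
  localConfigs.filter fun c => [Side.lowFirst, .lowSecond, .firstHigh, .secondHigh].all
    fun t => (c.colour t).isRed == (γ (localSide b k t)).isRed

/-- The colouring of the local edges with given colours on the boundary and inside. -/
def mergeColours (γ : LocalEdge → Colour) (δ : Fin 3 → Colour) (l : LocalEdge) : Colour :=
  if l.1 = l.2 then δ l.1 else γ l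

/-- The list of the colourings of the inner edges. -/
def innerColours : List (Fin 3 → Colour) :=
  [.red, .blue].flatMap fun x => [.red, .blue].flatMap fun y => [.red, .blue].map fun z => ![x, y, z]

/-- The valid triples that have given colours on the boundary. -/
def triplesWith (b : Bool) (γ : LocalEdge → Colour) : List Triple :=
  innerColours.flatMap fun δ =>
    (configsWith b (mergeColours γ δ) 0).flatMap fun x =>
      (configsWith b (mergeColours γ δ) 1).flatMap fun y =>
        (configsWith b (mergeColours γ δ) 2).map fun z => ![x, y, z]

/-- The boundary edges of the hexagon. -/
def boundaryEdges : List LocalEdge := [(0, 1), (0, 2), (1, 0), (1, 2), (2, 0), (2, 1)]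

/-- The connections of the boundary edges in a triple. -/
def connections (b : Bool) (s : Triple) : List ℕ := boundaryEdges.map (arcLabel b s)

/-- The colouring of the boundary edges by a list of colours. -/
def boundaryColours (x : Fin 6 → Colour) (l : LocalEdge) : Colour :=
  x (if l.2 = l.1 + 1 then ⟨l.1.val, by omega⟩ else ⟨3 + l.1.val, by omega⟩)

/-- The inner edges of the hexagon form a loop. -/
def hasInnerLoop (s : Triple) : Bool :=
  (List.finRange 3).all fun k =>
    match s k with
    | .turnLowHigh _ _ => true
    | _ => false

/-! ### Monomials and the basic identities between them. -/

/-- The variables of the local weights at a cube: the square roots of the values at the lowest and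
highest corners, at the neighbours `c + e i` of the lowest corner and `c + e j + e k` of the
highest corner; the face variables; and the loop weight. -/
inductive Var
  | pole (b : Bool)
  | node (b : Bool) (i : Fin 3)
  | face (b : Bool) (i : Fin 3)
  | two
  deriving DecidableEq

/-- The list of the variables. -/
def vars : List Var :=
  [.pole false, .pole true, .node false 0, .node false 1, .node false 2, .node true 0,
    .node true 1, .node true 2, .face false 0, .face false 1, .face false 2, .face true 0,
    .face true 1, .face true 2, .two]

instance : Fintype Var where
  elems := ⟨vars, by decide⟩
  complete := by
    rintro (b | ⟨b, i⟩ | ⟨b, i⟩ | _)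
    · cases b <;> decide
    · cases b <;> fin_cases i <;> decide
    · cases b <;> fin_cases i <;> decide
    · decide

/-- The variable at a corner of a visible face. -/
def cornerVar : Bool → Fin 3 → Corner → Var
  | false, _, .low => .pole false
  | false, k, .first => .node false (k + 1)
  | false, k, .second => .node false (k + 2)
  | false, k, .high => .node true k
  | true, k, .low => .node false k
  | true, k, .first => .node true (k + 2)
  | true, k, .second => .node true (k + 1)
  | true, _, .high => .pole true

/-- The position of a variable in the list. -/
def Var.index : Var → ℕ
  | .pole b => b.toNat
  | .node b i => 3 * b.toNat + (2 + i.val)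
  | .face b i => 3 * b.toNat + (8 + i.val)
  | .two => 14

/-- Exponent vectors of monomials. -/
abbrev Monomial : Type := Var → ℕ

/-- The power of a variable. -/
def Var.power (x : Var) (n : ℕ) : Monomial := fun y =>
  bif y.index == x.index then n else 0

/-- The monomial of a local configuration. -/
def faceMonomial (b : Bool) (k : Fin 3) (c : LocalConfig) : Monomial := fun x =>
  (cornerVar b k .low).power (c.cornerExp .low) x +
    (cornerVar b k .first).power (c.cornerExp .first) x +
    (cornerVar b k .second).power (c.cornerExp .second) x +
    (cornerVar b k .high).power (c.cornerExp .high) x +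
    (Var.face b k).power c.faceExp x

/-- The monomial of a triple, multiplied by the square of the value at the opposite pole. -/
def tripleMonomial (b : Bool) (s : Triple) : Monomial := fun x =>
  (Var.pole (!b)).power 4 x + (faceMonomial b 0 (s 0) x + faceMonomial b 1 (s 1) x +
    faceMonomial b 2 (s 2) x) + Var.two.power (if hasInnerLoop s then 1 else 0) x

/-- The monomial with the given list of variables. -/
def ofVars (l : List Var) : Monomial := fun x => (l.map fun y => y.power 1 x).sum

/-- The basic identities between the face variables below and above a cube. -/
inductive BasicIdentity
  | trivial
  | kashaev (b : Bool)
  | single (b : Bool) (i : Fin 3)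
  | double (b : Bool) (i : Fin 3)
  | triple

open Var in
/-- The Kashaev relation between the poles. -/
def kashaevTerms (b : Bool) : List Monomial :=
  [ofVars [two, node b 0, node b 0, node b 1, node b 1, node b 2, node b 2],
    ofVars [pole b, pole b, node b 0, node b 0, node (!b) 0, node (!b) 0],
    ofVars [pole b, pole b, node b 1, node b 1, node (!b) 1, node (!b) 1],
    ofVars [pole b, pole b, node b 2, node b 2, node (!b) 2, node (!b) 2],
    ofVars [two, face b 0, face b 1, face b 2]]

open Var in
/-- The right-hand side of the Kashaev relation between the poles. -/
def kashaevValue (b : Bool) : List Monomial :=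
  [ofVars [pole b, pole b, pole b, pole b, pole (!b), pole (!b)]]

open Var in
/-- The two terms of the relation between single face variables. -/
def singleTerms (b : Bool) (i : Fin 3) : List Monomial :=
  [ofVars [node b i, node b i, face b i], ofVars [face b (i + 1), face b (i + 2)]]

open Var in
/-- The value of the relation between single face variables. -/
def singleValue (b : Bool) (i : Fin 3) : List Monomial :=
  [ofVars [pole b, pole b, face (!b) i]]

open Var in
/-- The terms of the relation for the product of two face variables. -/
def doubleTerms (b : Bool) (i : Fin 3) : List Monomial :=
  [ofVars [two, node b i, node b i, node b (i + 1), node b (i + 1), node b (i + 2),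
      node b (i + 2), face b i],
    ofVars [pole b, pole b, node b (i + 1), node b (i + 1), node (!b) (i + 1), node (!b) (i + 1),
      face b i],
    ofVars [pole b, pole b, node b (i + 2), node b (i + 2), node (!b) (i + 2), node (!b) (i + 2),
      face b i],
    ofVars [two, node b (i + 1), node b (i + 1), node b (i + 2), node b (i + 2), face b (i + 1),
      face b (i + 2)],
    ofVars [pole b, pole b, node (!b) i, node (!b) i, face b (i + 1), face b (i + 2)]]

open Var in
/-- The value of the relation for the product of two face variables. -/
def doubleValue (b : Bool) (i : Fin 3) : List Monomial :=
  [ofVars [pole b, pole b, pole b, pole b, face (!b) (i + 1), face (!b) (i + 2)]]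

open Var in
/-- One side of the relation between the products of the face variables. -/
def tripleTerms (b : Bool) : List Monomial :=
  [ofVars [pole (!b), pole (!b), node b 0, node b 0, node b 1, node b 1, node b 2, node b 2],
    ofVars [pole (!b), pole (!b), face b 0, face b 1, face b 2]]

/-- The side `b` of a basic identity. -/
def BasicIdentity.terms : BasicIdentity → Bool → List Monomial
  | trivial, _ => [ofVars []]
  | kashaev b, b' => if b = b' then kashaevTerms b else kashaevValue b
  | single b i, b' => if b = b' then singleTerms b i else singleValue b i
  | double b i, b' => if b = b' then doubleTerms b i else doubleValue b i
  | triple, b => tripleTerms b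

/-- The list of the basic identities. -/
def basicIdentities : List BasicIdentity :=
  [.trivial, .kashaev false, .kashaev true, .single false 0, .single false 1, .single false 2,
    .single true 0, .single true 1, .single true 2, .double false 0,
    .double false 1, .double false 2, .double true 0, .double true 1, .double true 2, .triple]

/-- The exponents of a monomial as a list. -/
def Monomial.toList (m : Monomial) : List ℕ := vars.map m

/-- The greatest common divisor of a nonempty list of monomials. -/
def commonFactor (l : List Monomial) (x : Var) : ℕ := (l.map (· x)).foldr min 100

/-- The monomials of the triples with given colours and connections on the boundary. -/
def connectionTerms (b : Bool) (γ : LocalEdge → Colour) (p : List ℕ) : List Monomial :=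
  ((triplesWith b γ).filter fun s => connections b s == p).map (tripleMonomial b)

/-- The sums of monomials on both sides are a common multiple of a basic identity. -/
def isMultiple (A B : List Monomial) (t : BasicIdentity) : Bool :=
  A.length == (t.terms false).length && B.length == (t.terms true).length &&
  let m : Monomial := fun x => commonFactor A x - commonFactor (t.terms false) x
  (A.map Monomial.toList).isPerm ((t.terms false).map fun n => Monomial.toList fun x => m x + n x) &&
    (B.map Monomial.toList).isPerm ((t.terms true).map fun n => Monomial.toList fun x => m x + n x)

/-- The list of the colourings of the boundary. -/
def colourings : List (Fin 6 → Colour) :=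
  innerColours.flatMap fun x => innerColours.map fun y => ![x 0, x 1, x 2, y 0, y 1, y 2]

/-! ### Exhaustive checks over the valid triples. -/

/-- A Boolean predicate holds for all valid triples. -/
def allTriples (b : Bool) (p : (Fin 6 → Colour) → Triple → Bool) : Bool :=
  colourings.all fun x => (triplesWith b (boundaryColours x)).all (p x)

/-- The computational core of flip invariance: every boundary pattern realized below the cube is
reduced to one of the sixteen basic identities. Only monomials are compared here; the real values of
the variables enter later. -/
theorem allTriples_isMultiple : (allTriples false fun x s => basicIdentities.any fun t =>
    isMultiple (connectionTerms false (boundaryColours x) (connections false s))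
      (connectionTerms true (boundaryColours x) (connections false s)) t) = true := by
  decide +kernel

/-- Complements the previous check, which runs over patterns realized below only: no pattern occurs
above the cube alone, so no term of the upper sum is missed. -/
theorem allTriples_connectionTerms_ne_nil : (allTriples true fun x s =>
    !(connectionTerms false (boundaryColours x) (connections true s)).isEmpty) = true := by
  decide +kernel

/-- The list of all sides. -/
def sides : List Side := [.lowFirst, .lowSecond, .firstHigh, .secondHigh]

/-- Makes the label an invariant of the curves in the hexagon. It also certifies that four steps of
`exitEdge` are enough for the purpose of the labels; no separate bound is needed. -/
theorem allTriples_arcLabel (b : Bool) : (allTriples b fun _ s => (List.finRange 3).all fun k =>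
    sides.all fun t => arcLabel b s (localSide b k t) ==
      arcLabel b s (localSide b k ((s k).partner t))) = true := by
  cases b <;> decide +kernel

theorem allTriples_exitEdge (b : Bool) : (allTriples b fun _ s => (List.finRange 3).all fun i =>
    hasInnerLoop s || decide ((exitEdge b s 4 (occurrence b (i, i)).1 (occurrence b (i, i)).2).1 ≠
      (exitEdge b s 4 (occurrence b (i, i)).1 (occurrence b (i, i)).2).2)) = true := by
  cases b <;> decide +kernel

/-- Needed to turn sums over lists into sums over finite sets. -/
theorem nodup_triplesWith_boundaryColours (b : Bool) :
    (colourings.all fun x => decide (triplesWith b (boundaryColours x)).Nodup) = true := by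
  cases b <;> decide +kernel

end KashaevLoops

namespace KashaevLoops

/-! ### The hexagon around a cube: connections -/

/-- Two local edges are the ends of an arc of the triple. -/
def arcRel (b : Bool) (s : Triple) (l l' : LocalEdge) : Prop :=
  ∃ k t, l = localSide b k t ∧ l' = localSide b k ((s k).partner t)

theorem localSide_occurrence (b : Bool) (l : LocalEdge) :
    localSide b (occurrence b l).1 (occurrence b l).2 = l := by
  obtain ⟨i, j⟩ := l
  cases b <;> fin_cases i <;> fin_cases j <;> rfl

theorem localSide_across (b : Bool) (k : Fin 3) (t : Side) :
    localSide b (across b k t).1 (across b k t).2 = localSide b k t := by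
  cases b <;> cases t <;> fin_cases k <;> rfl

theorem LocalValid.colour_eq {b : Bool} {s : Triple} (h : LocalValid b s) (k : Fin 3) (t : Side) :
    (s k).colour t = localColour b s (localSide b k t) := by
  obtain ⟨γ, hγ⟩ := h
  rw [localColour, hγ, hγ, localSide_occurrence]

/-- Holds for any number of steps: if the steps run out before the boundary, the edge reached is
still on the same curve. -/
theorem eqvGen_exitEdge (b : Bool) (s : Triple) (n : ℕ) (k : Fin 3) (t : Side) :
    Relation.EqvGen (arcRel b s) (localSide b k t) (exitEdge b s n k t) := by
  induction n generalizing k t with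
  | zero => exact .refl _
  | succ n ih =>
    have h : Relation.EqvGen (arcRel b s) (localSide b k t) (localSide b k ((s k).partner t)) :=
      .rel _ _ ⟨k, t, rfl, rfl⟩
    rw [exitEdge]
    simp only
    split_ifs with h1
    · refine h.trans _ _ _ ?_
      have := ih (across b k ((s k).partner t)).1 (across b k ((s k).partner t)).2
      rwa [localSide_across] at this
    · exact h

theorem mem_innerColours (δ : Fin 3 → Colour) : δ ∈ innerColours := by
  have h : δ = ![δ 0, δ 1, δ 2] := by
    ext i; fin_cases i <;> rfl
  rw [h]
  generalize δ 0 = x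
  generalize δ 1 = y
  generalize δ 2 = z
  cases x <;> cases y <;> cases z <;> simp [innerColours]

theorem Colour.isRed_inj {c d : Colour} : c.isRed = d.isRed ↔ c = d := by
  cases c <;> cases d <;> simp [Colour.isRed]

theorem mem_localConfigs (c : LocalConfig) : c ∈ localConfigs := Fintype.complete c

theorem mem_configsWith {b : Bool} {γ : LocalEdge → Colour} {k : Fin 3} {c : LocalConfig} :
    c ∈ configsWith b γ k ↔ ∀ t, c.colour t = γ (localSide b k t) := by
  simp only [configsWith, List.mem_filter, mem_localConfigs, true_and, List.all_cons,
    List.all_nil, Bool.and_true, Bool.and_eq_true, beq_iff_eq, Colour.isRed_inj]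
  constructor
  · rintro ⟨h1, h2, h3, h4⟩ (_ | _ | _ | _) <;> assumption
  · intro h
    exact ⟨h _, h _, h _, h _⟩

theorem triple_eq (s : Triple) : ![s 0, s 1, s 2] = s := by
  ext i; fin_cases i <;> rfl

theorem mem_triplesWith {b : Bool} {γ : LocalEdge → Colour} {s : Triple} :
    s ∈ triplesWith b γ ↔ ∃ δ, ∀ k t, (s k).colour t = mergeColours γ δ (localSide b k t) := by
  simp only [triplesWith, List.mem_flatMap, List.mem_map, mem_configsWith, mem_innerColours,
    true_and]
  constructor
  · rintro ⟨δ, x, hx, y, hy, z, hz, rfl⟩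
    refine ⟨δ, fun k => ?_⟩
    fin_cases k
    exacts [hx, hy, hz]
  · rintro ⟨δ, h⟩
    exact ⟨δ, s 0, h 0, s 1, h 1, s 2, h 2, triple_eq s⟩

theorem mem_triplesWith_iff {b : Bool} {γ : LocalEdge → Colour} {s : Triple} :
    s ∈ triplesWith b γ ↔ LocalValid b s ∧ ∀ l ∈ boundaryEdges, localColour b s l = γ l := by
  have hb : ∀ l : LocalEdge, l ∈ boundaryEdges ↔ l.1 ≠ l.2 := by decide
  rw [mem_triplesWith]
  constructor
  · rintro ⟨δ, h⟩
    refine ⟨⟨_, h⟩, fun l hl => ?_⟩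
    rw [localColour, h, localSide_occurrence, mergeColours, if_neg ((hb l).1 hl)]
  · rintro ⟨h, hγ⟩
    refine ⟨fun i => localColour b s (i, i), fun k t => ?_⟩
    rw [h.colour_eq, mergeColours]
    generalize localSide b k t = l
    split_ifs with h1
    · rw [show (l.1, l.1) = l from Prod.ext rfl h1]
    · exact hγ l ((hb l).2 h1)

theorem mem_boundaryEdges {l : LocalEdge} : l ∈ boundaryEdges ↔ l.1 ≠ l.2 := by
  revert l; decide

theorem mem_colourings (x : Fin 6 → Colour) : x ∈ colourings := by
  simp only [colourings, List.mem_flatMap, List.mem_map, mem_innerColours, true_and]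
  refine ⟨![x 0, x 1, x 2], ![x 3, x 4, x 5], ?_⟩
  ext i; fin_cases i <;> rfl

theorem exists_boundaryColours (γ : LocalEdge → Colour) :
    ∃ x, ∀ l ∈ boundaryEdges, boundaryColours x l = γ l := by
  refine ⟨![γ (0, 1), γ (1, 2), γ (2, 0), γ (0, 2), γ (1, 0), γ (2, 1)], ?_⟩
  simp only [boundaryEdges, List.forall_mem_cons]
  exact ⟨rfl, rfl, rfl, rfl, rfl, rfl, by simp⟩

theorem LocalValid.exists_mem {b : Bool} {s : Triple} (h : LocalValid b s) :
    ∃ x, s ∈ triplesWith b (boundaryColours x) := by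
  obtain ⟨x, hx⟩ := exists_boundaryColours (localColour b s)
  exact ⟨x, mem_triplesWith_iff.2 ⟨h, fun l hl => (hx l hl).symm⟩⟩

theorem allTriples_iff {b : Bool} {p : (Fin 6 → Colour) → Triple → Bool} :
    allTriples b p = true ↔ ∀ x, ∀ s ∈ triplesWith b (boundaryColours x), p x s = true := by
  simp [allTriples, mem_colourings]

theorem LocalValid.arcLabel_eq {b : Bool} {s : Triple} (h : LocalValid b s) {l l' : LocalEdge}
    (hl : Relation.EqvGen (arcRel b s) l l') : arcLabel b s l = arcLabel b s l' := by
  obtain ⟨x, hx⟩ := h.exists_mem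
  induction hl with
  | rel l l' h1 =>
    obtain ⟨k, t, rfl, rfl⟩ := h1
    have h2 := allTriples_iff.1 (allTriples_arcLabel b) x s hx
    simp only [List.all_eq_true, List.mem_finRange, true_implies, beq_iff_eq] at h2
    exact h2 k t (by cases t <;> simp [sides])
  | refl => rfl
  | symm _ _ _ ih => exact ih.symm
  | trans _ _ _ _ _ ih1 ih2 => exact ih1.trans ih2

theorem rank_injective : Function.Injective rank := by
  intro l l'; revert l l'; decide

theorem exists_arcLabel_eq_rank (b : Bool) (s : Triple) {l : LocalEdge} (hl : l.1 ≠ l.2) :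
    ∃ l', Relation.EqvGen (arcRel b s) l l' ∧ arcLabel b s l = rank l' := by
  simp only [arcLabel, if_neg hl]
  rcases min_choice (rank l) (rank (exitEdge b s 4 (occurrence b l).1 (occurrence b l).2))
    with h | h
  · exact ⟨l, .refl _, h⟩
  · refine ⟨_, ?_, h⟩
    have := eqvGen_exitEdge b s 4 (occurrence b l).1 (occurrence b l).2
    rwa [localSide_occurrence] at this

/-- Labels are constant along curves, and the label of a boundary edge is the rank of some edge on
its curve. Since `rank` is injective, equal labels yield a common edge. Thus the list `connections`
decides connectedness. -/
theorem LocalValid.eqvGen_iff {b : Bool} {s : Triple} (h : LocalValid b s) {l l' : LocalEdge}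
    (hl : l.1 ≠ l.2) (hl' : l'.1 ≠ l'.2) :
    Relation.EqvGen (arcRel b s) l l' ↔ arcLabel b s l = arcLabel b s l' := by
  refine ⟨h.arcLabel_eq, fun h1 => ?_⟩
  obtain ⟨x, hx, hx'⟩ := exists_arcLabel_eq_rank b s hl
  obtain ⟨y, hy, hy'⟩ := exists_arcLabel_eq_rank b s hl'
  have : x = y := rank_injective (by rw [← hx', h1, hy'])
  subst this
  exact hx.trans _ _ _ (hy.symm _ _)

theorem hasInnerLoop_iff {s : Triple} :
    hasInnerLoop s = true ↔ ∀ k, ∃ c d, s k = .turnLowHigh c d := by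
  simp only [hasInnerLoop, List.all_eq_true, List.mem_finRange, true_implies]
  refine forall_congr' fun k => ?_
  cases s k <;> simp

/-- An inner loop contains all the inner edges and no boundary edge. -/
theorem eqvGen_of_hasInnerLoop {b : Bool} {s : Triple} (h : hasInnerLoop s = true) (i : Fin 3)
    (l : LocalEdge) : Relation.EqvGen (arcRel b s) (i, i) l ↔ l.1 = l.2 := by
  rw [hasInnerLoop_iff] at h
  constructor
  · intro hl
    -- When all three faces turn around their lowest and highest corners, an arc joins two inner
    -- sides or two boundary sides, never one of each.
    have key : ∀ l l', Relation.EqvGen (arcRel b s) l l' → (l.1 = l.2 ↔ l'.1 = l'.2) := by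
      intro l l' hl
      induction hl with
      | rel l l' h1 =>
        obtain ⟨k, t, rfl, rfl⟩ := h1
        obtain ⟨c, d, hk⟩ := h k
        rw [hk]
        clear hk
        cases b <;> cases t <;> simp only [localSide, LocalConfig.partner] <;> (revert k; decide)
      | refl => rfl
      | symm _ _ _ ih => exact ih.symm
      | trans _ _ _ _ _ ih1 ih2 => exact ih1.trans ih2
    exact (key _ _ hl).1 rfl
  · intro hl
    have step : ∀ i : Fin 3, Relation.EqvGen (arcRel b s) (i, i) (i + 1, i + 1) := by
      intro i
      cases b
      · refine .rel _ _ ⟨i + 2, .lowFirst, ?_, ?_⟩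
        · fin_cases i <;> rfl
        · obtain ⟨c, d, hk⟩ := h (i + 2)
          rw [hk]
          fin_cases i <;> rfl
      · refine .rel _ _ ⟨i + 2, .secondHigh, ?_, ?_⟩
        · fin_cases i <;> rfl
        · obtain ⟨c, d, hk⟩ := h (i + 2)
          rw [hk]
          fin_cases i <;> rfl
    obtain ⟨j, j'⟩ := l
    simp only at hl
    subst hl
    have h3 : j = i ∨ j = i + 1 ∨ j = i + 1 + 1 := by revert i j; decide
    rcases h3 with rfl | rfl | rfl
    · exact .refl _
    · exact step i
    · exact (step i).trans _ _ _ (step _)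

/-- If there is no inner loop, every inner edge is connected to the boundary. -/
theorem LocalValid.exists_boundary {b : Bool} {s : Triple} (h : LocalValid b s)
    (hs : ¬ hasInnerLoop s = true) (i : Fin 3) :
    ∃ l : LocalEdge, l.1 ≠ l.2 ∧ Relation.EqvGen (arcRel b s) (i, i) l := by
  obtain ⟨x, hx⟩ := h.exists_mem
  have h2 := allTriples_iff.1 (allTriples_exitEdge b) x s hx
  simp only [List.all_eq_true, List.mem_finRange, true_implies, Bool.or_eq_true, hs,
    decide_eq_true_eq, Bool.false_eq_true, false_or] at h2
  refine ⟨_, h2 i, ?_⟩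
  have := eqvGen_exitEdge b s 4 (occurrence b (i, i)).1 (occurrence b (i, i)).2
  rwa [localSide_occurrence] at this

end KashaevLoops

namespace KashaevLoops

/-! ### The hexagon around a cube: weights -/

theorem add_one_add_one (i : Fin 3) : i + 1 + 1 = i + 2 := by revert i; decide

theorem add_one_add_two (i : Fin 3) : i + 1 + 2 = i := by revert i; decide

theorem add_two_add_one (i : Fin 3) : i + 2 + 1 = i := by revert i; decide

theorem add_two_add_two (i : Fin 3) : i + 2 + 2 = i + 1 := by revert i; decide

/-- The value of a monomial. -/
noncomputable def Monomial.eval (v : Var → ℝ) (m : Monomial) : ℝ := ∏ x, v x ^ m x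

theorem Monomial.eval_add (v : Var → ℝ) (m n : Monomial) :
    Monomial.eval v (fun x => m x + n x) = m.eval v * n.eval v := by
  simp only [Monomial.eval, pow_add, Finset.prod_mul_distrib]

-- The numerical index lets `Var.power` be evaluated by comparing numbers in the exhaustive checks.
theorem Var.index_injective : Function.Injective Var.index := by
  intro x y; revert x y; decide

theorem Monomial.eval_power (v : Var → ℝ) (x : Var) (n : ℕ) :
    Monomial.eval v (x.power n) = v x ^ n := by
  rw [Monomial.eval, Finset.prod_eq_single x]
  · simp [Var.power]
  · intro y _ hy
    have : y.index ≠ x.index := fun h => hy (Var.index_injective h)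
    simp [Var.power, beq_false_of_ne this]
  · simp

theorem Monomial.eval_ofVars (v : Var → ℝ) (l : List Var) :
    Monomial.eval v (ofVars l) = (l.map v).prod := by
  induction l with
  | nil => simp [Monomial.eval, ofVars]
  | cons y l ih =>
    have : ofVars (y :: l) = fun x => y.power 1 x + ofVars l x := by
      ext x; simp [ofVars]
    rw [this, Monomial.eval_add, Monomial.eval_power, ih]
    simp

/-- The relations between the variables at a cube. -/
structure CubeRelations (v : Var → ℝ) : Prop where
  pos : ∀ x, 0 < v x
  two : v .two = 2
  face_sq : ∀ b i, v (.face b i) ^ 2 = v (.pole b) ^ 2 * v (.node (!b) i) ^ 2 +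
    v (.node b (i + 1)) ^ 2 * v (.node b (i + 2)) ^ 2
  kashaev : 2 * (v (.node false 0) * v (.node false 1) * v (.node false 2)) ^ 2 +
    v (.pole false) ^ 2 * (v (.node false 0) ^ 2 * v (.node true 0) ^ 2 +
      v (.node false 1) ^ 2 * v (.node true 1) ^ 2 +
      v (.node false 2) ^ 2 * v (.node true 2) ^ 2) +
    2 * v (.face false 0) * v (.face false 1) * v (.face false 2) =
    v (.pole false) ^ 4 * v (.pole true) ^ 2

/-- Below the cube both sides are positive, and their squares agree by the recurrence and the
formula for the squared face variables. Above it, the identity is multiplied by the fourth power of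
the lower pole, and the upper face variables are eliminated by means of the case below. -/
theorem CubeRelations.single {v : Var → ℝ} (h : CubeRelations v) (b : Bool) (i : Fin 3) :
    v (.node b i) ^ 2 * v (.face b i) + v (.face b (i + 1)) * v (.face b (i + 2)) =
      v (.pole b) ^ 2 * v (.face (!b) i) := by
  have hf : ∀ i, v (.node false i) ^ 2 * v (.face false i) +
      v (.face false (i + 1)) * v (.face false (i + 2)) = v (.pole false) ^ 2 * v (.face true i) := by
    intro i
    have hk := h.kashaev
    have h1 := h.face_sq false
    have h2 := h.face_sq true i
    have p := h.pos
    have p1 := p (.node false i)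
    have p2 := p (.face false i)
    have p3 := p (.face false (i + 1))
    have p4 := p (.face false (i + 2))
    have p5 := p (.pole false)
    have p6 := p (.face true i)
    refine (pow_left_inj₀ (by positivity) (by positivity) two_ne_zero).1 ?_
    have a0 := h1 0
    have a1 := h1 1
    have a2 := h1 2
    clear h1 p p1 p2 p3 p4 p5 p6
    fin_cases i <;> simp at a0 a1 a2 h2 ⊢
    · linear_combination v (.node false 0) ^ 4 * a0 + v (.face false 2) ^ 2 * a1 +
        (v (.pole false) ^ 2 * v (.node true 1) ^ 2 +
          v (.node false 2) ^ 2 * v (.node false 0) ^ 2) * a2 - v (.pole false) ^ 4 * h2 +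
        v (.node false 0) ^ 2 * hk
    · linear_combination v (.node false 1) ^ 4 * a1 + v (.face false 0) ^ 2 * a2 +
        (v (.pole false) ^ 2 * v (.node true 2) ^ 2 +
          v (.node false 0) ^ 2 * v (.node false 1) ^ 2) * a0 - v (.pole false) ^ 4 * h2 +
        v (.node false 1) ^ 2 * hk
    · linear_combination v (.node false 2) ^ 4 * a2 + v (.face false 1) ^ 2 * a0 +
        (v (.pole false) ^ 2 * v (.node true 0) ^ 2 +
          v (.node false 1) ^ 2 * v (.node false 2) ^ 2) * a1 - v (.pole false) ^ 4 * h2 +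
        v (.node false 2) ^ 2 * hk
  cases b
  · exact hf i
  · have hk := h.kashaev
    have a := h.face_sq false
    have p5 := h.pos (.pole false)
    have f0 := hf 0
    have f1 := hf 1
    have f2 := hf 2
    have a0 := a 0
    have a1 := a 1
    have a2 := a 2
    refine mul_left_cancel₀ (pow_ne_zero 4 p5.ne') ?_
    clear a hf p5
    fin_cases i <;> simp [-mul_eq_mul_left_iff] at a0 a1 a2 f0 f1 f2 ⊢
    · linear_combination -(v (.node true 0) ^ 2 * v (.pole false) ^ 2) * f0 -
        v (.pole false) ^ 2 * v (.face true 2) * f1 -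
        (v (.node false 1) ^ 2 * v (.face false 1) + v (.face false 2) * v (.face false 0)) * f2 -
        v (.face false 1) * v (.face false 2) * a0 + v (.node false 1) ^ 2 * v (.face false 0) * a1 +
        v (.node false 2) ^ 2 * v (.face false 0) * a2 + v (.face false 0) * hk
    · linear_combination -(v (.node true 1) ^ 2 * v (.pole false) ^ 2) * f1 -
        v (.pole false) ^ 2 * v (.face true 0) * f2 -
        (v (.node false 2) ^ 2 * v (.face false 2) + v (.face false 0) * v (.face false 1)) * f0 -
        v (.face false 2) * v (.face false 0) * a1 + v (.node false 2) ^ 2 * v (.face false 1) * a2 +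
        v (.node false 0) ^ 2 * v (.face false 1) * a0 + v (.face false 1) * hk
    · linear_combination -(v (.node true 2) ^ 2 * v (.pole false) ^ 2) * f2 -
        v (.pole false) ^ 2 * v (.face true 1) * f0 -
        (v (.node false 0) ^ 2 * v (.face false 0) + v (.face false 1) * v (.face false 2)) * f1 -
        v (.face false 0) * v (.face false 1) * a2 + v (.node false 0) ^ 2 * v (.face false 2) * a0 +
        v (.node false 1) ^ 2 * v (.face false 2) * a1 + v (.face false 2) * hk

/-- The product of the single relations for `i + 1` and `i + 2`, in which the squares of face
variables are replaced by their values. -/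
theorem CubeRelations.double {v : Var → ℝ} (h : CubeRelations v) (b : Bool) (i : Fin 3) :
    v (.pole b) ^ 4 * v (.face (!b) (i + 1)) * v (.face (!b) (i + 2)) =
      (2 * (v (.node b i) * v (.node b (i + 1)) * v (.node b (i + 2))) ^ 2 +
        v (.pole b) ^ 2 * v (.node b (i + 1)) ^ 2 * v (.node (!b) (i + 1)) ^ 2 +
        v (.pole b) ^ 2 * v (.node b (i + 2)) ^ 2 * v (.node (!b) (i + 2)) ^ 2) * v (.face b i) +
      (2 * v (.node b (i + 1)) ^ 2 * v (.node b (i + 2)) ^ 2 +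
        v (.pole b) ^ 2 * v (.node (!b) i) ^ 2) * v (.face b (i + 1)) * v (.face b (i + 2)) := by
  have h1 := h.single b (i + 1)
  have h2 := h.single b (i + 2)
  have h3 := h.face_sq b i
  have h4 := h.face_sq b (i + 1)
  have h5 := h.face_sq b (i + 2)
  rw [add_one_add_one, add_one_add_two] at h1 h4
  rw [add_two_add_one, add_two_add_two] at h2 h5
  generalize v (.node (!b) i) = B0 at *
  generalize v (.node (!b) (i + 1)) = B1 at *
  generalize v (.node (!b) (i + 2)) = B2 at *
  generalize v (.face (!b) (i + 1)) = Y1 at *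
  generalize v (.face (!b) (i + 2)) = Y2 at *
  generalize v (.node b i) = A0 at *
  generalize v (.node b (i + 1)) = A1 at *
  generalize v (.node b (i + 2)) = A2 at *
  generalize v (.face b i) = X0 at *
  generalize v (.face b (i + 1)) = X1 at *
  generalize v (.face b (i + 2)) = X2 at *
  generalize v (.pole b) = P at *
  linear_combination -(P ^ 2 * Y2) * h1 - (A1 ^ 2 * X1 + X2 * X0) * h2 +
    X1 * X2 * h3 + A1 ^ 2 * X0 * h4 + A2 ^ 2 * X0 * h5

/-- Multiplying each single relation for index `0` by its face variable and by the squared opposite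
pole shows that both sides equal the product of both squared poles with the symmetric expression
`face false 0 * face true 0 - (node false 0 * node true 0) ^ 2`. -/
theorem CubeRelations.triple {v : Var → ℝ} (h : CubeRelations v) :
    v (.pole true) ^ 2 * ((v (.node false 0) * v (.node false 1) * v (.node false 2)) ^ 2 +
      v (.face false 0) * v (.face false 1) * v (.face false 2)) =
    v (.pole false) ^ 2 * ((v (.node true 0) * v (.node true 1) * v (.node true 2)) ^ 2 +
      v (.face true 0) * v (.face true 1) * v (.face true 2)) := by
  have h1 := h.single false 0
  have h2 := h.single true 0
  have h3 := h.face_sq false 0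
  have h4 := h.face_sq true 0
  simp at h1 h2 h3 h4
  linear_combination v (.pole true) ^ 2 * v (.face false 0) * h1 -
    v (.pole false) ^ 2 * v (.face true 0) * h2 - v (.pole true) ^ 2 * v (.node false 0) ^ 2 * h3 +
    v (.pole false) ^ 2 * v (.node true 0) ^ 2 * h4

/-- The recurrence is symmetric under the exchange of the two poles: after multiplication by the
squared lower pole, the triple relation carries one form into the other. -/
theorem CubeRelations.kashaev_true {v : Var → ℝ} (h : CubeRelations v) :
    2 * (v (.node true 0) * v (.node true 1) * v (.node true 2)) ^ 2 +
    v (.pole true) ^ 2 * (v (.node false 0) ^ 2 * v (.node true 0) ^ 2 +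
      v (.node false 1) ^ 2 * v (.node true 1) ^ 2 +
      v (.node false 2) ^ 2 * v (.node true 2) ^ 2) +
    2 * v (.face true 0) * v (.face true 1) * v (.face true 2) =
    v (.pole true) ^ 4 * v (.pole false) ^ 2 := by
  have p5 := h.pos (.pole false)
  refine mul_left_cancel₀ (pow_ne_zero 2 p5.ne') ?_
  linear_combination v (.pole true) ^ 2 * h.kashaev - 2 * h.triple

theorem CubeRelations.sum_terms {v : Var → ℝ} (h : CubeRelations v) (t : BasicIdentity) :
    ((t.terms false).map (Monomial.eval v)).sum = ((t.terms true).map (Monomial.eval v)).sum := by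
  have h2 := h.two
  rcases t with _ | (_ | _) | ⟨_ | _, i⟩ | ⟨_ | _, i⟩ | _
  · rfl
  · have := h.kashaev
    simp [BasicIdentity.terms, kashaevTerms, kashaevValue, Monomial.eval_ofVars, h2]
    linear_combination this
  · have := h.kashaev_true
    simp [BasicIdentity.terms, kashaevTerms, kashaevValue, Monomial.eval_ofVars, h2]
    linear_combination -this
  · have := h.single false i
    simp [BasicIdentity.terms, singleTerms, singleValue, Monomial.eval_ofVars] at this ⊢
    linear_combination this
  · have := h.single true i
    simp [BasicIdentity.terms, singleTerms, singleValue, Monomial.eval_ofVars] at this ⊢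
    linear_combination -this
  · have := h.double false i
    simp [BasicIdentity.terms, doubleTerms, doubleValue, Monomial.eval_ofVars, h2] at this ⊢
    linear_combination -this
  · have := h.double true i
    simp [BasicIdentity.terms, doubleTerms, doubleValue, Monomial.eval_ofVars, h2] at this ⊢
    linear_combination this
  · have := h.triple
    simp [BasicIdentity.terms, tripleTerms, Monomial.eval_ofVars] at this ⊢
    linear_combination this

/-- The value of a list of exponents. -/
noncomputable def evalList (v : Var → ℝ) (l : List ℕ) : ℝ :=
  (List.zipWith (fun x n => v x ^ n) vars l).prod

theorem evalList_toList (v : Var → ℝ) (m : Monomial) : evalList v m.toList = m.eval v := by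
  -- This is `rfl` because the `Fintype` instance of `Var` is built from the list `vars`.
  have : Monomial.eval v m = (vars.map fun x => v x ^ m x).prod := rfl
  rw [this, evalList, Monomial.toList, List.zipWith_map_right]
  simp

theorem sum_eval_of_isPerm {v : Var → ℝ} {A B : List Monomial}
    (h : (A.map Monomial.toList).isPerm (B.map Monomial.toList) = true) :
    (A.map (Monomial.eval v)).sum = (B.map (Monomial.eval v)).sum := by
  have h1 := ((List.isPerm_iff.1 h).map (evalList v)).sum_eq
  simpa [List.map_map, Function.comp_def, evalList_toList] using h1

theorem CubeRelations.sum_eval_of_isMultiple {v : Var → ℝ} (h : CubeRelations v)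
    {A B : List Monomial} {t : BasicIdentity} (ht : isMultiple A B t = true) :
    (A.map (Monomial.eval v)).sum = (B.map (Monomial.eval v)).sum := by
  simp only [isMultiple, Bool.and_eq_true] at ht
  -- The length tests only reject quickly, and the truncated subtraction in `m` is harmless: the two
  -- permutation tests certify the multiple whatever `m` is.
  obtain ⟨_, h1, h2⟩ := ht
  set m : Monomial := fun x => commonFactor A x - commonFactor (t.terms false) x
  have key : ∀ (C : List Monomial), (((C.map fun n => (fun x => m x + n x : Monomial)).map
      (Monomial.eval v)).sum = m.eval v * (C.map (Monomial.eval v)).sum) := by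
    intro C
    rw [List.map_map, ← List.sum_map_mul_left]
    simp [Function.comp_def, Monomial.eval_add]
  have e1 := sum_eval_of_isPerm (v := v) (A := A)
    (B := (t.terms false).map fun n => (fun x => m x + n x : Monomial))
    (by simpa [List.map_map, Function.comp_def] using h1)
  have e2 := sum_eval_of_isPerm (v := v) (A := B)
    (B := (t.terms true).map fun n => (fun x => m x + n x : Monomial))
    (by simpa [List.map_map, Function.comp_def] using h2)
  rw [e1, e2, key, key, h.sum_terms]

theorem sum_connectionTerms {v : Var → ℝ} (h : CubeRelations v) {x : Fin 6 → Colour} {s : Triple}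
    (hs : s ∈ triplesWith false (boundaryColours x)) :
    ((connectionTerms false (boundaryColours x) (connections false s)).map (Monomial.eval v)).sum =
      ((connectionTerms true (boundaryColours x) (connections false s)).map
        (Monomial.eval v)).sum := by
  have h1 := allTriples_iff.1 allTriples_isMultiple x s hs
  rw [List.any_eq_true] at h1
  obtain ⟨t, -, ht⟩ := h1
  exact h.sum_eval_of_isMultiple ht

end KashaevLoops

/-! ### Summation over the triples with given boundary data. -/

namespace KashaevLoops

/-- Two triples, below and above a cube, have the same colours and connections on the boundary of
the hexagon. -/
def SameBoundary (s s' : Triple) : Prop :=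
  (∀ l : LocalEdge, l.1 ≠ l.2 → localColour false s l = localColour true s' l) ∧
    ∀ l l' : LocalEdge, l.1 ≠ l.2 → l'.1 ≠ l'.2 →
      (Relation.EqvGen (arcRel false s) l l' ↔ Relation.EqvGen (arcRel true s') l l')

/-- The colours and connections of a triple on the boundary of the hexagon. -/
def boundaryData (b : Bool) (s : Triple) : List Colour × List ℕ :=
  (boundaryEdges.map (localColour b s), connections b s)

theorem sameBoundary_of_boundaryData {s s' : Triple} (hs : LocalValid false s)
    (hs' : LocalValid true s') (h : boundaryData false s = boundaryData true s') :
    SameBoundary s s' := by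
  obtain ⟨h1, h2⟩ := Prod.ext_iff.1 h
  simp only [boundaryData, connections] at h1 h2
  rw [List.map_inj_left] at h1 h2
  refine ⟨fun l hl => h1 l (mem_boundaryEdges.2 hl), fun l l' hl hl' => ?_⟩
  rw [hs.eqvGen_iff hl hl', hs'.eqvGen_iff hl hl', h2 l (mem_boundaryEdges.2 hl),
    h2 l' (mem_boundaryEdges.2 hl')]

theorem mem_triplesWith_iff_map {b : Bool} {γ : LocalEdge → Colour} {s : Triple} :
    s ∈ triplesWith b γ ↔
      LocalValid b s ∧ boundaryEdges.map (localColour b s) = boundaryEdges.map γ := by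
  rw [mem_triplesWith_iff, List.map_inj_left]

open Classical in
theorem sum_eval_connectionTerms (v : Var → ℝ) (b : Bool) (x : Fin 6 → Colour) (p : List ℕ) :
    ((connectionTerms b (boundaryColours x) p).map (Monomial.eval v)).sum =
      ∑ s with LocalValid b s ∧ boundaryData b s = (boundaryEdges.map (boundaryColours x), p),
        (tripleMonomial b s).eval v := by
  have hn : (triplesWith b (boundaryColours x)).Nodup := by
    have := nodup_triplesWith_boundaryColours b
    rw [List.all_eq_true] at this
    simpa using this x (mem_colourings x)
  rw [connectionTerms, List.map_map, ← List.sum_toFinset _ (hn.filter _)]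
  refine Finset.sum_congr ?_ fun _ _ => rfl
  ext s
  simp [mem_triplesWith_iff_map, boundaryData, and_assoc]

/-- A positivity argument: the sum below contains the positive term of `s`, so the equal sum above
cannot be empty. -/
theorem exists_sameBoundary {v : Var → ℝ} (h : CubeRelations v) {s : Triple}
    (hs : LocalValid false s) :
    ∃ s', LocalValid true s' ∧ boundaryData true s' = boundaryData false s := by
  obtain ⟨x, hx⟩ := hs.exists_mem
  have h1 := sum_connectionTerms h hx
  have h2 : 0 < ((connectionTerms false (boundaryColours x) (connections false s)).map
      (Monomial.eval v)).sum := by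
    refine List.sum_pos _ ?_ ?_
    · simp only [List.mem_map]
      rintro _ ⟨m, -, rfl⟩
      exact Finset.prod_pos fun y _ => pow_pos (h.pos y) _
    · have : tripleMonomial false s ∈
          connectionTerms false (boundaryColours x) (connections false s) :=
        List.mem_map_of_mem (List.mem_filter.2 ⟨hx, by simp⟩)
      intro h0
      rw [List.map_eq_nil_iff] at h0
      rw [h0] at this
      simp at this
  rw [h1] at h2
  have h3 : connectionTerms true (boundaryColours x) (connections false s) ≠ [] := by
    intro h0
    rw [h0] at h2
    simp at h2
  obtain ⟨m, hm⟩ := List.exists_mem_of_ne_nil _ h3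
  obtain ⟨s', hs', -⟩ := List.mem_map.1 hm
  rw [List.mem_filter, mem_triplesWith_iff_map] at hs'
  refine ⟨s', hs'.1.1, Prod.ext ?_ (by simpa [boundaryData] using hs'.2)⟩
  exact hs'.1.2.trans (mem_triplesWith_iff_map.1 hx).2.symm

theorem exists_sameBoundary_symm {s : Triple} (hs : LocalValid true s) :
    ∃ s', LocalValid false s' ∧ boundaryData false s' = boundaryData true s := by
  obtain ⟨x, hx⟩ := hs.exists_mem
  have h1 := allTriples_iff.1 allTriples_connectionTerms_ne_nil x s hx
  have h3 : connectionTerms false (boundaryColours x) (connections true s) ≠ [] := by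
    intro h0
    simp [h0] at h1
  obtain ⟨m, hm⟩ := List.exists_mem_of_ne_nil _ h3
  obtain ⟨s', hs', -⟩ := List.mem_map.1 hm
  rw [List.mem_filter, mem_triplesWith_iff_map] at hs'
  refine ⟨s', hs'.1.1, Prod.ext ?_ (by simpa [boundaryData] using hs'.2)⟩
  exact hs'.1.2.trans (mem_triplesWith_iff_map.1 hx).2.symm

open Classical in
/-- The local form of the invariance of the partition function under a cube flip. -/
theorem sum_triples {v : Var → ℝ} (h : CubeRelations v) {F F' : Triple → ℝ}
    (hF : ∀ s s', LocalValid false s → LocalValid true s' → SameBoundary s s' → F s = F' s') :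
    ∑ s with LocalValid false s, F s * (tripleMonomial false s).eval v =
      ∑ s with LocalValid true s, F' s * (tripleMonomial true s).eval v := by
  -- Both sums are split according to boundary data. The data realized below include all those
  -- realized above.
  set T := (Finset.univ.filter (LocalValid false)).image (boundaryData false)
  have h1 : ∀ s ∈ Finset.univ.filter (LocalValid false), boundaryData false s ∈ T :=
    fun s hs => Finset.mem_image_of_mem _ hs
  have h2 : ∀ s ∈ Finset.univ.filter (LocalValid true), boundaryData true s ∈ T := by
    intro s hs
    obtain ⟨s', hs', h3⟩ := exists_sameBoundary_symm (Finset.mem_filter.1 hs).2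
    rw [← h3]
    exact h1 _ (by simp [hs'])
  rw [← Finset.sum_fiberwise_of_maps_to h1, ← Finset.sum_fiberwise_of_maps_to h2]
  refine Finset.sum_congr rfl fun p hp => ?_
  obtain ⟨s, hs, rfl⟩ := Finset.mem_image.1 hp
  replace hs := (Finset.mem_filter.1 hs).2
  obtain ⟨s', hs', hss⟩ := exists_sameBoundary h hs
  obtain ⟨x, hx⟩ := hs.exists_mem
  have hd : boundaryData false s =
      (boundaryEdges.map (boundaryColours x), connections false s) :=
    Prod.ext (mem_triplesWith_iff_map.1 hx).2 rfl
  rw [Finset.filter_filter, Finset.filter_filter]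
  -- On one fibre the outer factors are constant. Each is expressed by its value at a representative
  -- on the opposite side, since `hF` only compares a lower triple with an upper one.
  have e1 : ∑ t with LocalValid false t ∧ boundaryData false t = boundaryData false s,
      F t * (tripleMonomial false t).eval v = F' s' *
      ∑ t with LocalValid false t ∧ boundaryData false t = boundaryData false s,
      (tripleMonomial false t).eval v := by
    rw [Finset.mul_sum]
    refine Finset.sum_congr rfl fun t ht => ?_
    obtain ⟨ht1, ht2⟩ := (Finset.mem_filter.1 ht).2
    rw [hF t s' ht1 hs' (sameBoundary_of_boundaryData ht1 hs' (ht2.trans hss.symm))]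
  have e2 : ∑ t with LocalValid true t ∧ boundaryData true t = boundaryData false s,
      F' t * (tripleMonomial true t).eval v = F s *
      ∑ t with LocalValid true t ∧ boundaryData true t = boundaryData false s,
      (tripleMonomial true t).eval v := by
    rw [Finset.mul_sum]
    refine Finset.sum_congr rfl fun t ht => ?_
    obtain ⟨ht1, ht2⟩ := (Finset.mem_filter.1 ht).2
    rw [hF s t hs ht1 (sameBoundary_of_boundaryData hs ht1 ht2.symm)]
  rw [e1, e2, hd, ← sum_eval_connectionTerms, ← sum_eval_connectionTerms,
    sum_connectionTerms h hx, hF s s' hs hs' (sameBoundary_of_boundaryData hs hs' hss.symm)]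

end KashaevLoops

namespace KashaevLoops

/-! ### Equivalence classes after the replacement of a finite part of a graph -/

section Surgery

open Relation

variable {α κ : Type*}

/-- The finite equivalence classes, generated by a relation, of the elements of a set. -/
def finiteClasses (r : α → α → Prop) (D : Set α) : Set (Set α) :=
  {S | ∃ a ∈ D, S = {b | EqvGen r a b} ∧ S.Finite}

/-- The union of a relation `H` and of the image of a relation `A`. -/
def glueRel (H : α → α → Prop) (A : κ → κ → Prop) (L : κ → α) (a b : α) : Prop :=
  H a b ∨ ∃ l l', A l l' ∧ a = L l ∧ b = L l'

/-- The union of a relation `H` and of the connections outside `I` by a relation `A`. -/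
def traceRel (H : α → α → Prop) (A : κ → κ → Prop) (L : κ → α) (I : Set κ) (a b : α) : Prop :=
  H a b ∨ ∃ l l', l ∉ I ∧ l' ∉ I ∧ EqvGen A l l' ∧ a = L l ∧ b = L l'

/-- The hypotheses under which the part `A` is glued to the relation `H` on `E`. -/
structure IsGluing (H : α → α → Prop) (L : κ → α) (E : Set α) (I : Set κ) : Prop where
  inj : Function.Injective L
  mem : ∀ a b, H a b → a ∈ E ∧ b ∈ E
  inner : ∀ l ∈ I, L l ∉ E
  outer : ∀ l ∉ I, L l ∈ E

theorem eqvGen_mem_iff {r : α → α → Prop} {p : α → Prop} (h : ∀ a b, r a b → (p a ↔ p b)) {a b : α}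
    (hab : EqvGen r a b) : p a ↔ p b := by
  induction hab with
  | rel a b h1 => exact h a b h1
  | refl => rfl
  | symm _ _ _ ih => exact ih.symm
  | trans _ _ _ _ _ ih1 ih2 => exact ih1.trans ih2

theorem EqvGen.map_le {r : α → α → Prop} {s : κ → κ → Prop} {f : κ → α}
    (h : ∀ a b, s a b → EqvGen r (f a) (f b)) {a b : κ} (hab : EqvGen s a b) :
    EqvGen r (f a) (f b) := by
  induction hab with
  | rel a b h1 => exact h a b h1
  | refl => exact .refl _
  | symm _ _ _ ih => exact ih.symm
  | trans _ _ _ _ _ ih1 ih2 => exact ih1.trans _ _ _ ih2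

variable {H : α → α → Prop} {A : κ → κ → Prop} {L : κ → α} {E : Set α} {I : Set κ}

/-- Elements of `L '' I` are touched by `A` only. A path between points of `E` can therefore enter
and leave the glued part only at images of indices outside `I`, and each such excursion is a single
step of `traceRel`. -/
theorem IsGluing.eqvGen_iff (h : IsGluing H L E I) {a b : α} (ha : a ∈ E) (hb : b ∈ E) :
    EqvGen (glueRel H A L) a b ↔ EqvGen (traceRel H A L I) a b := by
  constructor
  · intro hab
    -- `Rep x w` says that `w` represents `x` in `E`: it is `x` itself or is reached from `x` inside
    -- the glued part. Two representatives of a point are connected in the trace.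
    let Rep : α → α → Prop := fun x w =>
      w ∈ E ∧ (x = w ∨ ∃ l l', x = L l ∧ w = L l' ∧ l' ∉ I ∧ EqvGen A l l')
    have hI : ∀ l, L l ∈ E → l ∉ I := fun l hl hl' => h.inner l hl' hl
    have uniq : ∀ x w w', Rep x w → Rep x w' → EqvGen (traceRel H A L I) w w' := by
      rintro x w w' ⟨hw, rfl | ⟨l, l', rfl, rfl, hl', hll⟩⟩ ⟨hw', rfl | ⟨m, m', hm, rfl, hm', hmm⟩⟩
      · exact .refl _
      · exact .rel _ _ (.inr ⟨m, m', hI m (hm ▸ hw), hm', hmm, hm, rfl⟩)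
      · exact .symm _ _ (.rel _ _ (.inr ⟨l, l', hI l hw', hl', hll, rfl, rfl⟩))
      · obtain rfl := h.inj hm
        exact .rel _ _ (.inr ⟨l', m', hl', hm', hll.symm.trans _ _ _ hmm, rfl, rfl⟩)
    have stepA : ∀ l l', EqvGen A l l' → ∀ w, Rep (L l) w → Rep (L l') w := by
      rintro l l' hll w ⟨hw, rfl | ⟨m, m', hm, rfl, hm', hmm⟩⟩
      · exact ⟨hw, .inr ⟨l', l, rfl, rfl, hI l hw, hll.symm⟩⟩
      · obtain rfl := h.inj hm
        exact ⟨hw, .inr ⟨l', m', rfl, rfl, hm', hll.symm.trans _ _ _ hmm⟩⟩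
    -- The invariant transports representatives in both directions, so that it passes through
    -- symmetry; an intermediate point may have no representative at all.
    have key : (∀ w, Rep a w → ∃ w', Rep b w' ∧ EqvGen (traceRel H A L I) w w') ∧
        ∀ w, Rep b w → ∃ w', Rep a w' ∧ EqvGen (traceRel H A L I) w w' := by
      clear ha hb
      induction hab with
      | rel x y hxy =>
        obtain hxy | ⟨l, l', hll, rfl, rfl⟩ := hxy
        · obtain ⟨hx, hy⟩ := h.mem x y hxy
          have hxy' : EqvGen (traceRel H A L I) x y := .rel _ _ (.inl hxy)
          exact ⟨fun w hw => ⟨y, ⟨hy, .inl rfl⟩,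
              (uniq x w x hw ⟨hx, .inl rfl⟩).trans _ _ _ hxy'⟩,
            fun w hw => ⟨x, ⟨hx, .inl rfl⟩,
              (uniq y w y hw ⟨hy, .inl rfl⟩).trans _ _ _ hxy'.symm⟩⟩
        · exact ⟨fun w hw => ⟨w, stepA l l' (.rel _ _ hll) w hw, .refl _⟩,
            fun w hw => ⟨w, stepA l' l (EqvGen.rel _ _ hll).symm w hw, .refl _⟩⟩
      | refl x => exact ⟨fun w hw => ⟨w, hw, .refl _⟩, fun w hw => ⟨w, hw, .refl _⟩⟩
      | symm x y _ ih => exact ih.symm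
      | trans x y z _ _ ih1 ih2 =>
        constructor
        · intro w hw
          obtain ⟨w1, h1, h1'⟩ := ih1.1 w hw
          obtain ⟨w2, h2, h2'⟩ := ih2.1 w1 h1
          exact ⟨w2, h2, h1'.trans _ _ _ h2'⟩
        · intro w hw
          obtain ⟨w1, h1, h1'⟩ := ih2.2 w hw
          obtain ⟨w2, h2, h2'⟩ := ih1.2 w1 h1
          exact ⟨w2, h2, h1'.trans _ _ _ h2'⟩
    obtain ⟨w, hw, haw⟩ := key.1 a ⟨ha, .inl rfl⟩
    exact haw.trans _ _ _ (uniq b w b hw ⟨hb, .inl rfl⟩)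
  · intro hab
    refine EqvGen.map_le (f := id) ?_ hab
    rintro x y (hxy | ⟨l, l', -, -, hll, rfl, rfl⟩)
    · exact .rel _ _ (.inl hxy)
    · exact EqvGen.map_le (f := L) (fun m m' hm => .rel _ _ (.inr ⟨m, m', hm, rfl, rfl⟩)) hll

theorem IsGluing.glue_mem_iff (h : IsGluing H L E I) {a b : α}
    (hab : EqvGen (glueRel H A L) a b) : a ∈ E ∪ L '' I ↔ b ∈ E ∪ L '' I := by
  refine eqvGen_mem_iff (p := fun a => a ∈ E ∪ L '' I) ?_ hab
  have hl : ∀ l, L l ∈ E ∪ L '' I := fun l => by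
    by_cases hl : l ∈ I
    · exact .inr ⟨l, hl, rfl⟩
    · exact .inl (h.outer l hl)
  rintro x y (hxy | ⟨l, l', -, rfl, rfl⟩)
  · simp [h.mem x y hxy]
  · simp only [hl]

theorem IsGluing.trace_mem_iff (h : IsGluing H L E I) {a b : α}
    (hab : EqvGen (traceRel H A L I) a b) : a ∈ E ↔ b ∈ E := by
  refine eqvGen_mem_iff (p := fun a => a ∈ E) ?_ hab
  rintro x y (hxy | ⟨l, l', hl, hl', -, rfl, rfl⟩)
  · simp [h.mem x y hxy]
  · simp [h.outer l hl, h.outer l' hl']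

/-- The finite classes of the glued relation are those outside and those inside the glued part. -/
theorem IsGluing.encard_finiteClasses [Finite κ] (h : IsGluing H L E I) :
    (finiteClasses (glueRel H A L) (E ∪ L '' I)).encard =
      (finiteClasses (traceRel H A L I) E).encard +
        {S | ∃ l ∈ I, S = {l' | EqvGen A l l'} ∧ S ⊆ I}.encard := by
  set C := finiteClasses (glueRel H A L) (E ∪ L '' I)
  -- Classes that meet `E` are counted by their intersection with `E`, the others by the classes of
  -- `A` inside `I`.
  have hsplit : C = {S ∈ C | (S ∩ E).Nonempty} ∪ {S ∈ C | ¬ (S ∩ E).Nonempty} := by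
    ext S; by_cases hS : (S ∩ E).Nonempty <;> simp [hS]
  have hdisj : Disjoint {S ∈ C | (S ∩ E).Nonempty} {S ∈ C | ¬ (S ∩ E).Nonempty} := by
    rw [Set.disjoint_left]
    rintro S ⟨-, h1⟩ ⟨-, h2⟩
    exact h2 h1
  have hclass : ∀ S ∈ C, ∀ a ∈ S, S = {b | EqvGen (glueRel H A L) a b} := by
    rintro S ⟨c, -, rfl, -⟩ a ha
    ext b
    exact ⟨fun hb => (ha.symm).trans _ _ _ hb, fun hb => ha.trans _ _ _ hb⟩
  have hinter : ∀ S ∈ C, ∀ a ∈ S, a ∈ E → S ∩ E = {b | EqvGen (traceRel H A L I) a b} := by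
    intro S hS a ha haE
    rw [hclass S hS a ha]
    ext b
    constructor
    · rintro ⟨hb, hbE⟩
      exact (h.eqvGen_iff haE hbE).1 hb
    · intro hb
      have hbE := (h.trace_mem_iff hb).1 haE
      exact ⟨(h.eqvGen_iff haE hbE).2 hb, hbE⟩
  have himage : ∀ l, (∀ l', EqvGen A l l' → l' ∈ I) → L '' {l' | EqvGen A l l'} = {b | EqvGen (glueRel H A L) (L l) b} := by
    intro l hsubI
    ext y
    constructor
    · rintro ⟨l', hll, rfl⟩
      exact EqvGen.map_le (fun m m' hm => .rel _ _ (.inr ⟨m, m', hm, rfl, rfl⟩)) hll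
    · intro hy
      have key := eqvGen_mem_iff (p := fun y => ∃ l', EqvGen A l l' ∧ L l' = y) ?_ hy
      · exact key.1 ⟨l, .refl _, rfl⟩
      · rintro x z (hxz | ⟨m, m', hmm, rfl, rfl⟩)
        · obtain ⟨hx, hz⟩ := h.mem x z hxz
          constructor
          · rintro ⟨l', hll, rfl⟩
            exact absurd hx (h.inner l' (hsubI l' hll))
          · rintro ⟨l', hll, rfl⟩
            exact absurd hz (h.inner l' (hsubI l' hll))
        · constructor
          · rintro ⟨l', hll, hlm⟩
            obtain rfl := h.inj hlm
            exact ⟨m', hll.trans _ _ _ (.rel _ _ hmm), rfl⟩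
          · rintro ⟨l', hll, hlm⟩
            obtain rfl := h.inj hlm
            exact ⟨m, hll.trans _ _ _ (EqvGen.rel _ _ hmm).symm, rfl⟩
  rw [hsplit, Set.encard_union_eq hdisj]
  congr 1
  · have hinj : Set.InjOn (· ∩ E) {S ∈ C | (S ∩ E).Nonempty} := by
      rintro S ⟨hS, a, ha, haE⟩ S' ⟨hS', -⟩ hSS
      change S ∩ E = S' ∩ E at hSS
      have ha' : a ∈ S' := by
        have : a ∈ S' ∩ E := hSS ▸ (⟨ha, haE⟩ : a ∈ S ∩ E)
        exact this.1
      rw [hclass S hS a ha, hclass S' hS' a ha']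
    rw [← hinj.encard_image]
    congr 1
    ext S
    constructor
    · rintro ⟨S, ⟨hS, a, ha, haE⟩, rfl⟩
      refine ⟨a, haE, hinter S hS a ha haE, ?_⟩
      obtain ⟨c, -, -, hfin⟩ := hS
      exact hfin.subset Set.inter_subset_left
    · rintro ⟨a, haE, rfl, hfin⟩
      -- Finiteness of the trace class gives that of the full class, as `I` adds only finitely many
      -- elements.
      have hS : {b | EqvGen (glueRel H A L) a b} ∈ C := by
        refine ⟨a, .inl haE, rfl, ?_⟩
        refine (hfin.union ((Set.toFinite I).image L)).subset fun b hb => ?_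
        rcases (h.glue_mem_iff hb).1 (.inl haE) with hbE | hbI
        · exact .inl ((h.eqvGen_iff haE hbE).1 hb)
        · exact .inr hbI
      exact ⟨_, ⟨hS, a, EqvGen.refl _, haE⟩, hinter _ hS a (EqvGen.refl _) haE⟩
  · rw [← (Set.image_injective.2 h.inj).injOn.encard_image]
    congr 1
    ext S
    constructor
    · rintro ⟨⟨a, ha, rfl, -⟩, hSE⟩
      have hSE' : ∀ b, EqvGen (glueRel H A L) a b → b ∉ E := fun b hb hbE => hSE ⟨b, hb, hbE⟩
      rcases ha with haE | ⟨l, hl, rfl⟩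
      · exact absurd haE (hSE' a (.refl _))
      have hmap : ∀ l', EqvGen A l l' → EqvGen (glueRel H A L) (L l) (L l') := fun l' hll =>
        EqvGen.map_le (fun m m' hm => .rel _ _ (.inr ⟨m, m', hm, rfl, rfl⟩)) hll
      have hsubI : ∀ l', EqvGen A l l' → l' ∈ I := fun l' hll => by
        by_contra hl'
        exact hSE' _ (hmap l' hll) (h.outer l' hl')
      exact ⟨_, ⟨l, hl, rfl, hsubI⟩, himage l hsubI⟩
    · rintro ⟨S, ⟨l, hl, rfl, hsubI⟩, rfl⟩
      have hS := himage l fun l' hll => hsubI hll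
      refine ⟨⟨L l, .inr ⟨l, hl, rfl⟩, hS, (Set.toFinite _).image L⟩, ?_⟩
      rintro ⟨_, ⟨l', hll, rfl⟩, hE⟩
      exact h.inner l' (hsubI hll) hE

end Surgery

end KashaevLoops

namespace KashaevLoops

/-! ### Vertices, edges and faces of a monotone solid -/

theorem e_apply (i j : Fin 3) : e i j = if j = i then 1 else 0 := by
  simp [e, Pi.single_apply]

theorem e_add_e_add_e (k : Fin 3) : e k + e (k + 1) + e (k + 2) = 1 := by
  ext j
  simp only [Pi.add_apply, e_apply]
  revert k j; decide

theorem add_e_e_e (x : Point) : x + e 0 + e 1 + e 2 = x + 1 := by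
  rw [add_assoc, add_assoc, ← add_assoc (e 0)]
  exact congrArg _ (e_add_e_add_e 0)

variable {U : SteppedSolid}

theorem IsMonotone.mem_of_le (hU : IsMonotone U) {c d : Point} (hc : c ∈ U) (h : d ≤ c) : d ∈ U :=
  hU c hc d h

/-- The cube `x - 1` is the lowest of the cubes that contain the point `x`. -/
theorem IsMonotone.hasPoint_iff (hU : IsMonotone U) {x : Point} : HasPoint U x ↔ x - 1 ∈ U := by
  constructor
  · rintro ⟨c, hc, h⟩
    exact hU.mem_of_le hc fun i => by have := h i; simp; omega
  · intro h
    exact ⟨_, h, fun i => by simp⟩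

theorem IsMonotone.mem_vertices (hU : IsMonotone U) {x : Point} :
    x ∈ vertices U ↔ x - 1 ∈ U ∧ x ∉ U := by
  simp only [vertices, Set.mem_ofPred_eq, hU.hasPoint_iff, add_e_e_e, add_sub_cancel_right]

theorem e_nonneg (i : Fin 3) : 0 ≤ e i := fun j => by
  rw [e_apply]; split_ifs <;> simp

/-- Among the four cubes around an edge, the lowest is in the solid and the highest is not. -/
theorem IsMonotone.mem_edges (hU : IsMonotone U) {a : LatticeEdge} :
    a ∈ edges U ↔ a.1 + e a.2 - 1 ∈ U ∧ a.1 ∉ U := by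
  simp only [edges, Set.mem_ofPred_eq, hU.mem_vertices]
  have h : a.1 ≤ a.1 + e a.2 := le_add_of_nonneg_right (e_nonneg _)
  constructor
  · rintro ⟨⟨-, h1⟩, h2, -⟩
    exact ⟨h2, h1⟩
  · rintro ⟨h1, h2⟩
    exact ⟨⟨hU.mem_of_le h1 (sub_le_sub_right h 1), h2⟩, h1, fun h3 => h2 (hU.mem_of_le h3 h)⟩

theorem corner_mem_vertices (hU : IsMonotone U) {f : LatticeSquare} (hf : f ∈ faces U)
    (v : Corner) : corner f v ∈ vertices U := by
  obtain ⟨x, k⟩ := f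
  obtain ⟨h1, h2⟩ := hf
  rw [hU.mem_vertices]
  constructor
  · refine hU.mem_of_le h1 ?_
    clear h1 h2
    simp only [corner]
    rw [← e_add_e_add_e k, sub_eq_add_neg, sub_eq_add_neg, add_assoc]
    refine add_le_add_right ?_ x
    cases v <;> simp only [Corner.offset] <;> intro j <;> simp only [Pi.add_apply, Pi.neg_apply,
      e_apply, Pi.zero_apply] <;> revert k j <;> decide
  · refine fun h3 => h2 (hU.mem_of_le h3 ?_)
    simp only [corner]
    refine le_add_of_nonneg_right ?_
    cases v <;> simp only [Corner.offset]
    · exact le_rfl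
    · exact e_nonneg _
    · exact e_nonneg _
    · exact add_nonneg (e_nonneg _) (e_nonneg _)

theorem side_mem_edges (hU : IsMonotone U) {f : LatticeSquare} (hf : f ∈ faces U) (s : Side) :
    side f s ∈ edges U := by
  have h := corner_mem_vertices hU hf
  have h1 := h .low
  have h2 := h .first
  have h3 := h .second
  have h4 := h .high
  simp only [corner, Corner.offset, add_zero] at h1 h2 h3 h4
  cases s
  · exact ⟨h1, h2⟩
  · exact ⟨h1, h3⟩
  · exact ⟨h2, by simpa [side, add_assoc] using h4⟩
  · exact ⟨h3, by simpa [side, add_assoc, add_comm (e (f.2 + 2))] using h4⟩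

/-! ### The curves of a configuration as equivalence classes of lattice edges -/

/-- Two lattice edges are the ends of an arc of the configuration. -/
def linkRel (σ : FaceLabelling U) (a b : LatticeEdge) : Prop :=
  ∃ (f : faces U) (s : Side), a = side f.1 s ∧ b = side f.1 ((σ f).partner s)

theorem linkRel_mem (hU : IsMonotone U) {σ : FaceLabelling U} {a b : LatticeEdge}
    (h : linkRel σ a b) : a ∈ edges U ∧ b ∈ edges U := by
  obtain ⟨f, s, rfl, rfl⟩ := h
  exact ⟨side_mem_edges hU f.2 _, side_mem_edges hU f.2 _⟩

theorem eqvGen_linkRel_mem_iff (hU : IsMonotone U) {σ : FaceLabelling U} {a b : LatticeEdge}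
    (h : Relation.EqvGen (linkRel σ) a b) : a ∈ edges U ↔ b ∈ edges U :=
  eqvGen_mem_iff (p := (· ∈ edges U)) (fun a b hab => by simp [linkRel_mem hU hab]) h

/-- Replaces paths in a graph whose vertex type depends on the surface by an equivalence relation on
all lattice edges. Configurations on the surfaces before and after a flip then become comparable. -/
theorem reachable_iff (hU : IsMonotone U) {σ : FaceLabelling U} {a b : edges U} :
    (linkGraph σ).Reachable a b ↔ Relation.EqvGen (linkRel σ) a.1 b.1 := by
  constructor
  · rw [SimpleGraph.reachable_iff_reflTransGen]
    intro h
    induction h with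
    | refl => exact .refl _
    | tail _ h ih =>
      refine ih.trans _ _ _ ?_
      rw [linkGraph, SimpleGraph.fromRel_adj] at h
      rcases h.2 with h | h
      · exact .rel _ _ h
      · exact .symm _ _ (.rel _ _ h)
  · have key : ∀ a b, Relation.EqvGen (linkRel σ) a b → ∀ (ha : a ∈ edges U) (hb : b ∈ edges U),
        (linkGraph σ).Reachable ⟨a, ha⟩ ⟨b, hb⟩ := by
      intro a b h
      induction h with
      | rel a b h =>
        intro ha hb
        by_cases hab : a = b
        · subst hab
          exact .refl _
        · refine SimpleGraph.Adj.reachable ?_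
          rw [linkGraph, SimpleGraph.fromRel_adj]
          exact ⟨by simpa using hab, .inl h⟩
      | refl => exact fun _ _ => .refl _
      | symm _ _ _ ih => exact fun ha hb => (ih hb ha).symm
      | trans a b c h1 _ ih1 ih2 =>
        intro ha hc
        have hb := (eqvGen_linkRel_mem_iff hU h1).1 ha
        exact (ih1 ha hb).trans (ih2 hb hc)
    exact fun h => key _ _ h _ _

theorem connectedIn_iff (hU : IsMonotone U) {σ : FaceLabelling U} {a b : LatticeEdge} :
    ConnectedIn σ a b ↔ a ∈ edges U ∧ b ∈ edges U ∧ Relation.EqvGen (linkRel σ) a b := by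
  simp only [ConnectedIn, reachable_iff hU, exists_prop]

theorem encard_loops (hU : IsMonotone U) (σ : FaceLabelling U) :
    (loops σ).encard = (finiteClasses (linkRel σ) (edges U)).encard := by
  have hinj : Function.Injective fun K : (linkGraph σ).ConnectedComponent =>
      Subtype.val '' K.supp :=
    (Set.image_injective.2 Subtype.val_injective).comp SimpleGraph.ConnectedComponent.supp_injective
  rw [← hinj.injOn.encard_image]
  congr 1
  have hsupp : ∀ a : edges U, Subtype.val '' ((linkGraph σ).connectedComponentMk a).supp =
      {b | Relation.EqvGen (linkRel σ) a.1 b} := by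
    intro a
    ext b
    simp only [Set.mem_image, SimpleGraph.ConnectedComponent.mem_supp_iff,
      SimpleGraph.ConnectedComponent.eq, reachable_iff hU, Subtype.exists, exists_and_right,
      exists_eq_right, Set.mem_ofPred_eq]
    constructor
    · rintro ⟨_, h⟩
      exact h.symm
    · intro h
      exact ⟨(eqvGen_linkRel_mem_iff hU h).1 a.2, h.symm⟩
  ext S
  constructor
  · rintro ⟨K, hK, rfl⟩
    induction K using SimpleGraph.ConnectedComponent.ind with
    | h a => exact ⟨a.1, a.2, hsupp a, Set.Finite.image _ hK⟩
  · rintro ⟨a, ha, rfl, hfin⟩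
    refine ⟨(linkGraph σ).connectedComponentMk ⟨a, ha⟩, ?_, hsupp ⟨a, ha⟩⟩
    rw [← hsupp ⟨a, ha⟩] at hfin
    exact Set.Finite.of_finite_image hfin Subtype.val_injective.injOn

end KashaevLoops

namespace KashaevLoops

/-! ### Cube flips -/

/-- The `k`-th face of a cube that is visible from below (`false`) or above (`true`). -/
def cubeFace (b : Bool) (c : Point) (k : Fin 3) : LatticeSquare := (bif b then c + e k else c, k)

/-- The position of a local edge relative to the lowest corner. -/
def localOffset : Bool → LocalEdge → Point
  | false, (i, j) => if i = j then 0 else e i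
  | true, (i, j) => if i = j then e (i + 1) + e (i + 2) else e i

/-- A local edge as a lattice edge. -/
def cubeEdge (b : Bool) (c : Point) (l : LocalEdge) : LatticeEdge := (c + localOffset b l, l.2)

/-- The corner of a cube that is visible from below or above only. -/
def pole (b : Bool) (c : Point) : Point := bif b then c + 1 else c

/-- The inner edges of the hexagon. -/
def innerEdges : Set LocalEdge := {l | l.1 = l.2}

theorem side_cubeFace (b : Bool) (c : Point) (k : Fin 3) (s : Side) :
    side (cubeFace b c k) s = cubeEdge b c (localSide b k s) := by
  have h1 : k + 1 ≠ k + 2 := by revert k; decide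
  have h2 : k ≠ k + 1 := by revert k; decide
  have h3 : k ≠ k + 2 := by revert k; decide
  cases b <;> cases s <;>
    simp [side, cubeFace, cubeEdge, localSide, localOffset, h1, h1.symm, h2, h3, add_assoc]
  exact add_comm _ _

theorem localOffset_apply (b : Bool) (l : LocalEdge) (k : Fin 3) : localOffset b l k =
    if l.1 = l.2 then (bif b then (if k = l.1 then 0 else 1) else 0)
    else if k = l.1 then 1 else 0 := by
  obtain ⟨i, j⟩ := l
  cases b <;> simp only [localOffset] <;> by_cases h : i = j
  · simp [h]
  · simp [h, e_apply]
  · simp only [h, if_true, cond_true, Pi.add_apply, e_apply]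
    clear h
    revert j k; decide
  · simp [h, e_apply]

theorem localOffset_injective (b : Bool) {l l' : LocalEdge} (h : localOffset b l = localOffset b l')
    (h2 : l.2 = l'.2) : l = l' := by
  have h3 : ∀ k, localOffset b l k = localOffset b l' k := fun k => congrFun h k
  simp only [localOffset_apply] at h3
  clear h
  revert b l l'
  decide

theorem cubeEdge_injective (b : Bool) (c : Point) : Function.Injective (cubeEdge b c) := by
  intro l l' h
  simp only [cubeEdge, Prod.mk.injEq, add_right_inj] at h
  exact localOffset_injective b h.1 h.2

/-- The cube `c` is outside the monotone solid `U`, which remains monotone when it is added. -/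
structure IsFlip (U : SteppedSolid) (c : Point) : Prop where
  mono : IsMonotone U
  mono_insert : IsMonotone (insert c U)
  notMem : c ∉ U

/-- The solid without (`false`) or with (`true`) the cube. -/
def flipSolid (U : SteppedSolid) (c : Point) (b : Bool) : SteppedSolid :=
  bif b then insert c U else U

/-- The faces that do not change in a flip. -/
def fixedFaces (U : SteppedSolid) (c : Point) : Set LatticeSquare := faces U ∩ faces (insert c U)

/-- The edges that do not change in a flip. -/
def fixedEdges (U : SteppedSolid) (c : Point) : Set LatticeEdge := edges U ∩ edges (insert c U)

/-- The vertices that do not change in a flip. -/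
def fixedVertices (U : SteppedSolid) (c : Point) : Set Point :=
  vertices U ∩ vertices (insert c U)

namespace IsFlip

variable {U : SteppedSolid} {c : Point}

theorem mono_flipSolid (h : IsFlip U c) (b : Bool) : IsMonotone (flipSolid U c b) := by
  cases b
  exacts [h.mono, h.mono_insert]

theorem mem_of_lt (h : IsFlip U c) {d : Point} (hd : d < c) : d ∈ U := by
  rcases h.mono_insert.mem_of_le (Set.mem_insert c U) hd.le with h1 | h1
  · exact absurd h1 hd.ne
  · exact h1

theorem notMem_of_le (h : IsFlip U c) {d : Point} (hd : c ≤ d) : d ∉ U :=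
  fun h1 => h.notMem (h.mono.mem_of_le h1 hd)

theorem e_pos (i : Fin 3) : 0 < e i :=
  lt_of_le_of_ne (e_nonneg i) fun h => by simpa [e_apply] using congrFun h i

/-- Cubes strictly below `c` are in `U` and cubes above `c` are not, so the flip exchanges the three
squares at the lower pole for the three at the upper pole and affects no other face. -/
theorem mem_faces (h : IsFlip U c) (b : Bool) (f : LatticeSquare) :
    f ∈ faces (flipSolid U c b) ↔ f ∈ fixedFaces U c ∨ f = cubeFace b c f.2 := by
  obtain ⟨x, k⟩ := f
  have h1 : c - e k ∈ U := h.mem_of_lt (sub_lt_self _ (e_pos k))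
  have h2 : c + e k ∉ U := h.notMem_of_le (le_add_of_nonneg_right (e_nonneg k))
  have h3 : e k ≠ 0 := (e_pos k).ne'
  have h4 := h.notMem
  cases b
  · simp only [flipSolid, cond_false, fixedFaces, faces, Set.mem_inter_iff, Set.mem_ofPred_eq,
      cubeFace, Set.mem_insert_iff, not_or, Prod.mk.injEq, and_true]
    by_cases hx : x = c
    · subst hx
      simp [h1, h4]
    · simp only [hx, not_false_eq_true, true_and, or_false]
      tauto
  · simp only [flipSolid, cond_true, fixedFaces, faces, Set.mem_inter_iff, Set.mem_ofPred_eq,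
      cubeFace, Set.mem_insert_iff, not_or, Prod.mk.injEq, and_true]
    by_cases hx : x = c + e k
    · subst hx
      simp [h2, h3]
    · have : x - e k ≠ c := fun h5 => hx (sub_eq_iff_eq_add.1 h5)
      simp only [hx, this, or_false, false_or]
      tauto

theorem cubeFace_notMem (h : IsFlip U c) (b : Bool) (k : Fin 3) :
    cubeFace b c k ∉ fixedFaces U c := by
  have h3 : e k ≠ 0 := (e_pos k).ne'
  cases b
  · rintro ⟨-, -, h1⟩
    exact h1 (Set.mem_insert c U)
  · rintro ⟨⟨h1, -⟩, -⟩
    refine h.notMem ?_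
    simpa [cubeFace] using h1

theorem cubeFace_mem (h : IsFlip U c) (b : Bool) (k : Fin 3) :
    cubeFace b c k ∈ faces (flipSolid U c b) := (h.mem_faces b _).2 (.inr rfl)

theorem fixedFaces_subset (h : IsFlip U c) (b : Bool) {f : LatticeSquare}
    (hf : f ∈ fixedFaces U c) : f ∈ faces (flipSolid U c b) := (h.mem_faces b f).2 (.inl hf)

theorem one_eq (i : Fin 3) : (1 : Point) = e i + (e (i + 1) + e (i + 2)) := by
  rw [← e_add_e_add_e i, add_assoc]

theorem mem_edges (h : IsFlip U c) (b : Bool) (a : LatticeEdge) :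
    a ∈ edges (flipSolid U c b) ↔ a ∈ fixedEdges U c ∨ a = cubeEdge b c (a.2, a.2) := by
  obtain ⟨x, k⟩ := a
  have h0 : 0 < e (k + 1) + e (k + 2) := add_pos_of_pos_of_nonneg (e_pos _) (e_nonneg _)
  have h1 : c + e k - 1 ∈ U := by
    refine h.mem_of_lt ?_
    rw [one_eq k, add_sub_assoc, sub_add_cancel_left]
    exact add_lt_of_neg_right _ (neg_neg_of_pos h0)
  have h2 : c + (e (k + 1) + e (k + 2)) ∉ U := h.notMem_of_le (le_add_of_nonneg_right h0.le)
  have h4 := h.notMem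
  simp only [fixedEdges, Set.mem_inter_iff, h.mono.mem_edges, h.mono_insert.mem_edges,
    (h.mono_flipSolid b).mem_edges, cubeEdge, localOffset, Prod.mk.injEq, and_true,
    Set.mem_insert_iff, not_or]
  cases b
  · simp only [flipSolid, cond_false, if_true, add_zero]
    by_cases hx : x = c
    · subst hx
      simp [h1, h4]
    · simp only [hx, not_false_eq_true, true_and, or_false]
      tauto
  · simp only [flipSolid, cond_true, if_true, Set.mem_insert_iff, not_or]
    by_cases hx : x = c + (e (k + 1) + e (k + 2))
    · subst hx
      have : c + (e (k + 1) + e (k + 2)) + e k - 1 = c := by rw [one_eq k]; abel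
      simp [h2, h0.ne', this]
    · have : x + e k - 1 ≠ c := fun h5 => hx (by rw [← h5, one_eq k]; abel)
      simp only [hx, this, or_false, false_or]
      tauto

theorem mem_vertices (h : IsFlip U c) (b : Bool) (x : Point) :
    x ∈ vertices (flipSolid U c b) ↔ x ∈ fixedVertices U c ∨ x = pole b c := by
  have h1 : c - 1 ∈ U := h.mem_of_lt (sub_lt_self _ (by
    rw [one_eq 0]; exact add_pos_of_pos_of_nonneg (e_pos _) (add_nonneg (e_nonneg _) (e_nonneg _))))
  have h2 : c + 1 ∉ U := h.notMem_of_le (le_add_of_nonneg_right zero_le_one)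
  have h4 := h.notMem
  simp only [fixedVertices, Set.mem_inter_iff, h.mono.mem_vertices, h.mono_insert.mem_vertices,
    (h.mono_flipSolid b).mem_vertices, Set.mem_insert_iff, not_or]
  cases b
  · simp only [flipSolid, cond_false, pole]
    by_cases hx : x = c
    · subst hx
      simp [h1, h4]
    · simp only [hx, not_false_eq_true, true_and, or_false]
      tauto
  · simp only [flipSolid, cond_true, pole, Set.mem_insert_iff, not_or]
    by_cases hx : x = c + 1
    · subst hx
      simp [h2]
    · have : x - 1 ≠ c := fun h5 => hx (sub_eq_iff_eq_add.1 h5)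
      simp only [hx, this, or_false, false_or]
      tauto

theorem pole_notMem (h : IsFlip U c) (b : Bool) : pole b c ∉ fixedVertices U c := by
  simp only [fixedVertices, Set.mem_inter_iff, h.mono.mem_vertices, h.mono_insert.mem_vertices]
  cases b <;> simp [pole, h.notMem]

theorem cubeEdge_inner_notMem (h : IsFlip U c) (b : Bool) {l : LocalEdge} (hl : l ∈ innerEdges) :
    cubeEdge b c l ∉ fixedEdges U c := by
  obtain ⟨i, j⟩ := l
  obtain rfl : i = j := hl
  simp only [fixedEdges, Set.mem_inter_iff, h.mono.mem_edges, h.mono_insert.mem_edges]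
  cases b
  · simp [cubeEdge, localOffset]
  · rintro ⟨⟨h1, -⟩, -⟩
    refine h.notMem ?_
    have : c + (e (i + 1) + e (i + 2)) + e i - 1 = c := by rw [one_eq i]; abel
    simpa [cubeEdge, localOffset, this] using h1

theorem cubeEdge_mem (h : IsFlip U c) (b : Bool) (l : LocalEdge) :
    cubeEdge b c l ∈ edges (flipSolid U c b) := by
  rw [← localSide_occurrence b l, ← side_cubeFace]
  exact side_mem_edges (h.mono_flipSolid b) (h.cubeFace_mem b _) _

theorem cubeEdge_outer_mem (h : IsFlip U c) (b : Bool) {l : LocalEdge} (hl : l ∉ innerEdges) :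
    cubeEdge b c l ∈ fixedEdges U c := by
  refine ((h.mem_edges b _).1 (h.cubeEdge_mem b l)).resolve_right fun h1 => hl ?_
  have := cubeEdge_injective b c h1
  simp only [cubeEdge] at this
  rw [this]
  rfl

theorem side_mem_fixedEdges (h : IsFlip U c) {f : LatticeSquare} (hf : f ∈ fixedFaces U c)
    (s : Side) : side f s ∈ fixedEdges U c :=
  ⟨side_mem_edges h.mono hf.1 s, side_mem_edges h.mono_insert hf.2 s⟩

theorem edges_eq (h : IsFlip U c) (b : Bool) :
    edges (flipSolid U c b) = fixedEdges U c ∪ cubeEdge b c '' innerEdges := by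
  ext a
  rw [h.mem_edges, Set.mem_union]
  refine or_congr_right ⟨fun ha => ⟨_, rfl, ha.symm⟩, ?_⟩
  rintro ⟨⟨i, j⟩, hl, rfl⟩
  obtain rfl : i = j := hl
  rfl

end IsFlip

/-! ### Configurations before and after a flip -/

/-- Two edges are the ends of an arc of a labelling of the fixed faces. -/
def fixedRel {U : SteppedSolid} {c : Point} (τ : fixedFaces U c → LocalConfig)
    (a b : LatticeEdge) : Prop :=
  ∃ (f : fixedFaces U c) (s : Side), a = side f.1 s ∧ b = side f.1 ((τ f).partner s)

open Classical in
/-- The labelling with given local configurations at the fixed faces and at the cube. -/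
noncomputable def glueLabelling {U : SteppedSolid} {c : Point} (b : Bool)
    (τ : fixedFaces U c → LocalConfig) (s : Triple) : FaceLabelling (flipSolid U c b) :=
  fun f => if h : f.1 ∈ fixedFaces U c then τ ⟨f.1, h⟩ else s f.1.2

namespace IsFlip

variable {U : SteppedSolid} {c : Point}

theorem glueLabelling_fixed (b : Bool) (τ : fixedFaces U c → LocalConfig) (s : Triple)
    {f : faces (flipSolid U c b)} (hf : f.1 ∈ fixedFaces U c) :
    glueLabelling b τ s f = τ ⟨f.1, hf⟩ := dif_pos hf

theorem glueLabelling_cubeFace (h : IsFlip U c) (b : Bool) (τ : fixedFaces U c → LocalConfig)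
    (s : Triple) (k : Fin 3) (hf : cubeFace b c k ∈ faces (flipSolid U c b)) :
    glueLabelling b τ s ⟨_, hf⟩ = s k := dif_neg (h.cubeFace_notMem b k)

/-- Every labelling is glued from its parts. -/
theorem glueLabelling_eq (h : IsFlip U c) (b : Bool) (σ : FaceLabelling (flipSolid U c b)) :
    glueLabelling b (fun f => σ ⟨f.1, h.fixedFaces_subset b f.2⟩)
      (fun k => σ ⟨_, h.cubeFace_mem b k⟩) = σ := by
  ext f
  obtain ⟨f, hf⟩ := f
  by_cases hfX : f ∈ fixedFaces U c
  · rw [glueLabelling_fixed b _ _ hfX]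
  · have := ((h.mem_faces b f).1 hf).resolve_left hfX
    generalize f.2 = k at this
    subst this
    rw [h.glueLabelling_cubeFace]

theorem glueLabelling_inj (h : IsFlip U c) (b : Bool) {τ τ' : fixedFaces U c → LocalConfig}
    {s s' : Triple} (hg : glueLabelling b τ s = glueLabelling b τ' s') : τ = τ' ∧ s = s' := by
  constructor
  · ext f
    have := congrFun hg ⟨f.1, h.fixedFaces_subset b f.2⟩
    rwa [glueLabelling_fixed b _ _ f.2, glueLabelling_fixed b _ _ f.2] at this
  · ext k
    have := congrFun hg ⟨_, h.cubeFace_mem b k⟩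
    rwa [h.glueLabelling_cubeFace, h.glueLabelling_cubeFace] at this

theorem isGluing (h : IsFlip U c) (b : Bool) (τ : fixedFaces U c → LocalConfig) :
    IsGluing (fixedRel τ) (cubeEdge b c) (fixedEdges U c) innerEdges where
  inj := cubeEdge_injective b c
  mem := by
    rintro _ _ ⟨f, s, rfl, rfl⟩
    exact ⟨h.side_mem_fixedEdges f.2 _, h.side_mem_fixedEdges f.2 _⟩
  inner := fun _ hl => h.cubeEdge_inner_notMem b hl
  outer := fun _ hl => h.cubeEdge_outer_mem b hl

/-- Puts a configuration into the form required by the surgery lemmas: arcs in fixed faces plus arcs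
in the hexagon. -/
theorem linkRel_glueLabelling (h : IsFlip U c) (b : Bool) (τ : fixedFaces U c → LocalConfig)
    (s : Triple) : linkRel (glueLabelling b τ s) =
      glueRel (fixedRel τ) (arcRel b s) (cubeEdge b c) := by
  ext x y
  constructor
  · rintro ⟨⟨f, hf⟩, t, rfl, rfl⟩
    by_cases hfX : f ∈ fixedFaces U c
    · refine .inl ⟨⟨f, hfX⟩, t, rfl, ?_⟩
      rw [glueLabelling_fixed b _ _ hfX]
    · have := ((h.mem_faces b f).1 hf).resolve_left hfX
      generalize f.2 = k at this
      subst this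
      refine .inr ⟨_, _, ⟨k, t, rfl, rfl⟩, side_cubeFace .., ?_⟩
      rw [h.glueLabelling_cubeFace, side_cubeFace]
  · rintro (⟨f, t, rfl, rfl⟩ | ⟨_, _, ⟨k, t, rfl, rfl⟩, rfl, rfl⟩)
    · refine ⟨⟨f.1, h.fixedFaces_subset b f.2⟩, t, rfl, ?_⟩
      rw [glueLabelling_fixed b _ _ f.2]
    · refine ⟨⟨_, h.cubeFace_mem b k⟩, t, (side_cubeFace ..).symm, ?_⟩
      rw [h.glueLabelling_cubeFace, side_cubeFace]

/-- The connections of the fixed edges in a glued configuration. -/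
def outerRel (b : Bool) (τ : fixedFaces U c → LocalConfig) (s : Triple) :
    LatticeEdge → LatticeEdge → Prop :=
  traceRel (fixedRel τ) (arcRel b s) (cubeEdge b c) innerEdges

theorem cubeEdge_outer {l : LocalEdge} (hl : l ∉ innerEdges) :
    cubeEdge false c l = cubeEdge true c l := by
  have : ¬ l.1 = l.2 := hl
  simp [cubeEdge, localOffset, this]

/-- The boundary edges of the hexagon are the same lattice edges seen from below and from above, so
only their connections matter. -/
theorem outerRel_eq {τ : fixedFaces U c → LocalConfig} {s s' : Triple} (hs : SameBoundary s s') :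
    outerRel false τ s = outerRel true τ s' := by
  ext x y
  refine or_congr_right ?_
  constructor
  · rintro ⟨l, l', hl, hl', hll, rfl, rfl⟩
    exact ⟨l, l', hl, hl', (hs.2 l l' hl hl').1 hll, cubeEdge_outer hl, cubeEdge_outer hl'⟩
  · rintro ⟨l, l', hl, hl', hll, rfl, rfl⟩
    exact ⟨l, l', hl, hl', (hs.2 l l' hl hl').2 hll, (cubeEdge_outer hl).symm,
      (cubeEdge_outer hl').symm⟩

theorem encard_inner {b : Bool} {s : Triple} (hs : LocalValid b s) :
    {S | ∃ l ∈ innerEdges, S = {l' | Relation.EqvGen (arcRel b s) l l'} ∧ S ⊆ innerEdges}.encard =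
      if hasInnerLoop s then 1 else 0 := by
  split_ifs with h
  · rw [Set.encard_eq_one]
    refine ⟨innerEdges, ?_⟩
    ext S
    have key : ∀ l ∈ innerEdges, {l' | Relation.EqvGen (arcRel b s) l l'} = innerEdges := by
      rintro ⟨i, j⟩ hl
      obtain rfl : i = j := hl
      ext l'
      exact eqvGen_of_hasInnerLoop h i l'
    constructor
    · rintro ⟨l, hl, rfl, -⟩
      exact key l hl
    · rintro rfl
      exact ⟨(0, 0), rfl, (key _ rfl).symm, subset_rfl⟩
  · rw [Set.encard_eq_zero, Set.eq_empty_iff_forall_notMem]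
    rintro S ⟨⟨i, j⟩, hl, rfl, hS⟩
    obtain rfl : i = j := hl
    obtain ⟨l, hl, hil⟩ := hs.exists_boundary h i
    exact hl (hS hil)

/-- The first term depends on the triple only through its boundary connections; the second is the
possible loop inside the hexagon, which is hidden from the outside. -/
theorem encard_loops_glueLabelling (h : IsFlip U c) (b : Bool) (τ : fixedFaces U c → LocalConfig)
    {s : Triple} (hs : LocalValid b s) : (loops (glueLabelling b τ s)).encard =
      (finiteClasses (outerRel b τ s) (fixedEdges U c)).encard +
        if hasInnerLoop s then 1 else 0 := by
  rw [encard_loops (h.mono_flipSolid b), h.linkRel_glueLabelling, h.edges_eq,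
    (h.isGluing b τ).encard_finiteClasses, encard_inner hs, outerRel]

end IsFlip

end KashaevLoops

/-! ### Tautness under a flip. -/

namespace KashaevLoops

theorem OutsideBall.mono {R R' : ℝ} {x : Point} (hR : 0 ≤ R) (h : R ≤ R')
    (hx : OutsideBall R' x) : OutsideBall R x :=
  lt_of_le_of_lt (pow_le_pow_left₀ hR h 2) hx

/-- Each coordinate of a corner of the cube is at most `|c i| + 1` in absolute value, and a sum of
squares of nonnegative numbers is at most the square of their sum. -/
theorem not_outsideBall {c x : Point} {R : ℝ} (hR : ∑ i, (|(c i : ℝ)| + 1) ≤ R)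
    (h1 : c ≤ x) (h2 : x ≤ c + 1) : ¬ OutsideBall R x := by
  rw [OutsideBall, not_lt]
  have h3 : ∀ i, (x i : ℝ) ^ 2 ≤ (|(c i : ℝ)| + 1) ^ 2 := by
    intro i
    rw [sq_le_sq, abs_of_nonneg (a := |(c i : ℝ)| + 1) (by positivity), abs_le]
    have a1 : (c i : ℝ) ≤ x i := by exact_mod_cast h1 i
    have a2 : (x i : ℝ) ≤ c i + 1 := by exact_mod_cast h2 i
    have a3 := le_abs_self (c i : ℝ)
    have a4 := neg_abs_le (c i : ℝ)
    constructor <;> linarith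
  calc ∑ i, (x i : ℝ) ^ 2 ≤ ∑ i, (|(c i : ℝ)| + 1) ^ 2 := Finset.sum_le_sum fun i _ => h3 i
    _ ≤ (∑ i, (|(c i : ℝ)| + 1)) ^ 2 :=
      Finset.sum_sq_le_sq_sum_of_nonneg fun i _ => by positivity
    _ ≤ R ^ 2 := pow_le_pow_left₀ (Finset.sum_nonneg fun i _ => by positivity) hR 2

/-- The conditions on the fixed faces under which a glued configuration is taut, given the
colours and the connections on the boundary of the hexagon. -/
def OuterTaut {U : SteppedSolid} {c : Point} (τ : fixedFaces U c → LocalConfig)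
    (γ : LocalEdge → Colour) (r : LatticeEdge → LatticeEdge → Prop) : Prop :=
  (∀ (f h : fixedFaces U c) (s t : Side), side f.1 s = side h.1 t →
    (τ f).colour s = (τ h).colour t) ∧
  (∀ (f : fixedFaces U c) (s : Side), ∀ l ∉ innerEdges, side f.1 s = cubeEdge false c l →
    (τ f).colour s = γ l) ∧
  ∃ R : ℝ, 0 ≤ R ∧ ∑ i, (|(c i : ℝ)| + 1) ≤ R ∧
    (∀ x, OutsideBall R x → (x ∈ fixedVertices U c ↔ x ∈ vertices negativeCorner)) ∧
    (∀ (f : fixedFaces U c) (hf0 : f.1 ∈ faces negativeCorner),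
      (∀ v, OutsideBall R (corner f.1 v)) → τ f = initialConfig ⟨f.1, hf0⟩) ∧
    (∀ a b : LatticeEdge, OutsideBall R a.1 → OutsideBall R (a.1 + e a.2) →
      OutsideBall R b.1 → OutsideBall R (b.1 + e b.2) →
      ConnectedIn initialConfig a b → Relation.EqvGen r a b)

namespace IsFlip

variable {U : SteppedSolid} {c : Point}

/-- No fixed face has an inner edge as a side. A shared side thus lies between fixed faces, between
faces of the cube, or on the boundary of the hexagon. -/
theorem isLoopConfig_glueLabelling_iff (h : IsFlip U c) (b : Bool)
    (τ : fixedFaces U c → LocalConfig) (s : Triple) :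
    IsLoopConfig (glueLabelling b τ s) ↔ LocalValid b s ∧
      (∀ (f h : fixedFaces U c) (s t : Side), side f.1 s = side h.1 t →
        (τ f).colour s = (τ h).colour t) ∧
      (∀ (f : fixedFaces U c) (t : Side), ∀ l ∉ innerEdges, side f.1 t = cubeEdge false c l →
        (τ f).colour t = localColour b s l) := by
  have hb : ∀ l ∉ innerEdges, cubeEdge false c l = cubeEdge b c l := by
    cases b
    · exact fun _ _ => rfl
    · exact fun l hl => cubeEdge_outer hl
  constructor
  · intro hσ
    have hP : ∀ k t k' t', localSide b k t = localSide b k' t' →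
        (s k).colour t = (s k').colour t' := by
      intro k t k' t' hk
      have := hσ ⟨_, h.cubeFace_mem b k⟩ ⟨_, h.cubeFace_mem b k'⟩ t t'
        (by rw [side_cubeFace, side_cubeFace, hk])
      rwa [h.glueLabelling_cubeFace, h.glueLabelling_cubeFace] at this
    refine ⟨⟨localColour b s, fun k t => hP _ _ _ _ (localSide_occurrence ..).symm⟩, ?_, ?_⟩
    · intro f h' t t' ht
      have := hσ ⟨f.1, h.fixedFaces_subset b f.2⟩ ⟨h'.1, h.fixedFaces_subset b h'.2⟩ t t' ht
      rwa [glueLabelling_fixed b _ _ f.2, glueLabelling_fixed b _ _ h'.2] at this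
    · intro f t l hl ht
      have := hσ ⟨f.1, h.fixedFaces_subset b f.2⟩ ⟨_, h.cubeFace_mem b (occurrence b l).1⟩ t
        (occurrence b l).2 (by rw [ht, side_cubeFace, localSide_occurrence, hb l hl])
      rwa [glueLabelling_fixed b _ _ f.2, h.glueLabelling_cubeFace] at this
  · rintro ⟨hs, h1, h2⟩
    have h3 : ∀ (f : fixedFaces U c) (t : Side) (k : Fin 3) (t' : Side),
        side f.1 t = side (cubeFace b c k) t' → (τ f).colour t = (s k).colour t' := by
      intro f t k t' ht
      rw [side_cubeFace] at ht
      have hl : localSide b k t' ∉ innerEdges := fun hl =>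
        h.cubeEdge_inner_notMem b hl (ht ▸ h.side_mem_fixedEdges f.2 t)
      rw [h2 f t _ hl (ht.trans (hb _ hl).symm), hs.colour_eq]
    rintro ⟨f, hf⟩ ⟨f', hf'⟩ t t' ht
    simp only at ht
    by_cases hX : f ∈ fixedFaces U c <;> by_cases hX' : f' ∈ fixedFaces U c
    · rw [glueLabelling_fixed b _ _ hX, glueLabelling_fixed b _ _ hX']
      exact h1 _ _ _ _ ht
    · have := ((h.mem_faces b f').1 hf').resolve_left hX'
      generalize f'.2 = k at this
      subst this
      rw [glueLabelling_fixed b _ _ hX, h.glueLabelling_cubeFace]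
      exact h3 ⟨f, hX⟩ _ _ _ ht
    · have := ((h.mem_faces b f).1 hf).resolve_left hX
      generalize f.2 = k at this
      subst this
      rw [h.glueLabelling_cubeFace, glueLabelling_fixed (f := ⟨f', hf'⟩) b _ _ hX']
      exact (h3 ⟨f', hX'⟩ _ _ _ ht.symm).symm
    · have e1 := ((h.mem_faces b f).1 hf).resolve_left hX
      generalize f.2 = k at e1
      subst e1
      have e2 := ((h.mem_faces b f').1 hf').resolve_left hX'
      generalize f'.2 = k' at e2
      subst e2
      rw [side_cubeFace, side_cubeFace] at ht
      rw [h.glueLabelling_cubeFace, h.glueLabelling_cubeFace, hs.colour_eq, hs.colour_eq,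
        cubeEdge_injective b c ht]

theorem pole_not_outsideBall {R : ℝ} (hR : ∑ i, (|(c i : ℝ)| + 1) ≤ R) (b : Bool) :
    ¬ OutsideBall R (pole b c) := by
  cases b
  · exact not_outsideBall hR le_rfl (le_add_of_nonneg_right zero_le_one)
  · exact not_outsideBall hR (le_add_of_nonneg_right zero_le_one) le_rfl

theorem e_le_one (i : Fin 3) : e i ≤ 1 := fun j => by
  rw [e_apply]; split_ifs <;> simp

theorem cubeFace_not_outsideBall {R : ℝ} (hR : ∑ i, (|(c i : ℝ)| + 1) ≤ R) (b : Bool)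
    (k : Fin 3) : ¬ OutsideBall R (cubeFace b c k).1 := by
  cases b
  · exact not_outsideBall hR le_rfl (le_add_of_nonneg_right zero_le_one)
  · exact not_outsideBall hR (le_add_of_nonneg_right (e_nonneg k)) (add_le_add_right (e_le_one k) c)

theorem cubeEdge_not_outsideBall {R : ℝ} (hR : ∑ i, (|(c i : ℝ)| + 1) ≤ R) (b : Bool)
    (i : Fin 3) : ¬ OutsideBall R (cubeEdge b c (i, i)).1 := by
  cases b
  · exact not_outsideBall hR (by simp [cubeEdge, localOffset])
      (by simp [cubeEdge, localOffset])
  · have h0 : 0 ≤ e (i + 1) + e (i + 2) := add_nonneg (e_nonneg _) (e_nonneg _)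
    refine not_outsideBall hR (by simpa [cubeEdge, localOffset] using h0) ?_
    simp only [cubeEdge, localOffset, if_true]
    rw [one_eq i]
    exact add_le_add_right (le_add_of_nonneg_left (e_nonneg i)) c

/-- With a ball that contains the cube, the conditions of tautness outside it concern only fixed
vertices, faces and edges, and the triple enters only through its boundary data. -/
theorem isTaut_glueLabelling_iff (h : IsFlip U c) (b : Bool) (τ : fixedFaces U c → LocalConfig)
    (s : Triple) : IsTaut (glueLabelling b τ s) ↔
      LocalValid b s ∧ OuterTaut τ (localColour b s) (outerRel b τ s) := by
  have hV := h.mono_flipSolid b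
  have hvert : ∀ {R : ℝ}, ∑ i, (|(c i : ℝ)| + 1) ≤ R → ∀ x, OutsideBall R x →
      (x ∈ vertices (flipSolid U c b) ↔ x ∈ fixedVertices U c) := by
    intro R hR x hx
    rw [h.mem_vertices, or_iff_left]
    rintro rfl
    exact pole_not_outsideBall hR b hx
  have hedge : ∀ {R : ℝ}, ∑ i, (|(c i : ℝ)| + 1) ≤ R → ∀ a : LatticeEdge, OutsideBall R a.1 →
      (a ∈ edges (flipSolid U c b) ↔ a ∈ fixedEdges U c) := by
    intro R hR a ha
    rw [h.mem_edges, or_iff_left]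
    intro h1
    rw [h1] at ha
    exact cubeEdge_not_outsideBall hR b _ ha
  have hconn : ∀ {x y : LatticeEdge}, x ∈ fixedEdges U c → y ∈ fixedEdges U c →
      (ConnectedIn (glueLabelling b τ s) x y ↔ Relation.EqvGen (outerRel b τ s) x y) := by
    intro x y hx hy
    rw [connectedIn_iff hV, h.mem_edges, h.mem_edges, h.linkRel_glueLabelling,
      (h.isGluing b τ).eqvGen_iff hx hy, outerRel]
    simp [hx, hy]
  rw [IsTaut, h.isLoopConfig_glueLabelling_iff]
  simp only [OuterTaut, and_assoc]
  refine and_congr_right fun hs => and_congr_right fun _ => and_congr_right fun _ => ?_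
  constructor
  · rintro ⟨R, hR, h1, h2, h3⟩
    -- All the conditions concern the outside of the ball, so they persist when the ball is enlarged
    -- to contain the cube.
    set R' := max R (∑ i, (|(c i : ℝ)| + 1))
    have hRR : R ≤ R' := le_max_left _ _
    have hR' : ∑ i, (|(c i : ℝ)| + 1) ≤ R' := le_max_right _ _
    have hout : ∀ {x}, OutsideBall R' x → OutsideBall R x := fun hx => hx.mono hR hRR
    refine ⟨R', hR.trans hRR, hR', fun x hx => ?_, fun f hf0 hf => ?_,
      fun x y hx hx' hy hy' hxy => ?_⟩
    · rw [← h1 x (hout hx), hvert hR' x hx]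
    · rw [← h2 f.1 (h.fixedFaces_subset b f.2) hf0 fun v => hout (hf v),
        glueLabelling_fixed b _ _ f.2]
    · have h4 := h3 x y (hout hx) (hout hx') (hout hy) (hout hy') hxy
      obtain ⟨hx1, hy1, -⟩ := id h4
      exact (hconn ((hedge hR' x hx).1 hx1) ((hedge hR' y hy).1 hy1)).1 h4
  · rintro ⟨R, hR, hR', h1, h2, h3⟩
    refine ⟨R, hR, fun x hx => ?_, fun f hf hf0 hfo => ?_, fun x y hx hx' hy hy' hxy => ?_⟩
    · rw [hvert hR' x hx, h1 x hx]
    · have hfX : f ∈ fixedFaces U c := by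
        refine ((h.mem_faces b f).1 hf).resolve_right fun h4 => ?_
        have h5 := hfo .low
        rw [h4] at h5
        exact cubeFace_not_outsideBall hR' b f.2 (by simpa [corner, Corner.offset] using h5)
      rw [glueLabelling_fixed b _ _ hfX]
      exact h2 ⟨f, hfX⟩ hf0 hfo
    · have hmem : ∀ a : LatticeEdge, OutsideBall R a.1 → OutsideBall R (a.1 + e a.2) →
          a ∈ edges negativeCorner → a ∈ fixedEdges U c := by
        intro a ha ha' ha0
        refine (hedge hR' a ha).1 ⟨?_, ?_⟩
        · exact (hvert hR' _ ha).2 ((h1 _ ha).2 ha0.1)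
        · exact (hvert hR' _ ha').2 ((h1 _ ha').2 ha0.2)
      obtain ⟨hx0, hy0, -⟩ := id hxy
      exact (hconn (hmem x hx hx' hx0) (hmem y hy hy' hy0)).2 (h3 x y hx hx' hy hy' hxy)

theorem isTaut_glueLabelling_congr (h : IsFlip U c) (τ : fixedFaces U c → LocalConfig)
    {s s' : Triple} (hs : LocalValid false s) (hs' : LocalValid true s')
    (hss : SameBoundary s s') :
    IsTaut (glueLabelling false τ s) ↔ IsTaut (glueLabelling true τ s') := by
  rw [h.isTaut_glueLabelling_iff, h.isTaut_glueLabelling_iff, outerRel_eq hss]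
  simp only [hs, hs', true_and, OuterTaut]
  refine and_congr_right fun _ => and_congr_left fun _ => ?_
  refine forall_congr' fun f => forall_congr' fun t => forall_congr' fun l =>
    forall_congr' fun hl => ?_
  rw [hss.1 l hl]

end IsFlip

end KashaevLoops

/-! ### Weights under a flip. -/

namespace KashaevLoops

/-- The partition function of the taut configurations on the surface of `U` is well defined. -/
def WellDefined (U : SteppedSolid) : Prop :=
  (tautConfigs U).Finite ∧ ∀ σ ∈ tautConfigs U, (loops σ).Finite ∧
    {x | x ∈ vertices U ∧ vertexExp σ x ≠ 0}.Finite ∧ {f : faces U | (σ f).faceExp ≠ 0}.Finite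

namespace IsFlip

variable {U : SteppedSolid} {c : Point}

open Classical in
/-- Twice the exponent of a vertex variable in the weights of the fixed faces. -/
noncomputable def fixedExp (τ : fixedFaces U c → LocalConfig) (x : Point) : ℤ :=
  ∑ k : Fin 3, ∑ v : Corner,
    if h : ((x - v.offset k, k) : LatticeSquare) ∈ fixedFaces U c then
      ((τ ⟨_, h⟩).cornerExp v : ℤ) else 0

open Classical in
/-- Twice the exponent of a vertex variable in the weights of the faces of the cube. -/
noncomputable def cubeExp (b : Bool) (c : Point) (s : Triple) (x : Point) : ℕ :=
  ∑ k : Fin 3, ∑ v : Corner, if x = corner (cubeFace b c k) v then (s k).cornerExp v else 0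

/-- Each face around `x` is either fixed or a face of the cube, never both. The constant `-4`, the
doubled exponent of `g x ^ (-2)`, is kept with the fixed part. -/
theorem vertexExp_glueLabelling (h : IsFlip U c) (b : Bool) (τ : fixedFaces U c → LocalConfig)
    (s : Triple) (x : Point) :
    vertexExp (glueLabelling b τ s) x = (fixedExp τ x - 4) + (cubeExp b c s x : ℤ) := by
  have key : ∀ A B C : ℤ, A = B + C → A - 4 = (B - 4) + C := by intros; omega
  rw [vertexExp, fixedExp, cubeExp]
  refine key _ _ _ ?_
  push_cast
  rw [← Finset.sum_add_distrib]
  refine Finset.sum_congr rfl fun k _ => ?_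
  rw [← Finset.sum_add_distrib]
  refine Finset.sum_congr rfl fun v _ => ?_
  have hcube : x = corner (cubeFace b c k) v ↔ (x - v.offset k, k) = cubeFace b c k := by
    simp only [corner, cubeFace, Prod.mk.injEq, and_true, sub_eq_iff_eq_add]
  by_cases hX : (x - v.offset k, k) ∈ fixedFaces U c
  · have h1 := h.fixedFaces_subset b hX
    have h2 : x ≠ corner (cubeFace b c k) v := by
      rw [Ne, hcube]
      exact fun h3 => h.cubeFace_notMem b k (h3 ▸ hX)
    rw [dif_pos h1, dif_pos hX, if_neg h2, glueLabelling_fixed b _ _ hX, add_zero]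
  · rw [dif_neg hX, zero_add]
    by_cases h1 : x = corner (cubeFace b c k) v
    · rw [if_pos h1]
      rw [hcube] at h1
      have h2 := h.cubeFace_mem b k
      rw [← h1] at h2
      rw [dif_pos h2]
      have h3 : glueLabelling b τ s ⟨_, h2⟩ = s k := dif_neg hX
      rw [h3]
    · rw [if_neg h1, dif_neg]
      · intro h2
        exact h1 (hcube.2 (((h.mem_faces b _).1 h2).resolve_left hX))

theorem corner_mem_fixedVertices (h : IsFlip U c) {f : LatticeSquare} (hf : f ∈ fixedFaces U c)
    (v : Corner) : corner f v ∈ fixedVertices U c :=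
  ⟨corner_mem_vertices h.mono hf.1 v, corner_mem_vertices h.mono_insert hf.2 v⟩

theorem fixedExp_pole (h : IsFlip U c) (b : Bool) (τ : fixedFaces U c → LocalConfig) :
    fixedExp τ (pole b c) = 0 := by
  refine Finset.sum_eq_zero fun k _ => Finset.sum_eq_zero fun v _ => dif_neg fun hX => ?_
  have := h.corner_mem_fixedVertices hX v
  simp only [corner, sub_add_cancel] at this
  exact h.pole_notMem b this

theorem vertices_eq (h : IsFlip U c) (b : Bool) :
    vertices (flipSolid U c b) = insert (pole b c) (fixedVertices U c) := by
  ext x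
  rw [h.mem_vertices, Set.mem_insert_iff, or_comm]

theorem faces_eq (h : IsFlip U c) (b : Bool) :
    faces (flipSolid U c b) = fixedFaces U c ∪ Set.range (cubeFace b c) := by
  ext f
  rw [h.mem_faces, Set.mem_union]
  refine or_congr_right ⟨fun hf => ⟨_, hf.symm⟩, ?_⟩
  rintro ⟨k, rfl⟩
  rfl

/-- The product of all the factors of the weight that do not change in a flip. -/
noncomputable def fixedWeight (g : Point → ℝ) (τ : fixedFaces U c → LocalConfig) : ℝ :=
  (∏ᶠ x ∈ fixedVertices U c, √(g x) ^ (fixedExp τ x - 4)) *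
    ∏ᶠ f : fixedFaces U c, faceVar g f ^ (τ f).faceExp

theorem finprod_cubeExp (h : IsFlip U c) (b : Bool) (s : Triple) (g : Point → ℝ) :
    ∏ᶠ x ∈ vertices (flipSolid U c b), √(g x) ^ cubeExp b c s x =
      ∏ k, ∏ v, √(g (corner (cubeFace b c k) v)) ^ (s k).cornerExp v := by
  classical
  set S : Finset Point :=
    Finset.univ.image fun p : Fin 3 × Corner => corner (cubeFace b c p.1) p.2
  have hS : ∀ k v, corner (cubeFace b c k) v ∈ S := fun k v =>
    Finset.mem_image_of_mem (fun p : Fin 3 × Corner => corner (cubeFace b c p.1) p.2)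
      (Finset.mem_univ (k, v))
  have hSV : ∀ x ∈ S, x ∈ vertices (flipSolid U c b) := by
    intro x hx
    obtain ⟨p, -, rfl⟩ := Finset.mem_image.1 hx
    exact corner_mem_vertices (h.mono_flipSolid b) (h.cubeFace_mem b _) _
  have hexp : ∀ x ∉ S, cubeExp b c s x = 0 := by
    intro x hx
    refine Finset.sum_eq_zero fun k _ => Finset.sum_eq_zero fun v _ => if_neg ?_
    rintro rfl
    exact hx (hS k v)
  rw [finprod_mem_eq_prod_of_inter_mulSupport_eq (t := S)]
  · simp only [cubeExp, ← Finset.prod_pow_eq_pow_sum]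
    rw [Finset.prod_comm]
    refine Finset.prod_congr rfl fun k _ => ?_
    rw [Finset.prod_comm]
    refine Finset.prod_congr rfl fun v _ => ?_
    rw [Finset.prod_eq_single (corner (cubeFace b c k) v)]
    · rw [if_pos rfl]
    · intro x _ hx
      rw [if_neg hx, pow_zero]
    · exact fun h1 => absurd (hS k v) h1
  · ext x
    simp only [Set.mem_inter_iff, Function.mem_mulSupport, Finset.mem_coe]
    refine and_congr_left fun hx => ⟨fun _ => ?_, hSV x⟩
    by_contra hxS
    exact hx (by rw [hexp x hxS, pow_zero])

/-- The finiteness hypothesis matters: `finprod` is `1` on infinite supports and is then not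
multiplicative. At the pole the fixed part contributes only the factor `g ^ (-2)`. -/
theorem finprod_vertices (h : IsFlip U c) (b : Bool) {g : Point → ℝ}
    (hg : ∀ x ∈ vertices (flipSolid U c b), 0 < g x) (τ : fixedFaces U c → LocalConfig)
    (s : Triple) (hfin : {x | x ∈ fixedVertices U c ∧ fixedExp τ x - 4 ≠ 0}.Finite) :
    ∏ᶠ x : vertices (flipSolid U c b), √(g x) ^ vertexExp (glueLabelling b τ s) x =
      (∏ᶠ x ∈ fixedVertices U c, √(g x) ^ (fixedExp τ x - 4)) *
        (∏ k, ∏ v, √(g (corner (cubeFace b c k) v)) ^ (s k).cornerExp v) / g (pole b c) ^ 2 := by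
  classical
  rw [finprod_set_coe_eq_finprod_mem (f := fun x => √(g x) ^ vertexExp (glueLabelling b τ s) x)]
  have h1 : ∏ᶠ x ∈ vertices (flipSolid U c b), √(g x) ^ vertexExp (glueLabelling b τ s) x =
      ∏ᶠ x ∈ vertices (flipSolid U c b), (√(g x) ^ (fixedExp τ x - 4) *
        √(g x) ^ cubeExp b c s x) := by
    refine finprod_mem_congr rfl fun x hx => ?_
    rw [h.vertexExp_glueLabelling, zpow_add₀ (Real.sqrt_pos.2 (hg x hx)).ne', zpow_natCast]
  have hsub : fixedVertices U c ∩ Function.mulSupport (fun x => √(g x) ^ (fixedExp τ x - 4)) ⊆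
      {x | x ∈ fixedVertices U c ∧ fixedExp τ x - 4 ≠ 0} := by
    rintro x ⟨hx, hx'⟩
    refine ⟨hx, fun h0 => hx' ?_⟩
    simp only [h0, zpow_zero]
  have hA : (vertices (flipSolid U c b) ∩
      Function.mulSupport fun x => √(g x) ^ (fixedExp τ x - 4)).Finite := by
    refine ((hfin.subset hsub).insert (pole b c)).subset ?_
    rintro x ⟨hx, hx'⟩
    rcases (h.mem_vertices b x).1 hx with hx1 | rfl
    · exact .inr ⟨hx1, hx'⟩
    · exact .inl rfl
  have hB : (vertices (flipSolid U c b) ∩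
      Function.mulSupport fun x => √(g x) ^ cubeExp b c s x).Finite := by
    refine (Set.toFinite (Set.range fun p : Fin 3 × Corner =>
      corner (cubeFace b c p.1) p.2)).subset ?_
    rintro x ⟨-, hx'⟩
    by_contra hx
    refine hx' ?_
    have : cubeExp b c s x = 0 := by
      refine Finset.sum_eq_zero fun k _ => Finset.sum_eq_zero fun v _ => if_neg ?_
      rintro rfl
      exact hx ⟨(k, v), rfl⟩
    simp only [this, pow_zero]
  rw [h1, finprod_mem_mul_distrib' hA hB, h.finprod_cubeExp, h.vertices_eq,
    finprod_mem_insert' _ (h.pole_notMem b) (hfin.subset hsub), h.fixedExp_pole]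
  have hp : 0 < g (pole b c) := hg _ ((h.mem_vertices b _).2 (.inr rfl))
  have h2 : √(g (pole b c)) ^ ((0 : ℤ) - 4) = (g (pole b c) ^ 2)⁻¹ := by
    rw [show ((0 : ℤ) - 4) = -((4 : ℕ) : ℤ) by norm_num, zpow_neg, zpow_natCast,
      show (4 : ℕ) = 2 * 2 by norm_num, pow_mul, Real.sq_sqrt hp.le]
  rw [h2]
  ring

theorem finprod_faces (h : IsFlip U c) (b : Bool) (g : Point → ℝ)
    (τ : fixedFaces U c → LocalConfig) (s : Triple)
    (hfin : {f : fixedFaces U c | (τ f).faceExp ≠ 0}.Finite) :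
    ∏ᶠ f : faces (flipSolid U c b), faceVar g f ^ (glueLabelling b τ s f).faceExp =
      (∏ᶠ f : fixedFaces U c, faceVar g f ^ (τ f).faceExp) *
        ∏ k, faceVar g (cubeFace b c k) ^ (s k).faceExp := by
  classical
  set F : LatticeSquare → ℝ := fun f =>
    faceVar g f ^ (if hf : f ∈ fixedFaces U c then τ ⟨f, hf⟩ else s f.2).faceExp
  have hF : ∀ f : fixedFaces U c, F f = faceVar g f ^ (τ f).faceExp := by
    intro f
    simp only [F, dif_pos f.2]
  have hinj : Function.Injective (cubeFace b c) := fun k k' hk => congrArg Prod.snd hk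
  have hfin' : (fixedFaces U c ∩ Function.mulSupport F).Finite := by
    refine (hfin.image Subtype.val).subset ?_
    rintro f ⟨hf, hf'⟩
    refine ⟨⟨f, hf⟩, fun h0 => hf' ?_, rfl⟩
    change F (⟨f, hf⟩ : fixedFaces U c) = 1
    rw [hF, h0, pow_zero]
  have e1 : ∏ᶠ f : faces (flipSolid U c b), faceVar g f ^ (glueLabelling b τ s f).faceExp =
      ∏ᶠ f ∈ faces (flipSolid U c b), F f := by
    rw [← finprod_set_coe_eq_finprod_mem]
    rfl
  rw [e1, h.faces_eq, finprod_mem_union' ?_ hfin' ((Set.toFinite _).inter_of_left _),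
    finprod_mem_range hinj, ← finprod_set_coe_eq_finprod_mem,
    finprod_eq_prod_of_fintype fun k => F (cubeFace b c k)]
  · congr 1
    · exact finprod_congr hF
    · refine Finset.prod_congr rfl fun k _ => ?_
      simp only [F, dif_neg (h.cubeFace_notMem b k)]
      rfl
  · rw [Set.disjoint_right]
    rintro _ ⟨k, rfl⟩
    exact h.cubeFace_notMem b k

/-- Separates the factors that the outside determines from the local weights of the cube. Finiteness
of the outer loops is needed because `ncard` is `0` on infinite sets. -/
theorem tautWeight_glueLabelling (h : IsFlip U c) (b : Bool) {g : Point → ℝ}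
    (hg : ∀ x ∈ vertices (flipSolid U c b), 0 < g x) (τ : fixedFaces U c → LocalConfig)
    {s : Triple} (hs : LocalValid b s)
    (hvert : {x | x ∈ fixedVertices U c ∧ fixedExp τ x - 4 ≠ 0}.Finite)
    (hface : {f : fixedFaces U c | (τ f).faceExp ≠ 0}.Finite)
    (hloop : (finiteClasses (outerRel b τ s) (fixedEdges U c)).Finite) :
    tautWeight g (glueLabelling b τ s) =
      2 ^ (finiteClasses (outerRel b τ s) (fixedEdges U c)).ncard * fixedWeight g τ *
        (2 ^ (if hasInnerLoop s then 1 else 0) * ∏ k, localWeight g (cubeFace b c k) (s k)) /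
          g (pole b c) ^ 2 := by
  have hn : (loops (glueLabelling b τ s)).ncard =
      (finiteClasses (outerRel b τ s) (fixedEdges U c)).ncard +
        if hasInnerLoop s then 1 else 0 := by
    have := h.encard_loops_glueLabelling b τ hs
    rw [← hloop.cast_ncard_eq] at this
    rw [Set.ncard, this]
    split_ifs
    · exact ENat.toNat_natCast (_ + 1)
    · simp
  have hw : ∀ k, localWeight g (cubeFace b c k) (s k) =
      (∏ v, √(g (corner (cubeFace b c k) v)) ^ (s k).cornerExp v) *
        faceVar g (cubeFace b c k) ^ (s k).faceExp := fun k =>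
    localWeight_eq g _ (fun v => (hg _ (corner_mem_vertices (h.mono_flipSolid b)
      (h.cubeFace_mem b k) v)).le) _
  rw [tautWeight, hn, h.finprod_vertices b hg τ s hvert, h.finprod_faces b g τ s hface]
  simp only [hw, Finset.prod_mul_distrib, fixedWeight, pow_add]
  ring

end IsFlip

end KashaevLoops

/-! ### Invariance of the partition function under a flip. -/

namespace KashaevLoops
namespace IsFlip

variable {U : SteppedSolid} {c : Point}

/-- The values of the variables at a cube. -/
noncomputable def cubeValue (g : Point → ℝ) (c : Point) : Var → ℝ
  | .pole b => √(g (pole b c))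
  | .node false i => √(g (c + e i))
  | .node true i => √(g (c + (e (i + 1) + e (i + 2))))
  | .face b i => faceVar g (cubeFace b c i)
  | .two => 2

theorem cubeValue_cornerVar (g : Point → ℝ) (c : Point) (b : Bool) (k : Fin 3) (v : Corner) :
    cubeValue g c (cornerVar b k v) = √(g (corner (cubeFace b c k) v)) := by
  cases b <;> cases v <;> simp [cornerVar, cubeValue, corner, cubeFace, Corner.offset, pole,
    add_assoc, one_eq k]
  rw [add_comm (e (k + 2))]

/-- The factor of the opposite pole brings the weights below and above to the common denominator `g
c ^ 2 * g (c + 1) ^ 2`. -/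
theorem cubeValue_eval (g : Point → ℝ) (c : Point) (b : Bool) (s : Triple)
    (hg : ∀ b, 0 < g (pole b c)) (hg' : ∀ k v, 0 ≤ g (corner (cubeFace b c k) v)) :
    (tripleMonomial b s).eval (cubeValue g c) = g (pole (!b) c) ^ 2 *
      (2 ^ (if hasInnerLoop s then 1 else 0) * ∏ k, localWeight g (cubeFace b c k) (s k)) := by
  have h1 : ∀ k, (faceMonomial b k (s k)).eval (cubeValue g c) =
      localWeight g (cubeFace b c k) (s k) := by
    intro k
    have hu : (Finset.univ : Finset Corner) = {.low, .first, .second, .high} := rfl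
    rw [localWeight_eq g _ (hg' k), hu]
    unfold faceMonomial
    simp only [Monomial.eval_add, Monomial.eval_power, cubeValue_cornerVar]
    simp [cubeValue, mul_assoc]
  unfold tripleMonomial
  simp only [Monomial.eval_add, Monomial.eval_power, h1, Fin.prod_univ_three]
  have h2 : cubeValue g c (.pole (!b)) ^ 4 = g (pole (!b) c) ^ 2 := by
    rw [cubeValue, show (4 : ℕ) = 2 * 2 by norm_num, pow_mul, Real.sq_sqrt (hg _).le]
  rw [h2, cubeValue]
  ring

theorem pos_corner (h : IsFlip U c) (b : Bool) {g : Point → ℝ}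
    (hg : ∀ x ∈ vertices (flipSolid U c b), 0 < g x) (k : Fin 3) (v : Corner) :
    0 < g (corner (cubeFace b c k) v) :=
  hg _ (corner_mem_vertices (h.mono_flipSolid b) (h.cubeFace_mem b k) v)

theorem pos_step (h : IsFlip U c) {g : Point → ℝ} (hg : ∀ x ∈ vertices U, 0 < g x)
    (i : Fin 3) : 0 < g (c + e i) := by
  have := h.pos_corner false hg (i + 2) .first
  rwa [corner, Corner.offset, cubeFace, add_two_add_one] at this

theorem pos_diagonal (h : IsFlip U c) {g : Point → ℝ} (hg : ∀ x ∈ vertices U, 0 < g x)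
    (k : Fin 3) : 0 < g (c + (e (k + 1) + e (k + 2))) :=
  h.pos_corner false hg k .high

theorem pos_base (h : IsFlip U c) {g : Point → ℝ} (hg : ∀ x ∈ vertices U, 0 < g x) : 0 < g c :=
  hg c ((h.mem_vertices false c).2 (.inr rfl))

theorem pos_top (h : IsFlip U c) {g : Point → ℝ} (hg : ∀ x ∈ vertices U, 0 < g x)
    (hrec : RecurrenceAt g c) : 0 < g (c + 1) := by
  have p := h.pos_base hg
  have p0 := h.pos_step hg 0
  have p1 := h.pos_step hg 1
  have p2 := h.pos_step hg 2
  have q0 : 0 < g (c + e 1 + e 2) := by simpa [add_assoc] using h.pos_diagonal hg 0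
  have q1 : 0 < g (c + e 0 + e 2) := by
    rw [add_assoc, add_comm (e 0)]
    exact h.pos_diagonal hg 1
  have q2 : 0 < g (c + e 0 + e 1) := by simpa [add_assoc] using h.pos_diagonal hg 2
  rw [RecurrenceAt, add_e_e_e] at hrec
  rw [hrec]
  positivity

theorem pos_insert (h : IsFlip U c) {g : Point → ℝ} (hg : ∀ x ∈ vertices U, 0 < g x)
    (hrec : RecurrenceAt g c) (x : Point) (hx : x ∈ vertices (insert c U)) : 0 < g x := by
  rcases (h.mem_vertices true x).1 hx with h1 | rfl
  · exact hg x h1.1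
  · exact h.pos_top hg hrec

theorem cubeRelations (h : IsFlip U c) {g : Point → ℝ} (hg : ∀ x ∈ vertices U, 0 < g x)
    (hrec : RecurrenceAt g c) : CubeRelations (cubeValue g c) := by
  have hpole : ∀ b, 0 < g (pole b c) := by
    rintro (_ | _)
    exacts [h.pos_base hg, h.pos_top hg hrec]
  have hg2 : ∀ b, ∀ x ∈ vertices (flipSolid U c b), 0 < g x := by
    rintro (_ | _)
    exacts [hg, h.pos_insert hg hrec]
  have hc := fun b => h.pos_corner b (hg2 b)
  have hnode : ∀ b i, 0 < cubeValue g c (.node b i) := by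
    rintro (_ | _) i
    · exact Real.sqrt_pos.2 (h.pos_step hg i)
    · exact Real.sqrt_pos.2 (h.pos_diagonal hg i)
  have hface : ∀ b i, 0 < cubeValue g c (.face b i) := fun b i => by
    have := hc b i
    exact Real.sqrt_pos.2 (add_pos (mul_pos (this _) (this _)) (mul_pos (this _) (this _)))
  have hsq : ∀ b k v, cubeValue g c (cornerVar b k v) ^ 2 = g (corner (cubeFace b c k) v) := by
    intro b k v
    rw [cubeValue_cornerVar, Real.sq_sqrt (hc b k v).le]
  have hfsq : ∀ b i, cubeValue g c (.face b i) ^ 2 =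
      cubeValue g c (cornerVar b i .low) ^ 2 * cubeValue g c (cornerVar b i .high) ^ 2 +
      cubeValue g c (cornerVar b i .first) ^ 2 * cubeValue g c (cornerVar b i .second) ^ 2 := by
    intro b i
    have := hc b i
    simp only [hsq]
    exact Real.sq_sqrt (add_pos (mul_pos (this _) (this _)) (mul_pos (this _) (this _))).le
  refine ⟨?_, rfl, ?_, ?_⟩
  · rintro (b | ⟨b, i⟩ | ⟨b, i⟩ | _)
    exacts [Real.sqrt_pos.2 (hpole b), hnode b i, hface b i, two_pos]
  · rintro (_ | _) i
    · exact hfsq false i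
    · rw [hfsq true i]
      simp only [cornerVar, Bool.not_true]
      ring
  · have p := h.pos_base hg
    have n0 := Real.sq_sqrt (h.pos_step hg 0).le
    have n1 := Real.sq_sqrt (h.pos_step hg 1).le
    have n2 := Real.sq_sqrt (h.pos_step hg 2).le
    have m0 := Real.sq_sqrt (h.pos_diagonal hg 0).le
    have m1 := Real.sq_sqrt (h.pos_diagonal hg 1).le
    have m2 := Real.sq_sqrt (h.pos_diagonal hg 2).le
    have a1 : c + e 1 + e 2 = c + (e (0 + 1) + e (0 + 2)) := by simp [add_assoc]
    have a2 : c + e 0 + e 2 = c + (e (1 + 1) + e (1 + 2)) := by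
      rw [add_assoc, add_comm (e 0)]
      rfl
    have a3 : c + e 0 + e 1 = c + (e (2 + 1) + e (2 + 2)) := by simp [add_assoc]
    have f0 : cubeValue g c (.face false 0) = √(g c * g (c + (e (0 + 1) + e (0 + 2))) +
        g (c + e 1) * g (c + e 2)) := by
      simp [cubeValue, faceVar, cubeFace, corner, Corner.offset]
    have f1 : cubeValue g c (.face false 1) = √(g c * g (c + (e (1 + 1) + e (1 + 2))) +
        g (c + e 0) * g (c + e 2)) := by
      simp [cubeValue, faceVar, cubeFace, corner, Corner.offset, mul_comm]
    have f2 : cubeValue g c (.face false 2) = √(g c * g (c + (e (2 + 1) + e (2 + 2))) +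
        g (c + e 0) * g (c + e 1)) := by
      simp [cubeValue, faceVar, cubeFace, corner, Corner.offset]
    have q : cubeValue g c (.pole true) ^ 2 = g (c + 1) := Real.sq_sqrt (hpole true).le
    have q' : cubeValue g c (.pole false) ^ 2 = g c := Real.sq_sqrt p.le
    simp only [RecurrenceAt] at hrec
    rw [add_e_e_e, a1, a2, a3, ← f0, ← f1, ← f2, eq_div_iff (pow_ne_zero 2 p.ne')] at hrec
    have e1 : cubeValue g c (.pole false) ^ 4 = g c ^ 2 := by
      rw [← q', ← pow_mul]
    rw [q, q', e1]
    simp only [mul_pow]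
    have e2 : ∀ i, cubeValue g c (.node false i) = √(g (c + e i)) := fun _ => rfl
    have e3 : ∀ i, cubeValue g c (.node true i) = √(g (c + (e (i + 1) + e (i + 2)))) :=
      fun _ => rfl
    rw [e2, e2, e2, e3, e3, e3, n0, n1, n2, m0, m1, m2]
    linear_combination -hrec

open Classical in
/-- The partition function is a sum over the configurations of the fixed faces. -/
theorem tautPartition_eq_sum (h : IsFlip U c) (b : Bool) (g : Point → ℝ)
    (T : Finset (fixedFaces U c → LocalConfig))
    (hT : ∀ τ s, IsTaut (glueLabelling b τ s) → τ ∈ T) :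
    tautPartition (flipSolid U c b) g = ∑ τ ∈ T, ∑ s with LocalValid b s,
      if IsTaut (glueLabelling b τ s) then tautWeight g (glueLabelling b τ s) else 0 := by
  set P : Set ((fixedFaces U c → LocalConfig) × Triple) := {p | IsTaut (glueLabelling b p.1 p.2)}
  have hP : tautConfigs (flipSolid U c b) = (fun p => glueLabelling b p.1 p.2) '' P := by
    ext σ
    constructor
    · intro hσ
      refine ⟨(_, _), ?_, h.glueLabelling_eq b σ⟩
      rw [Set.mem_ofPred_eq]
      simp only [h.glueLabelling_eq b σ]
      exact hσ
    · rintro ⟨p, hp, rfl⟩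
      exact hp
  have hinj : Set.InjOn (fun p : (fixedFaces U c → LocalConfig) × Triple =>
      glueLabelling b p.1 p.2) P := fun p _ p' _ hpp => by
    obtain ⟨h1, h2⟩ := h.glueLabelling_inj b hpp
    exact Prod.ext h1 h2
  rw [tautPartition, hP, finsum_mem_image hinj, finsum_mem_def,
    finsum_eq_sum_of_support_subset (s := T ×ˢ Finset.univ), Finset.sum_product]
  · refine Finset.sum_congr rfl fun τ _ => ?_
    rw [Finset.sum_filter]
    refine Finset.sum_congr rfl fun s _ => ?_
    by_cases hs : IsTaut (glueLabelling b τ s)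
    · rw [if_pos ((h.isTaut_glueLabelling_iff b τ s).1 hs).1, if_pos hs, Set.indicator_of_mem]
      exact hs
    · rw [if_neg hs, ite_self, Set.indicator_of_notMem]
      exact hs
  · intro p hp
    have : p ∈ P := Set.mem_of_indicator_ne_zero hp
    simpa using hT p.1 p.2 this

/-- The fixed part of a taut configuration below the cube is that of one above the cube. -/
theorem exists_isTaut_insert (h : IsFlip U c) {g : Point → ℝ} (hg : ∀ x ∈ vertices U, 0 < g x)
    (hrec : RecurrenceAt g c) {τ : fixedFaces U c → LocalConfig} {s : Triple}
    (hs : IsTaut (glueLabelling false τ s)) : ∃ s', LocalValid true s' ∧ SameBoundary s s' ∧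
      IsTaut (glueLabelling true τ s') := by
  have hs1 := ((h.isTaut_glueLabelling_iff false τ s).1 hs).1
  obtain ⟨s', hs', hss⟩ := exists_sameBoundary (h.cubeRelations hg hrec) hs1
  have hb := sameBoundary_of_boundaryData hs1 hs' hss.symm
  exact ⟨s', hs', hb, (h.isTaut_glueLabelling_congr τ hs1 hs' hb).1 hs⟩

/-- The finiteness properties of the fixed part of a configuration. -/
structure FixedFinite (τ : fixedFaces U c → LocalConfig)
    (r : LatticeEdge → LatticeEdge → Prop) : Prop where
  vert : {x | x ∈ fixedVertices U c ∧ fixedExp τ x - 4 ≠ 0}.Finite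
  face : {f : fixedFaces U c | (τ f).faceExp ≠ 0}.Finite
  loop : (finiteClasses r (fixedEdges U c)).Finite

theorem cubeExp_eq_zero {b : Bool} {s : Triple} {x : Point}
    (hx : x ∉ Set.range fun p : Fin 3 × Corner => corner (cubeFace b c p.1) p.2) :
    cubeExp b c s x = 0 := by
  refine Finset.sum_eq_zero fun k _ => Finset.sum_eq_zero fun v _ => if_neg ?_
  rintro rfl
  exact hx ⟨(k, v), rfl⟩

/-- The faces of the cube touch finitely many vertices and add at most one loop, so finiteness of
the exponents and of the loops can be tested on the fixed part, which both surfaces share. -/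
theorem fixedFinite_iff (h : IsFlip U c) (b : Bool) (τ : fixedFaces U c → LocalConfig)
    {s : Triple} (hs : LocalValid b s) : FixedFinite τ (outerRel b τ s) ↔
      (loops (glueLabelling b τ s)).Finite ∧
      {x | x ∈ vertices (flipSolid U c b) ∧ vertexExp (glueLabelling b τ s) x ≠ 0}.Finite ∧
      {f : faces (flipSolid U c b) | (glueLabelling b τ s f).faceExp ≠ 0}.Finite := by
  have h1 : (finiteClasses (outerRel b τ s) (fixedEdges U c)).Finite ↔
      (loops (glueLabelling b τ s)).Finite := by
    rw [← Set.encard_ne_top_iff, ← Set.encard_ne_top_iff, h.encard_loops_glueLabelling b τ hs]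
    split_ifs <;> simp
  have hcorner := Set.toFinite (Set.range fun p : Fin 3 × Corner => corner (cubeFace b c p.1) p.2)
  have h2 : {x | x ∈ fixedVertices U c ∧ fixedExp τ x - 4 ≠ 0}.Finite ↔
      {x | x ∈ vertices (flipSolid U c b) ∧
        vertexExp (glueLabelling b τ s) x ≠ 0}.Finite := by
    constructor
    · intro hf
      refine ((hf.union hcorner).insert (pole b c)).subset ?_
      rintro x ⟨hx, hx'⟩
      rcases (h.mem_vertices b x).1 hx with hx1 | hx1
      · refine .inr (or_iff_not_imp_right.2 fun hxc => ⟨hx1, ?_⟩)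
        rwa [h.vertexExp_glueLabelling, cubeExp_eq_zero hxc, Nat.cast_zero, add_zero] at hx'
      · exact .inl hx1
    · intro hf
      refine (hf.union hcorner).subset ?_
      rintro x ⟨hx, hx'⟩
      refine or_iff_not_imp_right.2 fun hxc => ⟨(h.mem_vertices b x).2 (.inl hx), ?_⟩
      rwa [h.vertexExp_glueLabelling, cubeExp_eq_zero hxc, Nat.cast_zero, add_zero]
  have h3 : {f : fixedFaces U c | (τ f).faceExp ≠ 0}.Finite ↔
      {f : faces (flipSolid U c b) | (glueLabelling b τ s f).faceExp ≠ 0}.Finite := by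
    let ι : fixedFaces U c → faces (flipSolid U c b) :=
      fun f => ⟨f.1, h.fixedFaces_subset b f.2⟩
    have hι : Function.Injective ι := fun f f' hff => Subtype.ext (congrArg (·.1) hff)
    have hιτ : ∀ f, glueLabelling b τ s (ι f) = τ f := fun f =>
      glueLabelling_fixed b τ s (f := ι f) f.2
    constructor
    · intro hf
      refine ((hf.image ι).union
        (Set.toFinite (Set.range fun k => ⟨_, h.cubeFace_mem b k⟩))).subset ?_
      intro f hf'
      rcases (h.mem_faces b f.1).1 f.2 with hX | hX
      · refine .inl ⟨⟨f.1, hX⟩, ?_, rfl⟩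
        rwa [Set.mem_ofPred_eq, ← hιτ]
      · exact .inr ⟨f.1.2, Subtype.ext hX.symm⟩
    · intro hf
      refine Set.Finite.of_finite_image (f := ι) (hf.subset ?_) hι.injOn
      rintro _ ⟨f, hf', rfl⟩
      rwa [Set.mem_ofPred_eq, hιτ]
  rw [← h1, ← h2, ← h3]
  exact ⟨fun ⟨a, b, c⟩ => ⟨c, a, b⟩, fun ⟨a, b, c⟩ => ⟨b, c, a⟩⟩

/-- The invariance of the partition function under cube flips. -/
theorem wellDefined_and_tautPartition (h : IsFlip U c) {g : Point → ℝ}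
    (hg : ∀ x ∈ vertices U, 0 < g x) (hrec : RecurrenceAt g c)
    (hW : WellDefined (insert c U)) :
    WellDefined U ∧ tautPartition U g = tautPartition (insert c U) g := by
  classical
  -- These finitely many fixed parts index both partition functions: a taut configuration below has
  -- the same fixed part as some taut configuration above.
  have hT : {τ : fixedFaces U c → LocalConfig | ∃ s, IsTaut (glueLabelling true τ s)}.Finite := by
    refine (hW.1.image fun (σ : FaceLabelling (flipSolid U c true)) (f : fixedFaces U c) =>
      σ ⟨f.1, h.fixedFaces_subset true f.2⟩).subset ?_
    rintro τ ⟨s, hs⟩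
    refine ⟨_, hs, ?_⟩
    ext f
    exact glueLabelling_fixed true τ s (f := ⟨f.1, h.fixedFaces_subset true f.2⟩) f.2
  have hff : ∀ {τ : fixedFaces U c → LocalConfig} {s}, IsTaut (glueLabelling true τ s) →
      FixedFinite τ (outerRel true τ s) := by
    intro τ s hs
    rw [h.fixedFinite_iff true τ ((h.isTaut_glueLabelling_iff true τ s).1 hs).1]
    exact hW.2 _ hs
  have hff' : ∀ {τ : fixedFaces U c → LocalConfig} {s}, IsTaut (glueLabelling false τ s) →
      FixedFinite τ (outerRel false τ s) := by
    intro τ s hs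
    obtain ⟨s', -, hb, hs'⟩ := h.exists_isTaut_insert hg hrec hs
    rw [outerRel_eq hb]
    exact hff hs'
  have hTF : ∀ τ s, IsTaut (glueLabelling false τ s) → τ ∈ hT.toFinset := by
    intro τ s hs
    obtain ⟨s', -, -, hs'⟩ := h.exists_isTaut_insert hg hrec hs
    exact hT.mem_toFinset.2 ⟨s', hs'⟩
  have hTT : ∀ τ s, IsTaut (glueLabelling true τ s) → τ ∈ hT.toFinset :=
    fun τ s hs => hT.mem_toFinset.2 ⟨s, hs⟩
  refine ⟨⟨?_, ?_⟩, ?_⟩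
  · refine (Set.Finite.image2 (fun τ s => (glueLabelling false τ s : FaceLabelling U)) hT
      (Set.toFinite (Set.univ : Set Triple))).subset ?_
    intro σ hσ
    have e1 := h.glueLabelling_eq false σ
    have hσ' : IsTaut (U := flipSolid U c false) σ := hσ
    rw [← e1] at hσ'
    obtain ⟨s', -, -, hs'⟩ := h.exists_isTaut_insert hg hrec hσ'
    exact ⟨_, ⟨s', hs'⟩, _, trivial, e1⟩
  · intro σ hσ
    have e1 := h.glueLabelling_eq false σ
    have hσ' : IsTaut (U := flipSolid U c false) σ := hσ
    rw [← e1] at hσ'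
    have := (h.fixedFinite_iff false _ ((h.isTaut_glueLabelling_iff false _ _).1 hσ').1).1
      (hff' hσ')
    rw [e1] at this
    exact this
  · have hg2 : ∀ b, ∀ x ∈ vertices (flipSolid U c b), 0 < g x := by
      rintro (_ | _)
      exacts [hg, h.pos_insert hg hrec]
    have hpole : ∀ b, 0 < g (pole b c) := fun b =>
      hg2 b _ ((h.mem_vertices b _).2 (.inr rfl))
    -- The factor of the weight that depends only on the fixed part and the boundary data; its
    -- denominator contains both poles and is therefore the same on both sides.
    let F : Bool → (fixedFaces U c → LocalConfig) → Triple → ℝ := fun b τ s =>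
      if IsTaut (glueLabelling b τ s) then
        2 ^ (finiteClasses (outerRel b τ s) (fixedEdges U c)).ncard * fixedWeight g τ /
          (g (pole b c) ^ 2 * g (pole (!b) c) ^ 2) else 0
    have key : ∀ b τ s, LocalValid b s →
        (IsTaut (glueLabelling b τ s) → FixedFinite τ (outerRel b τ s)) →
        (if IsTaut (glueLabelling b τ s) then tautWeight g (glueLabelling b τ s) else 0) =
          F b τ s * (tripleMonomial b s).eval (cubeValue g c) := by
      intro b τ s hs hfin
      by_cases hτ : IsTaut (glueLabelling b τ s)
      · have hf := hfin hτ
        have p1 := (hpole b).ne'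
        have p2 := (hpole (!b)).ne'
        simp only [F, if_pos hτ]
        rw [h.tautWeight_glueLabelling b (hg2 b) τ hs hf.vert hf.face hf.loop,
          cubeValue_eval g c b s hpole fun k v => (h.pos_corner b (hg2 b) k v).le]
        field_simp
      · simp only [F, if_neg hτ, zero_mul]
    change tautPartition (flipSolid U c false) g = tautPartition (flipSolid U c true) g
    rw [h.tautPartition_eq_sum false g hT.toFinset hTF, h.tautPartition_eq_sum true g hT.toFinset hTT]
    refine Finset.sum_congr rfl fun τ _ => ?_
    rw [Finset.sum_congr rfl fun s hs => key false τ s (Finset.mem_filter.1 hs).2 hff',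
      Finset.sum_congr rfl fun s hs => key true τ s (Finset.mem_filter.1 hs).2 hff]
    refine sum_triples (h.cubeRelations hg hrec) fun s s' hs hs' hss => ?_
    simp only [F, h.isTaut_glueLabelling_congr τ hs hs' hss, outerRel_eq hss, Bool.not_false,
      Bool.not_true, mul_comm (g (pole false c) ^ 2)]

end IsFlip
end KashaevLoops

namespace KashaevLoops

/-! ### The surface of the negative corner -/

theorem isMonotone_negativeCorner : IsMonotone negativeCorner := fun _ hc _ hd i =>
  (add_le_add_left (hd i) 1).trans (hc i)

theorem forall_fin_three (k : Fin 3) (p : Fin 3 → Prop) :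
    (∀ i, p i) ↔ p k ∧ p (k + 1) ∧ p (k + 2) := by
  have h : ∀ k i : Fin 3, i = k ∨ i = k + 1 ∨ i = k + 2 := by decide
  constructor
  · exact fun hp => ⟨hp _, hp _, hp _⟩
  · rintro ⟨h1, h2, h3⟩ i
    rcases h k i with rfl | rfl | rfl <;> assumption

theorem ne_add_one (k : Fin 3) : k ≠ k + 1 := by revert k; decide

theorem ne_add_two (k : Fin 3) : k ≠ k + 2 := by revert k; decide

theorem add_one_ne_add_two (k : Fin 3) : k + 1 ≠ k + 2 := by revert k; decide

/-- The point of the `k`-th coordinate plane with given coordinates. -/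
def planePoint (k : Fin 3) (u v : ℤ) : Point :=
  fun i => if i = k then 0 else if i = k + 1 then u else v

theorem planePoint_self (k : Fin 3) (u v : ℤ) : planePoint k u v k = 0 := if_pos rfl

theorem planePoint_first (k : Fin 3) (u v : ℤ) : planePoint k u v (k + 1) = u := by
  rw [planePoint, if_neg (ne_add_one k).symm, if_pos rfl]

theorem planePoint_second (k : Fin 3) (u v : ℤ) : planePoint k u v (k + 2) = v := by
  rw [planePoint, if_neg (ne_add_two k).symm, if_neg (add_one_ne_add_two k).symm]

/-- A square of the `k`-th coordinate plane. -/
def planeFace (k : Fin 3) (u v : ℤ) : LatticeSquare := (planePoint k u v, k)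

theorem mem_faces_negativeCorner {f : LatticeSquare} : f ∈ faces negativeCorner ↔
    f.1 f.2 = 0 ∧ f.1 (f.2 + 1) ≤ -1 ∧ f.1 (f.2 + 2) ≤ -1 := by
  obtain ⟨x, k⟩ := f
  simp only [faces, negativeCorner, Set.mem_ofPred_eq]
  rw [forall_fin_three k, forall_fin_three k]
  simp only [Pi.sub_apply, e_apply, (ne_add_one k).symm, (ne_add_two k).symm, if_true, if_false]
  omega

theorem planeFace_mem {k : Fin 3} {u v : ℤ} :
    planeFace k u v ∈ faces negativeCorner ↔ u ≤ -1 ∧ v ≤ -1 := by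
  rw [mem_faces_negativeCorner]
  simp [planeFace, planePoint_self, planePoint_first, planePoint_second]

theorem eq_planeFace {f : LatticeSquare} (hf : f ∈ faces negativeCorner) :
    f = planeFace f.2 (f.1 (f.2 + 1)) (f.1 (f.2 + 2)) := by
  refine Prod.ext (funext ?_) rfl
  rw [forall_fin_three f.2]
  simp [planeFace, planePoint_self, planePoint_first, planePoint_second,
    (mem_faces_negativeCorner.1 hf).1]

theorem mem_vertices_negativeCorner {x : Point} (k : Fin 3) : x ∈ vertices negativeCorner ↔
    (x k ≤ 0 ∧ x (k + 1) ≤ 0 ∧ x (k + 2) ≤ 0) ∧ (x k = 0 ∨ x (k + 1) = 0 ∨ x (k + 2) = 0) := by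
  rw [isMonotone_negativeCorner.mem_vertices]
  simp only [negativeCorner, Set.mem_ofPred_eq]
  rw [forall_fin_three k, forall_fin_three k]
  simp only [Pi.sub_apply, Pi.one_apply]
  omega

/-- Twice the midpoint of an edge. -/
def mid (a : LatticeEdge) (i : Fin 3) : ℤ := 2 * a.1 i + e a.2 i

theorem mid_injective : Function.Injective mid := by
  rintro ⟨x, i⟩ ⟨y, j⟩ h
  have h1 : ∀ k, 2 * x k + e i k = 2 * y k + e j k := fun k => congrFun h k
  simp only [e_apply] at h1
  obtain rfl : i = j := by
    by_contra hij
    have := h1 i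
    rw [if_pos rfl, if_neg hij] at this
    omega
  refine Prod.ext (funext fun k => ?_) rfl
  have := h1 k
  simp only
  omega

/-- The edge of the `k`-th coordinate plane with given doubled midpoint, for `p + q` odd. -/
def planeEdge (k : Fin 3) (p q : ℤ) : LatticeEdge :=
  if p % 2 = 1 then (planePoint k ((p - 1) / 2) (q / 2), k + 1)
  else (planePoint k (p / 2) ((q - 1) / 2), k + 2)

theorem mid_planeEdge {k : Fin 3} {p q : ℤ} (h : (p + q) % 2 = 1) :
    mid (planeEdge k p q) k = 0 ∧ mid (planeEdge k p q) (k + 1) = p ∧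
      mid (planeEdge k p q) (k + 2) = q := by
  unfold planeEdge
  split_ifs with hp
  · simp only [mid, planePoint_self, planePoint_first, planePoint_second, e_apply, ne_add_one,
      (add_one_ne_add_two k).symm, if_true, if_false]
    omega
  · simp only [mid, planePoint_self, planePoint_first, planePoint_second, e_apply, ne_add_two,
      add_one_ne_add_two k, if_true, if_false]
    omega

theorem eq_planeEdge {a : LatticeEdge} {k : Fin 3} {p q : ℤ} (h : (p + q) % 2 = 1)
    (h0 : mid a k = 0) (h1 : mid a (k + 1) = p) (h2 : mid a (k + 2) = q) :
    a = planeEdge k p q := by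
  obtain ⟨g0, g1, g2⟩ := mid_planeEdge (k := k) h
  refine mid_injective (funext ?_)
  rw [forall_fin_three k]
  exact ⟨by rw [h0, g0], by rw [h1, g1], by rw [h2, g2]⟩

/-- An edge on a coordinate axis lies in two coordinate planes and has coordinates in each of them.
-/
theorem planeEdge_rotate {k : Fin 3} {p : ℤ} (h : p % 2 = 1) :
    planeEdge k 0 p = planeEdge (k + 1) p 0 := by
  obtain ⟨g0, g1, g2⟩ := mid_planeEdge (k := k) (p := 0) (q := p) (by omega)
  refine eq_planeEdge (by omega) g1 ?_ ?_
  · rwa [add_one_add_one]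
  · rwa [add_one_add_two]

theorem side_planeFace (k : Fin 3) (u v : ℤ) :
    side (planeFace k u v) .lowFirst = planeEdge k (2 * u + 1) (2 * v) ∧
    side (planeFace k u v) .lowSecond = planeEdge k (2 * u) (2 * v + 1) ∧
    side (planeFace k u v) .firstHigh = planeEdge k (2 * u + 2) (2 * v + 1) ∧
    side (planeFace k u v) .secondHigh = planeEdge k (2 * u + 1) (2 * v + 2) := by
  have n1 := ne_add_one k
  have n2 := ne_add_two k
  have n3 := add_one_ne_add_two k
  refine ⟨?_, ?_, ?_, ?_⟩ <;> refine eq_planeEdge (by omega) ?_ ?_ ?_ <;>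
    simp [mid, side, planeFace, planePoint_self, planePoint_first, planePoint_second, e_apply,
      n1, n2, n3, n3.symm, mul_add]

theorem mem_edges_negativeCorner {a : LatticeEdge} : a ∈ edges negativeCorner ↔
    ∃ k p q, p ≤ 0 ∧ q ≤ 0 ∧ (p + q) % 2 = 1 ∧ a = planeEdge k p q := by
  rw [isMonotone_negativeCorner.mem_edges]
  obtain ⟨x, i⟩ := a
  have n1 := ne_add_one i
  have n2 := ne_add_two i
  have n3 := add_one_ne_add_two i
  simp only [negativeCorner, Set.mem_ofPred_eq]
  rw [forall_fin_three i, forall_fin_three i]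
  simp only [Pi.sub_apply, Pi.add_apply, Pi.one_apply, e_apply, if_true, n1.symm, n2.symm, if_false]
  constructor
  · intro h
    have h1 : x (i + 1) = 0 ∨ x (i + 2) = 0 := by omega
    rcases h1 with h1 | h1
    · refine ⟨i + 1, 2 * x (i + 2), 2 * x i + 1, by omega, by omega, by omega, ?_⟩
      refine eq_planeEdge (by omega) ?_ ?_ ?_ <;>
        simp [mid, add_one_add_one, add_one_add_two, e_apply, n1.symm, n2.symm, h1]
    · refine ⟨i + 2, 2 * x i + 1, 2 * x (i + 1), by omega, by omega, by omega, ?_⟩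
      refine eq_planeEdge (by omega) ?_ ?_ ?_ <;>
        simp [mid, add_two_add_one, add_two_add_two, e_apply, n1.symm, n2.symm, h1]
  · rintro ⟨k, p, q, hp, hq, hpq, ha⟩
    obtain ⟨g0, g1, g2⟩ := mid_planeEdge (k := k) hpq
    rw [← ha] at g0 g1 g2
    have hk : ∀ k i : Fin 3, i = k ∨ i = k + 1 ∨ i = k + 2 := by decide
    rcases hk k i with rfl | rfl | rfl <;>
      simp only [mid, add_one_add_one, add_one_add_two, add_two_add_one, add_two_add_two, e_apply,
        n1.symm, n2.symm, if_true, if_false] at * <;> omega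

end KashaevLoops

namespace KashaevLoops

/-! ### The initial configuration -/

/-- The coordinates of an edge are unique except on the axes. In this form the ambiguity can be
resolved by `omega`. -/
theorem planeEdge_eq_cases {k k' : Fin 3} {p q p' q' : ℤ} (h : (p + q) % 2 = 1)
    (h' : (p' + q') % 2 = 1) (heq : planeEdge k p q = planeEdge k' p' q') :
    (k' = k ∧ p' = p ∧ q' = q) ∨ (k' = k + 1 ∧ p = 0 ∧ q' = 0 ∧ p' = q) ∨
      (k' = k + 2 ∧ q = 0 ∧ p' = 0 ∧ q' = p) := by
  obtain ⟨g0, g1, g2⟩ := mid_planeEdge (k := k) h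
  obtain ⟨g0', g1', g2'⟩ := mid_planeEdge (k := k') h'
  rw [← heq] at g0' g1' g2'
  have hk : ∀ k i : Fin 3, i = k ∨ i = k + 1 ∨ i = k + 2 := by decide
  rcases hk k k' with rfl | rfl | rfl
  · exact .inl ⟨rfl, by omega, by omega⟩
  · rw [add_one_add_one] at g1'
    rw [add_one_add_two] at g2'
    exact .inr (.inl ⟨rfl, by omega, by omega, by omega⟩)
  · rw [add_two_add_one] at g1'
    rw [add_two_add_two] at g2'
    exact .inr (.inr ⟨rfl, by omega, by omega, by omega⟩)

theorem exists_side_planeFace (k : Fin 3) (u v : ℤ) (s : Side) :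
    ∃ p q : ℤ, (2 * u ≤ p ∧ p ≤ 2 * u + 2) ∧ (2 * v ≤ q ∧ q ≤ 2 * v + 2) ∧
      (p + q = 2 * u + 2 * v + 1 ∨ p + q = 2 * u + 2 * v + 3) ∧
      side (planeFace k u v) s = planeEdge k p q := by
  obtain ⟨h1, h2, h3, h4⟩ := side_planeFace k u v
  cases s
  · exact ⟨_, _, by omega, by omega, by omega, h1⟩
  · exact ⟨_, _, by omega, by omega, by omega, h2⟩
  · exact ⟨_, _, by omega, by omega, by omega, h3⟩
  · exact ⟨_, _, by omega, by omega, by omega, h4⟩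

/-- The arc that turns around an intermediate corner and goes up from a given edge. -/
theorem exists_turnMiddle_arc (k : Fin 3) {p q : ℤ} (h : (p + q) % 2 = 1) (c d : Colour) :
    ∃ s, side (planeFace k (p / 2) (q / 2)) s = planeEdge k p q ∧
      side (planeFace k (p / 2) (q / 2)) ((LocalConfig.turnMiddle c d).partner s) =
        planeEdge k (p + 1) (q + 1) := by
  obtain ⟨h1, h2, h3, h4⟩ := side_planeFace k (p / 2) (q / 2)
  by_cases hp : p % 2 = 1
  · refine ⟨.lowFirst, ?_, ?_⟩
    · rw [h1]; congr 1 <;> omega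
    · simp only [LocalConfig.partner]
      rw [h3]; congr 1 <;> omega
  · refine ⟨.lowSecond, ?_, ?_⟩
    · rw [h2]; congr 1 <;> omega
    · simp only [LocalConfig.partner]
      rw [h4]; congr 1 <;> omega

/-- Every arc that turns around an intermediate corner goes up or down by one diagonal step. -/
theorem turnMiddle_arc_cases (k : Fin 3) (u v : ℤ) (c d : Colour) (s : Side) :
    ∃ p q : ℤ, (p + q) % 2 = 1 ∧ p / 2 = u ∧ q / 2 = v ∧
      ((side (planeFace k u v) s = planeEdge k p q ∧
        side (planeFace k u v) ((LocalConfig.turnMiddle c d).partner s) =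
          planeEdge k (p + 1) (q + 1)) ∨
      (side (planeFace k u v) s = planeEdge k (p + 1) (q + 1) ∧
        side (planeFace k u v) ((LocalConfig.turnMiddle c d).partner s) = planeEdge k p q)) := by
  obtain ⟨h1, h2, h3, h4⟩ := side_planeFace k u v
  have h3' : side (planeFace k u v) .firstHigh = planeEdge k (2 * u + 1 + 1) (2 * v + 1) := by
    rw [h3]; congr 1; omega
  have h4' : side (planeFace k u v) .secondHigh = planeEdge k (2 * u + 1) (2 * v + 1 + 1) := by
    rw [h4]; congr 1; omega
  cases s
  · exact ⟨2 * u + 1, 2 * v, by omega, by omega, by omega, .inl ⟨h1, h3'⟩⟩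
  · exact ⟨2 * u, 2 * v + 1, by omega, by omega, by omega, .inl ⟨h2, h4'⟩⟩
  · exact ⟨2 * u + 1, 2 * v, by omega, by omega, by omega, .inr ⟨h3', h1⟩⟩
  · exact ⟨2 * u, 2 * v + 1, by omega, by omega, by omega, .inr ⟨h4', h2⟩⟩

theorem linkRel_initialConfig (k : Fin 3) {p q : ℤ} (h : (p + q) % 2 = 1) (hp : p ≤ -1)
    (hq : q ≤ -1) : linkRel initialConfig (planeEdge k p q) (planeEdge k (p + 1) (q + 1)) := by
  obtain ⟨s, h1, h2⟩ := exists_turnMiddle_arc k h .blue .blue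
  exact ⟨⟨_, planeFace_mem.2 ⟨by omega, by omega⟩⟩, s, h1.symm, h2.symm⟩

theorem eqvGen_initialConfig (k : Fin 3) {p q : ℤ} (h : (p + q) % 2 = 1) (n : ℕ) (hp : p + n ≤ 0)
    (hq : q + n ≤ 0) :
    Relation.EqvGen (linkRel initialConfig) (planeEdge k p q) (planeEdge k (p + n) (q + n)) := by
  induction n with
  | zero => simpa using Relation.EqvGen.refl _
  | succ n ih =>
    push_cast at hp hq ⊢
    refine (ih (by omega) (by omega)).trans _ _ _ (.rel _ _ ?_)
    rw [← add_assoc, ← add_assoc]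
    exact linkRel_initialConfig k (by omega) (by omega) (by omega)

/-- Every edge lies on a diagonal that descends to infinity, so no curve is finite. -/
theorem loops_initialConfig : loops initialConfig = ∅ := by
  rw [← Set.encard_eq_zero, encard_loops isMonotone_negativeCorner, Set.encard_eq_zero,
    Set.eq_empty_iff_forall_notMem]
  rintro C ⟨a, ha, rfl, hfin⟩
  obtain ⟨k, p, q, hp, hq, hpq, rfl⟩ := mem_edges_negativeCorner.1 ha
  refine Set.infinite_of_injective_forall_mem (f := fun n : ℕ => planeEdge k (p - n) (q - n)) ?_ ?_
    hfin
  · intro m n hmn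
    have := planeEdge_eq_cases (by omega) (by omega) hmn
    omega
  · intro n
    have := eqvGen_initialConfig k (p := p - n) (q := q - n) (by omega) n (by omega) (by omega)
    simp only [sub_add_cancel] at this
    exact this.symm

theorem isTaut_initialConfig : IsTaut initialConfig := by
  refine ⟨?_, 0, le_rfl, fun _ _ => Iff.rfl, fun _ _ _ _ => rfl, fun _ _ _ _ _ _ h => h⟩
  have h : ∀ s, (LocalConfig.turnMiddle .blue .blue).colour s = .blue := by
    rintro (_ | _ | _ | _) <;> rfl
  intro f f' s t _
  simp only [initialConfig, h]

open Classical in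
-- Only lowest and highest corners contribute, each with doubled exponent `2`. A point off the axes
-- is lowest in one face and highest in another; a point on one axis is highest in one face of each
-- of two planes; the origin is highest in one face of each of the three planes. The totals are `4 -
-- 4`, `4 - 4` and `6 - 4`.
theorem vertexExp_initialConfig {x : Point} (hx : x ∈ vertices negativeCorner) :
    vertexExp initialConfig x = if x = 0 then 2 else 0 := by
  have h0 : x = 0 ↔ x 0 = 0 ∧ x 1 = 0 ∧ x 2 = 0 := by
    constructor
    · rintro rfl
      simp
    · rintro ⟨h0, h1, h2⟩
      funext i
      fin_cases i <;> assumption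
  have hsum : ∀ F : Corner → ℤ, ∑ v, F v = F .low + F .first + F .second + F .high := by
    intro F
    have h : (Finset.univ : Finset Corner) = {.low, .first, .second, .high} := rfl
    rw [h]
    simp [add_assoc]
  have hx' := (mem_vertices_negativeCorner 0).1 hx
  have hexp : ∀ y v, (if h : y ∈ faces negativeCorner then
      (((initialConfig ⟨y, h⟩).cornerExp v : ℕ) : ℤ) else 0) =
      if y.1 y.2 = 0 ∧ y.1 (y.2 + 1) ≤ -1 ∧ y.1 (y.2 + 2) ≤ -1 then
        ((LocalConfig.turnMiddle .blue .blue).cornerExp v : ℤ) else 0 := fun y v => by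
    by_cases h : y ∈ faces negativeCorner
    · rw [dif_pos h, if_pos (mem_faces_negativeCorner.1 h)]; rfl
    · rw [dif_neg h, if_neg (mt mem_faces_negativeCorner.2 h)]
  rw [vertexExp]
  simp only [hexp]
  simp only [LocalConfig.cornerExp, Fin.sum_univ_three, hsum, h0,
    Corner.offset, Pi.sub_apply, Pi.add_apply, Pi.zero_apply,
    e_apply, Fin.isValue, Fin.reduceAdd, Fin.reduceEq, if_true, if_false, ite_self,
    Nat.cast_ofNat, Nat.cast_zero] at hx' ⊢
  split_ifs <;> omega

theorem zero_mem_vertices_negativeCorner : (0 : Point) ∈ vertices negativeCorner :=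
  (mem_vertices_negativeCorner 0).2 (by simp)

theorem tautWeight_initialConfig {g : Point → ℝ} (hg : 0 < g 0) :
    tautWeight g initialConfig = g 0 := by
  have h1 : ∏ᶠ x : vertices negativeCorner, √(g x) ^ vertexExp initialConfig x = g 0 := by
    rw [finprod_eq_single _ ⟨0, zero_mem_vertices_negativeCorner⟩]
    · rw [vertexExp_initialConfig zero_mem_vertices_negativeCorner, if_pos rfl]
      exact_mod_cast Real.sq_sqrt hg.le
    · rintro ⟨x, hx⟩ hne
      rw [vertexExp_initialConfig hx, if_neg fun h => hne (Subtype.ext h), zpow_zero]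
  rw [tautWeight, h1, loops_initialConfig, finprod_eq_one_of_forall_eq_one fun f => ?_]
  · simp
  · simp [initialConfig, LocalConfig.faceExp]

theorem wellDefined_negativeCorner (h : tautConfigs negativeCorner = {initialConfig}) :
    WellDefined negativeCorner := by
  refine ⟨h ▸ Set.finite_singleton _, ?_⟩
  rw [h]
  rintro σ rfl
  refine ⟨by rw [loops_initialConfig]; exact Set.finite_empty, ?_, ?_⟩
  · refine (Set.finite_singleton (0 : Point)).subset ?_
    rintro x ⟨hx, hne⟩
    rw [vertexExp_initialConfig hx] at hne
    by_contra h0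
    exact hne (if_neg h0)
  · simp [initialConfig, LocalConfig.faceExp]

end KashaevLoops

namespace KashaevLoops

open Relation (EqvGen)

/-! ### Curves have at most two ends -/

theorem reachable_fromRel {α : Type*} {r : α → α → Prop} {a b : α} (h : EqvGen r a b) :
    (SimpleGraph.fromRel r).Reachable a b := by
  induction h with
  | rel a b h =>
    by_cases hab : a = b
    · subst hab
      exact .refl _
    · exact SimpleGraph.Adj.reachable ((SimpleGraph.fromRel_adj _ _ _).2 ⟨hab, .inl h⟩)
  | refl => exact .refl _
  | symm _ _ _ ih => exact ih.symm
  | trans _ _ _ _ _ ih1 ih2 => exact ih1.trans ih2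

/-- A connected curve, in which every point has at most two neighbours, has at most two ends. -/
theorem not_three_ends {α : Type*} {r : α → α → Prop} (hsymm : ∀ a b, r a b → r b a)
    (hdeg : ∀ a b₁ b₂ b₃, r a b₁ → r a b₂ → r a b₃ → b₁ = b₂ ∨ b₁ = b₃ ∨ b₂ = b₃) {x y z : α}
    (hx : ∀ b₁ b₂, r x b₁ → r x b₂ → b₁ = b₂) (hy : ∀ b₁ b₂, r y b₁ → r y b₂ → b₁ = b₂)
    (hz : ∀ b₁ b₂, r z b₁ → r z b₂ → b₁ = b₂) (hxy : x ≠ y) (hxz : x ≠ z) (hyz : y ≠ z)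
    (h1 : EqvGen r x y) (h2 : EqvGen r x z) : False := by
  have hadj : ∀ {a b}, (SimpleGraph.fromRel r).Adj a b → r a b := fun h => by
    rw [SimpleGraph.fromRel_adj] at h
    exact h.2.elim id (hsymm _ _)
  obtain ⟨p, hp⟩ := (reachable_fromRel h1).exists_isPath
  have hlen : 0 < p.length := by
    by_contra h
    exact hxy (SimpleGraph.Walk.eq_of_length_eq_zero (p := p) (by omega))
  have hinj : ∀ i j, i ≤ p.length → j ≤ p.length → p.getVert i = p.getVert j → i = j :=
    fun i j hi hj h => hp.getVert_injOn hi hj h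
  have hmid : ∀ i, 0 < i → i < p.length →
      r (p.getVert i) (p.getVert (i - 1)) ∧ r (p.getVert i) (p.getVert (i + 1)) := by
    intro i h0 hi
    refine ⟨?_, hadj (p.adj_getVert_succ hi)⟩
    have := p.adj_getVert_succ (i := i - 1) (by omega)
    rw [Nat.sub_add_cancel h0] at this
    exact hadj this.symm
  -- The path is closed under `r`: its two ends have their only neighbour on it, and an interior
  -- point already has two distinct neighbours on it.
  have hclosed : ∀ a b, r a b → (∃ i ≤ p.length, p.getVert i = a) →
      ∃ i ≤ p.length, p.getVert i = b := by
    rintro a b hab ⟨i, hi, rfl⟩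
    by_cases h0 : i = 0
    · subst h0
      have := hadj (p.adj_getVert_succ (i := 0) hlen)
      rw [SimpleGraph.Walk.getVert_zero] at hab this
      exact ⟨0 + 1, by omega, hx _ _ this hab⟩
    by_cases h1 : i = p.length
    · subst h1
      have := p.adj_getVert_succ (i := p.length - 1) (by omega)
      rw [Nat.sub_add_cancel hlen] at this
      have := hadj this.symm
      rw [SimpleGraph.Walk.getVert_length] at hab this
      exact ⟨p.length - 1, by omega, hy _ _ this hab⟩
    · obtain ⟨h2, h3⟩ := hmid i (by omega) (by omega)
      rcases hdeg _ _ _ _ h2 h3 hab with h | h | h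
      · have := hinj _ _ (by omega) (by omega) h
        omega
      · exact ⟨_, by omega, h⟩
      · exact ⟨_, by omega, h⟩
  -- Hence `z` is an interior point of the path, with two different neighbours, although it is an
  -- end.
  obtain ⟨i, hi, rfl⟩ := (eqvGen_mem_iff (p := fun a => ∃ i ≤ p.length, p.getVert i = a)
    (fun a b hab => ⟨hclosed a b hab, hclosed b a (hsymm _ _ hab)⟩) h2).1 ⟨0, by omega, by simp⟩
  have h0 : 0 < i := by
    rcases Nat.eq_zero_or_pos i with rfl | h
    · exact absurd p.getVert_zero.symm hxz
    · exact h
  have h1 : i < p.length := by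
    rcases hi.eq_or_lt with rfl | h
    · exact absurd p.getVert_length.symm hyz
    · exact h
  obtain ⟨h2, h3⟩ := hmid i h0 h1
  have := hinj _ _ (by omega) (by omega) (hz _ _ h2 h3)
  omega

/-! ### Labellings of the surface of the negative corner that are initial outside a box -/

/-- The sides that end at the corner `first`. -/
def Side.isFirst : Side → Bool
  | .lowFirst => true
  | .lowSecond => false
  | .firstHigh => true
  | .secondHigh => false

theorem partner_partner (c : LocalConfig) (s : Side) : c.partner (c.partner s) = s := by
  cases c <;> cases s <;> rfl

theorem colour_partner (c : LocalConfig) (s : Side) : c.colour (c.partner s) = c.colour s := by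
  cases c <;> cases s <;> rfl

/-- An edge is a side of at most one face in each of the two classes distinguished by
`Side.isFirst`; this bounds the number of faces at an edge by two, also on the axes. -/
theorem eq_of_side_eq {f f' : LatticeSquare} (hf : f ∈ faces negativeCorner)
    (hf' : f' ∈ faces negativeCorner) {s s' : Side} (hs : s.isFirst = s'.isFirst)
    (h : side f s = side f' s') : f = f' ∧ s = s' := by
  obtain ⟨x, k⟩ := f
  obtain ⟨x', k'⟩ := f'
  rw [mem_faces_negativeCorner] at hf hf'
  have hk1 : ∀ k k' : Fin 3, k + 1 = k' + 2 → k = k' + 1 := by decide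
  have n1 := ne_add_one
  cases s <;> cases s' <;> simp only [Side.isFirst, reduceCtorEq] at hs <;>
    simp only [side, Prod.mk.injEq, add_left_inj, and_true, reduceCtorEq, and_false] at h ⊢
  · exact h
  · obtain ⟨rfl, hk⟩ := h
    obtain rfl := hk1 _ _ hk
    simp only [Pi.add_apply, e_apply, add_one_add_two, n1, if_false] at hf hf'
    omega
  · exact h
  · obtain ⟨rfl, hk⟩ := h
    obtain rfl := hk1 _ _ hk.symm
    simp only [Pi.add_apply, e_apply, add_one_add_one, add_one_add_two] at hf hf'
    omega
  · obtain ⟨rfl, hk⟩ := h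
    obtain rfl := hk1 _ _ hk.symm
    simp only [Pi.add_apply, e_apply, add_one_add_two, n1, if_false] at hf hf'
    omega
  · obtain ⟨h, rfl⟩ := h
    exact ⟨add_right_cancel h, rfl⟩
  · obtain ⟨rfl, hk⟩ := h
    obtain rfl := hk1 _ _ hk
    simp only [Pi.add_apply, e_apply, add_one_add_one, add_one_add_two] at hf hf'
    omega
  · obtain ⟨h, rfl⟩ := h
    exact ⟨add_right_cancel h, rfl⟩

variable {σ : FaceLabelling negativeCorner} {N : ℤ}

theorem linkRel_degree {a b₁ b₂ b₃ : LatticeEdge} (h₁ : linkRel σ a b₁) (h₂ : linkRel σ a b₂)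
    (h₃ : linkRel σ a b₃) : b₁ = b₂ ∨ b₁ = b₃ ∨ b₂ = b₃ := by
  obtain ⟨f₁, s₁, rfl, rfl⟩ := h₁
  obtain ⟨f₂, s₂, e₂, rfl⟩ := h₂
  obtain ⟨f₃, s₃, e₃, rfl⟩ := h₃
  have key : ∀ (f f' : faces negativeCorner) (s s' : Side), s.isFirst = s'.isFirst →
      side f.1 s = side f'.1 s' → side f.1 ((σ f).partner s) = side f'.1 ((σ f').partner s') := by
    rintro ⟨f, hf⟩ ⟨f', hf'⟩ s s' hs h
    obtain ⟨rfl, rfl⟩ := eq_of_side_eq hf hf' hs h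
    rfl
  -- Among three sides two lie in the same class, and then they are the same side of the same face.
  have hb : ∀ a b c : Bool, a = b ∨ a = c ∨ b = c := by decide
  rcases hb s₁.isFirst s₂.isFirst s₃.isFirst with h | h | h
  · exact .inl (key _ _ _ _ h e₂)
  · exact .inr (.inl (key _ _ _ _ h e₃))
  · exact .inr (.inr (key _ _ _ _ h (e₂.symm.trans e₃)))

/-- The labelling is that of the initial configuration outside a box. -/
def IsInitialOutside (σ : FaceLabelling negativeCorner) (N : ℤ) : Prop :=
  ∀ (k : Fin 3) (u v : ℤ) (h : planeFace k u v ∈ faces negativeCorner),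
    u ≤ -N - 1 ∨ v ≤ -N - 1 → σ ⟨_, h⟩ = .turnMiddle .blue .blue

/-- Two edges are the ends of an arc in a face of the box. -/
def boxRel (σ : FaceLabelling negativeCorner) (N : ℤ) (a b : LatticeEdge) : Prop :=
  ∃ (k : Fin 3) (u v : ℤ) (h : planeFace k u v ∈ faces negativeCorner) (s : Side),
    -N ≤ u ∧ -N ≤ v ∧ a = side (planeFace k u v) s ∧
      b = side (planeFace k u v) ((σ ⟨_, h⟩).partner s)

/-- The edge belongs to a face of the box. -/
def InBox (N : ℤ) (a : LatticeEdge) : Prop :=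
  ∃ (k : Fin 3) (p q : ℤ), (p + q) % 2 = 1 ∧ -2 * N ≤ p ∧ p ≤ 0 ∧ -2 * N ≤ q ∧ q ≤ 0 ∧
    a = planeEdge k p q

theorem boxRel.linkRel {a b : LatticeEdge} (h : boxRel σ N a b) : linkRel σ a b := by
  obtain ⟨k, u, v, h, s, -, -, rfl, rfl⟩ := h
  exact ⟨⟨_, h⟩, s, rfl, rfl⟩

theorem boxRel_symm {a b : LatticeEdge} (h : boxRel σ N a b) : boxRel σ N b a := by
  obtain ⟨k, u, v, h, s, hu, hv, rfl, rfl⟩ := h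
  exact ⟨k, u, v, h, _, hu, hv, rfl, by rw [partner_partner]⟩

theorem boxRel.inBox {a b : LatticeEdge} (h : boxRel σ N a b) : InBox N a := by
  obtain ⟨k, u, v, h, s, hu, hv, rfl, -⟩ := h
  obtain ⟨p, q, h1, h2, h3, h5⟩ := exists_side_planeFace k u v s
  rw [planeFace_mem] at h
  exact ⟨k, p, q, by omega, by omega, by omega, by omega, by omega, h5⟩

theorem IsInitialOutside.linkRel_cases (hσ : IsInitialOutside σ N) {a b : LatticeEdge}
    (h : linkRel σ a b) : boxRel σ N a b ∨ ∃ (k : Fin 3) (p q : ℤ), (p + q) % 2 = 1 ∧ p ≤ -1 ∧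
      q ≤ -1 ∧ (p ≤ -2 * N - 1 ∨ q ≤ -2 * N - 1) ∧
      ((a = planeEdge k p q ∧ b = planeEdge k (p + 1) (q + 1)) ∨
        (a = planeEdge k (p + 1) (q + 1) ∧ b = planeEdge k p q)) := by
  obtain ⟨⟨f, hf⟩, s, rfl, rfl⟩ := h
  obtain ⟨k, u, v, rfl⟩ : ∃ k u v, f = planeFace k u v := ⟨_, _, _, eq_planeFace hf⟩
  by_cases hb : -N ≤ u ∧ -N ≤ v
  · exact .inl ⟨k, u, v, hf, s, hb.1, hb.2, rfl, rfl⟩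
  · rw [hσ k u v hf (by omega)]
    rw [planeFace_mem] at hf
    obtain ⟨p, q, hpq, hp, hq, h⟩ := turnMiddle_arc_cases k u v .blue .blue s
    exact .inr ⟨k, p, q, hpq, by omega, by omega, by omega, h⟩

/-- The edge leads, along diagonals outside the box, to an edge of the box connected to `a`. -/
def LeadsTo (σ : FaceLabelling negativeCorner) (N : ℤ) (a b : LatticeEdge) : Prop :=
  ∃ (k : Fin 3) (p q t : ℤ), (p + q) % 2 = 1 ∧ -2 * N < p - q ∧ p - q < 2 * N ∧ 0 ≤ t ∧
    -2 * N ≤ p + t ∧ -2 * N ≤ q + t ∧ (t = 0 ∨ p + t = -2 * N ∨ q + t = -2 * N) ∧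
    b = planeEdge k p q ∧ EqvGen (boxRel σ N) a (planeEdge k (p + t) (q + t))

theorem InBox.leadsTo_iff {a b : LatticeEdge} (hb : InBox N b) :
    LeadsTo σ N a b ↔ EqvGen (boxRel σ N) a b := by
  obtain ⟨k, p, q, hpq, hp1, hp2, hq1, hq2, rfl⟩ := hb
  constructor
  · rintro ⟨k', p', q', t, h1, h2, h3, h4, h5, h6, h7, h8, h9⟩
    have := planeEdge_eq_cases hpq h1 h8
    obtain rfl : t = 0 := by omega
    rwa [add_zero, add_zero, ← h8] at h9
  · intro h
    refine ⟨k, p, q, 0, hpq, by omega, by omega, le_rfl, by omega, by omega, .inl rfl, rfl, ?_⟩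
    rwa [add_zero, add_zero]

/-- Moving one step along a diagonal outside the box changes the distance `t` to the box by one and
leaves the point of entry unchanged. -/
theorem leadsTo_diagonal {a : LatticeEdge} {k : Fin 3} {p q : ℤ} (h : (p + q) % 2 = 1)
    (hp : p ≤ -1) (hq : q ≤ -1) (hpq : p ≤ -2 * N - 1 ∨ q ≤ -2 * N - 1) :
    LeadsTo σ N a (planeEdge k p q) ↔ LeadsTo σ N a (planeEdge k (p + 1) (q + 1)) := by
  constructor
  · rintro ⟨k', p', q', t, h1, h2, h3, h4, h5, h6, h7, h8, h9⟩
    have h' := planeEdge_eq_cases h h1 h8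
    obtain ⟨rfl, rfl, rfl⟩ : k' = k ∧ p' = p ∧ q' = q := by omega
    refine ⟨k', p' + 1, q' + 1, t - 1, by omega, by omega, by omega, by omega, by omega, by omega,
      by omega, rfl, ?_⟩
    rwa [add_add_sub_cancel, add_add_sub_cancel]
  · rintro ⟨k', p', q', t, h1, h2, h3, h4, h5, h6, h7, h8, h9⟩
    have h' := planeEdge_eq_cases (by omega) h1 h8
    obtain ⟨rfl, rfl, rfl⟩ : k' = k ∧ p' = p + 1 ∧ q' = q + 1 := by omega
    refine ⟨k', p, q, t + 1, by omega, by omega, by omega, by omega, by omega, by omega, by omega,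
      rfl, ?_⟩
    rwa [add_comm t, ← add_assoc, ← add_assoc]

/-- Edges of the box that are connected are connected inside the box. -/
theorem IsInitialOutside.eqvGen_boxRel (hσ : IsInitialOutside σ N) {a b : LatticeEdge}
    (h : EqvGen (linkRel σ) a b) (ha : InBox N a) (hb : InBox N b) : EqvGen (boxRel σ N) a b := by
  rw [← hb.leadsTo_iff]
  -- A curve that leaves the box does so along a diagonal, which leads back only to the same edge of
  -- the box.
  refine (eqvGen_mem_iff (p := LeadsTo σ N a) (fun c d hcd => ?_) h).1
    (ha.leadsTo_iff.2 (.refl _))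
  rcases hσ.linkRel_cases hcd with hcd | ⟨k, p, q, h1, h2, h3, h4, ⟨rfl, rfl⟩ | ⟨rfl, rfl⟩⟩
  · rw [hcd.inBox.leadsTo_iff, (boxRel_symm hcd).inBox.leadsTo_iff]
    exact ⟨fun h => h.trans _ _ _ (.rel _ _ hcd), fun h => h.trans _ _ _ (.symm _ _ (.rel _ _ hcd))⟩
  · exact leadsTo_diagonal h1 h2 h3 h4
  · exact (leadsTo_diagonal h1 h2 h3 h4).symm

end KashaevLoops

namespace KashaevLoops

open Relation (EqvGen)

variable {σ : FaceLabelling negativeCorner} {N : ℤ}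

/-! ### Taut configurations on the surface of the negative corner -/

/-- The edge on the outer boundary of the box on the diagonal `p - q = d` of a plane. -/
def farEdge (N : ℤ) (k : Fin 3) (d : ℤ) : LatticeEdge :=
  planeEdge k (-2 * N + max d 0) (-2 * N + max (-d) 0)

theorem exists_farEdge_eq (k : Fin 3) {d : ℤ} (hd : d % 2 = 1) (h1 : -2 * N < d)
    (h2 : d < 2 * N) : ∃ p q : ℤ, (p + q) % 2 = 1 ∧ p - q = d ∧ p ≤ -1 ∧ q ≤ -1 ∧ -2 * N ≤ p ∧
      -2 * N ≤ q ∧ (p = -2 * N ∨ q = -2 * N) ∧ farEdge N k d = planeEdge k p q :=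
  ⟨_, _, by omega, by omega, by omega, by omega, by omega, by omega, by omega, rfl⟩

theorem farEdge_inBox (k : Fin 3) {d : ℤ} (hd : d % 2 = 1) (h1 : -2 * N < d) (h2 : d < 2 * N) :
    InBox N (farEdge N k d) := by
  obtain ⟨p, q, h3, h4, h5, h6, h7, h8, -, h9⟩ := exists_farEdge_eq k hd h1 h2
  exact ⟨k, p, q, h3, h7, by omega, h8, by omega, h9⟩

theorem farEdge_inj {k k' : Fin 3} {d d' : ℤ} (hd : d % 2 = 1) (h1 : -2 * N < d)
    (h2 : d < 2 * N) (hd' : d' % 2 = 1) (h1' : -2 * N < d') (h2' : d' < 2 * N)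
    (h : farEdge N k d = farEdge N k' d') : k = k' ∧ d = d' := by
  obtain ⟨p, q, h3, h4, h5, h6, -, -, -, h9⟩ := exists_farEdge_eq k hd h1 h2
  obtain ⟨p', q', h3', h4', h5', h6', -, -, -, h9'⟩ := exists_farEdge_eq k' hd' h1' h2'
  rw [h9, h9'] at h
  have := planeEdge_eq_cases h3 h3' h
  omega

/-- Only one face of the box has a far edge as a side, so a far edge is an end of its curve in the
box. -/
theorem farEdge_end (k : Fin 3) {d : ℤ} (hd : d % 2 = 1) (h1 : -2 * N < d) (h2 : d < 2 * N)
    {b₁ b₂ : LatticeEdge} (hb₁ : boxRel σ N (farEdge N k d) b₁)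
    (hb₂ : boxRel σ N (farEdge N k d) b₂) : b₁ = b₂ := by
  obtain ⟨p, q, h3, h4, h5, h6, h7, h8, h10, h9⟩ := exists_farEdge_eq k hd h1 h2
  rw [h9] at hb₁ hb₂
  have key : ∀ (k' : Fin 3) (u v : ℤ) (s : Side), u ≤ -1 ∧ v ≤ -1 → -N ≤ u → -N ≤ v →
      planeEdge k p q = side (planeFace k' u v) s →
      k' = k ∧ u = p / 2 ∧ v = q / 2 ∧ s = if p % 2 = 1 then .lowFirst else .lowSecond := by
    intro k' u v s huv hu hv h
    obtain ⟨e1, e2, e3, e4⟩ := side_planeFace k' u v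
    cases s
    · rw [e1] at h
      have := planeEdge_eq_cases h3 (by omega) h
      exact ⟨by omega, by omega, by omega, by rw [if_pos (by omega)]⟩
    · rw [e2] at h
      have := planeEdge_eq_cases h3 (by omega) h
      exact ⟨by omega, by omega, by omega, by rw [if_neg (by omega)]⟩
    · rw [e3] at h
      have := planeEdge_eq_cases h3 (by omega) h
      omega
    · rw [e4] at h
      have := planeEdge_eq_cases h3 (by omega) h
      omega
  obtain ⟨k₁, u₁, v₁, hf₁, s₁, hu₁, hv₁, h₁, rfl⟩ := hb₁
  obtain ⟨k₂, u₂, v₂, hf₂, s₂, hu₂, hv₂, h₂, rfl⟩ := hb₂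
  obtain ⟨rfl, rfl, rfl, rfl⟩ := key _ _ _ _ (planeFace_mem.1 hf₁) hu₁ hv₁ h₁
  obtain ⟨rfl, rfl, rfl, rfl⟩ := key _ _ _ _ (planeFace_mem.1 hf₂) hu₂ hv₂ h₂
  rfl

/-- In the initial configuration, the far edges are connected in pairs, across the axes. -/
theorem exists_farEdge_mate (k : Fin 3) {d : ℤ} (hd : d % 2 = 1) (h1 : -2 * N < d)
    (h2 : d < 2 * N) : ∃ k' d', k' ≠ k ∧ d' % 2 = 1 ∧ -2 * N < d' ∧ d' < 2 * N ∧
      EqvGen (linkRel initialConfig) (farEdge N k d) (farEdge N k' d') := by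
  have key : ∀ (k : Fin 3) (p q p' q' : ℤ), (p + q) % 2 = 1 → p ≤ p' → p' - p = q' - q → p' ≤ 0 →
      q' ≤ 0 → EqvGen (linkRel initialConfig) (planeEdge k p q) (planeEdge k p' q') := by
    intro k p q p' q' h h1 h2 h3 h4
    have := eqvGen_initialConfig k h (p' - p).toNat (by omega) (by omega)
    rwa [Int.toNat_of_nonneg (by omega), add_sub_cancel, h2, add_sub_cancel] at this
  -- For `d > 0` the diagonal climbs to `(0, -d)` on an axis. In the next plane this edge is `(-d,
  -- 0)`, from which the curve descends along the diagonal `-d`.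
  have hpos : ∀ (k : Fin 3) (d : ℤ), d % 2 = 1 → 0 < d → d < 2 * N →
      EqvGen (linkRel initialConfig) (farEdge N k d) (farEdge N (k + 1) (-d)) := by
    intro k d hd h0 h2
    refine (key k _ _ 0 (-d) (by omega) (by omega) (by omega) (by omega) (by omega)).trans _ _ _ ?_
    rw [planeEdge_rotate (by omega)]
    exact (key (k + 1) _ _ (-d) 0 (by omega) (by omega) (by omega) (by omega) (by omega)).symm
  rcases lt_trichotomy d 0 with h | h | h
  · refine ⟨k + 2, -d, (ne_add_two k).symm, by omega, by omega, by omega, .symm _ _ ?_⟩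
    have := hpos (k + 2) (-d) (by omega) (by omega) (by omega)
    rwa [add_two_add_one, neg_neg] at this
  · omega
  · exact ⟨k + 1, -d, (ne_add_one k).symm, by omega, by omega, by omega, hpos k d hd h h2⟩

/-- The far edges are connected as in the initial configuration. -/
def ConnectsFarEdges (σ : FaceLabelling negativeCorner) (N : ℤ) : Prop :=
  ∀ k d k' d', d % 2 = 1 → -2 * N < d → d < 2 * N → d' % 2 = 1 → -2 * N < d' → d' < 2 * N →
    EqvGen (linkRel initialConfig) (farEdge N k d) (farEdge N k' d') →
    EqvGen (linkRel σ) (farEdge N k d) (farEdge N k' d')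

theorem exists_boxRel_mate (hσ : IsInitialOutside σ N) (hc : ConnectsFarEdges σ N) (k : Fin 3)
    {d : ℤ} (hd : d % 2 = 1) (h1 : -2 * N < d) (h2 : d < 2 * N) :
    ∃ k' d', k' ≠ k ∧ d' % 2 = 1 ∧ -2 * N < d' ∧ d' < 2 * N ∧
      EqvGen (boxRel σ N) (farEdge N k d) (farEdge N k' d') := by
  obtain ⟨k', d', hk, hd', h1', h2', h⟩ := exists_farEdge_mate k hd h1 h2
  exact ⟨k', d', hk, hd', h1', h2', hσ.eqvGen_boxRel (hc _ _ _ _ hd h1 h2 hd' h1' h2' h)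
    (farEdge_inBox _ hd h1 h2) (farEdge_inBox _ hd' h1' h2')⟩

/-- Each far edge is already joined to one in another plane; a second one in its own plane would be
a third end of the same curve. -/
theorem eq_of_eqvGen_farEdge (hσ : IsInitialOutside σ N) (hc : ConnectsFarEdges σ N) {k : Fin 3}
    {d d' : ℤ} (hd : d % 2 = 1) (h1 : -2 * N < d) (h2 : d < 2 * N) (hd' : d' % 2 = 1)
    (h1' : -2 * N < d') (h2' : d' < 2 * N)
    (h : EqvGen (boxRel σ N) (farEdge N k d) (farEdge N k d')) : d = d' := by
  by_contra hne
  obtain ⟨k', d'', hk, hd'', h1'', h2'', h''⟩ := exists_boxRel_mate hσ hc k hd h1 h2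
  refine not_three_ends (r := boxRel σ N) (fun _ _ => boxRel_symm)
    (fun _ _ _ _ g₁ g₂ g₃ => linkRel_degree g₁.linkRel g₂.linkRel g₃.linkRel)
    (fun _ _ => farEdge_end k hd h1 h2) (fun _ _ => farEdge_end k hd' h1' h2')
    (fun _ _ => farEdge_end k' hd'' h1'' h2'') ?_ ?_ ?_ h h''
  · exact fun h => hne (farEdge_inj hd h1 h2 hd' h1' h2' h).2
  · exact fun h => hk (farEdge_inj hd h1 h2 hd'' h1'' h2'' h).1.symm
  · exact fun h => hk (farEdge_inj hd' h1' h2' hd'' h1'' h2'' h).1.symm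

/-- The curve of a far edge meets the cut of the box at level `l`. -/
theorem exists_cut (hσ : IsInitialOutside σ N) (hc : ConnectsFarEdges σ N) (k : Fin 3) {l d : ℤ}
    (hl : l % 2 = 1) (hd : d % 2 = 1) (h1 : -2 * N < d) (h2 : d < 2 * N) :
    ∃ p q : ℤ, (p + q) % 2 = 1 ∧ -2 * N ≤ p ∧ p ≤ 0 ∧ -2 * N ≤ q ∧ q ≤ 0 ∧
      (p + q = l ∨ (p = 0 ∨ q = 0) ∧ p + q < l ∨ (p = -2 * N ∨ q = -2 * N) ∧ l < p + q) ∧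
      EqvGen (boxRel σ N) (farEdge N k d) (planeEdge k p q) := by
  obtain ⟨p, q, h3, h4, h5, h6, h7, h8, h10, h9⟩ := exists_farEdge_eq k hd h1 h2
  by_cases hlpq : l ≤ p + q
  · exact ⟨p, q, h3, h7, by omega, h8, by omega, by omega, h9 ▸ .refl _⟩
  by_contra hcon
  -- `P` describes the part of the curve in plane `k` that is strictly below the cut and off the
  -- axes. A curve that avoids the cut would stay there.
  set P : LatticeEdge → Prop := fun a => EqvGen (boxRel σ N) (farEdge N k d) a ∧
    ∃ p q : ℤ, (p + q) % 2 = 1 ∧ p ≤ -1 ∧ q ≤ -1 ∧ p + q < l ∧ a = planeEdge k p q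
  have hstep : ∀ a b, boxRel σ N a b → P a → P b := by
    rintro a b hab ⟨ha, p, q, hpq, hp, hq, hlt, rfl⟩
    have hb : EqvGen (boxRel σ N) (farEdge N k d) b := ha.trans _ _ _ (.rel _ _ hab)
    refine ⟨hb, ?_⟩
    obtain ⟨k', u, v, hf, s, hu, hv, hs, hb'⟩ := hab
    have huv := planeFace_mem.1 hf
    obtain ⟨p₁, q₁, e₁, e₂, e₃, e₄⟩ := exists_side_planeFace k' u v s
    obtain ⟨p', q', f₁, f₂, f₃, f₄⟩ := exists_side_planeFace k' u v ((σ ⟨_, hf⟩).partner s)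
    rw [e₄] at hs
    rw [f₄] at hb'
    have hk := planeEdge_eq_cases hpq (by omega) hs
    obtain ⟨rfl, rfl, rfl⟩ : k' = k ∧ p₁ = p ∧ q₁ = q := by omega
    -- The sums `p + q` at the two ends of an arc are odd and differ by at most `2`, so the odd
    -- level `l` cannot be skipped. Reaching level `l`, or an axis below it, means meeting the cut.
    by_cases hgood : p' ≤ -1 ∧ q' ≤ -1 ∧ p' + q' < l
    · exact ⟨p', q', by omega, hgood.1, hgood.2.1, hgood.2.2, hb'⟩
    · exact absurd ⟨p', q', by omega, by omega, by omega, by omega, by omega, by omega, hb' ▸ hb⟩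
        hcon
  obtain ⟨k', d', hk, hd', h1', h2', h⟩ := exists_boxRel_mate hσ hc k hd h1 h2
  have hP : P (farEdge N k' d') := (eqvGen_mem_iff (p := P)
    (fun a b hab => ⟨hstep a b hab, hstep b a (boxRel_symm hab)⟩) h).1
    ⟨.refl _, p, q, h3, h5, h6, by omega, h9⟩
  obtain ⟨-, p', q', g1, g2, g3, -, g4⟩ := hP
  obtain ⟨p'', q'', f1, -, f2, f3, -, -, -, f4⟩ := exists_farEdge_eq k' hd' h1' h2'
  rw [f4] at g4
  have := planeEdge_eq_cases f1 g1 g4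
  omega

end KashaevLoops

/-! ### Rigidity of the taut configuration on the negative corner. -/

namespace KashaevLoops

open Relation (EqvGen)

variable {σ : FaceLabelling negativeCorner} {N : ℤ}

/-- Every edge of a plane of the box at level `l` belongs to the curve of a far edge of that plane,
and different edges at that level belong to the curves of different far edges. -/
theorem exists_level_curves (hσ : IsInitialOutside σ N) (hc : ConnectsFarEdges σ N) (k : Fin 3)
    {l : ℤ} (hl : l % 2 = 1) : ∃ f : ℤ → ℤ × ℤ,
      (∀ d, d % 2 = 1 → -2 * N < d → d < 2 * N →
        EqvGen (boxRel σ N) (farEdge N k d) (planeEdge k (f d).1 (f d).2)) ∧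
      ∀ p q, p + q = l → -2 * N ≤ p → p ≤ 0 → -2 * N ≤ q → q ≤ 0 →
        ∃ d, d % 2 = 1 ∧ -2 * N < d ∧ d < 2 * N ∧ f d = (p, q) := by
  have hcut := fun d (hd : d % 2 = 1 ∧ -2 * N < d ∧ d < 2 * N) =>
    exists_cut hσ hc k hl hd.1 hd.2.1 hd.2.2
  choose! fp fq h1 h2 h3 h4 h5 h6 h7 using hcut
  refine ⟨fun d => (fp d, fq d), fun d g1 g2 g3 => h7 d ⟨g1, g2, g3⟩, ?_⟩
  set S : Finset ℤ := (Finset.Ioo (-2 * N) (2 * N)).filter (· % 2 = 1)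
  have hS : ∀ d, d ∈ S ↔ d % 2 = 1 ∧ -2 * N < d ∧ d < 2 * N := by
    intro d
    simp only [S, Finset.mem_filter, Finset.mem_Ioo]
    tauto
  -- The cut meets each diagonal of the box in exactly one edge, so `p - q` identifies its edges
  -- with the odd numbers that also index the far edges.
  have hmaps : Set.MapsTo (fun d => fp d - fq d) S S := by
    intro d hd
    have hd' := (hS d).1 hd
    have e1 := h1 d hd'
    have e2 := h2 d hd'
    have e3 := h3 d hd'
    have e4 := h4 d hd'
    have e5 := h5 d hd'
    refine (hS _).2 ?_
    dsimp only
    omega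
  have hinj : Set.InjOn (fun d => fp d - fq d) S := by
    intro d hd d' hd' hdd
    have g := (hS d).1 hd
    have g' := (hS d').1 hd'
    have e1 := h1 d g
    have e2 := h2 d g
    have e3 := h3 d g
    have e4 := h4 d g
    have e5 := h5 d g
    have e6 := h6 d g
    have e1' := h1 d' g'
    have e2' := h2 d' g'
    have e3' := h3 d' g'
    have e4' := h4 d' g'
    have e5' := h5 d' g'
    have e6' := h6 d' g'
    dsimp only at hdd
    have e7 := h7 d g
    have e7' := h7 d' g'
    obtain ⟨hp, hq⟩ : fp d = fp d' ∧ fq d = fq d' := by omega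
    rw [← hp, ← hq] at e7'
    exact eq_of_eqvGen_farEdge hσ hc g.1 g.2.1 g.2.2 g'.1 g'.2.1 g'.2.2
      (e7.trans _ _ _ (e7'.symm _ _))
  -- An injection of a finite set into itself is surjective: every edge of the cut is on the curve
  -- of some far edge.
  have hsurj := Finset.surjOn_of_injOn_of_card_le _ hmaps hinj le_rfl
  intro p q hpq hp1 hp2 hq1 hq2
  obtain ⟨d, hd, hdd⟩ := hsurj (Finset.mem_coe.2 ((hS (p - q)).2 (by omega)))
  have g := (hS d).1 hd
  refine ⟨d, g.1, g.2.1, g.2.2, ?_⟩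
  have e1 := h1 d g
  have e2 := h2 d g
  have e3 := h3 d g
  have e4 := h4 d g
  have e5 := h5 d g
  have e6 := h6 d g
  dsimp only at hdd
  exact Prod.ext (by simp only; omega) (by simp only; omega)

theorem exists_eqvGen_farEdge (hσ : IsInitialOutside σ N) (hc : ConnectsFarEdges σ N) (k : Fin 3)
    {p q : ℤ} (h : (p + q) % 2 = 1) (hp1 : -2 * N ≤ p) (hp2 : p ≤ 0) (hq1 : -2 * N ≤ q)
    (hq2 : q ≤ 0) : ∃ d, d % 2 = 1 ∧ -2 * N < d ∧ d < 2 * N ∧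
      EqvGen (boxRel σ N) (farEdge N k d) (planeEdge k p q) := by
  obtain ⟨f, h1, h2⟩ := exists_level_curves hσ hc k h
  obtain ⟨d, hd, hd1, hd2, hf⟩ := h2 p q rfl hp1 hp2 hq1 hq2
  have := h1 d hd hd1 hd2
  rw [hf] at this
  exact ⟨d, hd, hd1, hd2, this⟩

/-- Two edges of one level lie on the curves of far edges of the same plane, and these far edges
coincide if the curves do. -/
theorem eq_of_eqvGen_level (hσ : IsInitialOutside σ N) (hc : ConnectsFarEdges σ N) (k : Fin 3)
    {p q p' q' : ℤ} (h : (p + q) % 2 = 1) (hp1 : -2 * N ≤ p) (hp2 : p ≤ 0) (hq1 : -2 * N ≤ q)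
    (hq2 : q ≤ 0) (h' : p' + q' = p + q) (hp1' : -2 * N ≤ p') (hp2' : p' ≤ 0) (hq1' : -2 * N ≤ q')
    (hq2' : q' ≤ 0) (hconn : EqvGen (boxRel σ N) (planeEdge k p q) (planeEdge k p' q')) :
    p = p' := by
  obtain ⟨f, h1, h2⟩ := exists_level_curves hσ hc k h
  obtain ⟨d, hd, hd1, hd2, hf⟩ := h2 p q rfl hp1 hp2 hq1 hq2
  obtain ⟨d', hd', hd1', hd2', hf'⟩ := h2 p' q' h' hp1' hp2' hq1' hq2'
  have e := h1 d hd hd1 hd2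
  have e' := h1 d' hd' hd1' hd2'
  rw [hf] at e
  rw [hf'] at e'
  obtain rfl := eq_of_eqvGen_farEdge hσ hc hd hd1 hd2 hd' hd1' hd2'
    ((e.trans _ _ _ hconn).trans _ _ _ (e'.symm _ _))
  exact (Prod.ext_iff.1 (hf.symm.trans hf')).1

/-- The edge is blue in all the faces that contain it. -/
def IsBlueEdge (σ : FaceLabelling negativeCorner) (a : LatticeEdge) : Prop :=
  ∀ (f : faces negativeCorner) (s : Side), a = side f.1 s → (σ f).colour s = .blue

theorem isBlueEdge_iff (hl : IsLoopConfig σ) {f : faces negativeCorner} {s : Side} :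
    IsBlueEdge σ (side f.1 s) ↔ (σ f).colour s = .blue :=
  ⟨fun h => h _ _ rfl, fun h _ _ hs => (hl _ _ _ _ hs) ▸ h⟩

theorem isBlueEdge_congr (hl : IsLoopConfig σ) {a b : LatticeEdge} (h : EqvGen (linkRel σ) a b) :
    IsBlueEdge σ a ↔ IsBlueEdge σ b := by
  refine eqvGen_mem_iff (p := IsBlueEdge σ) ?_ h
  rintro _ _ ⟨f, s, rfl, rfl⟩
  rw [isBlueEdge_iff hl, isBlueEdge_iff hl, colour_partner]

/-- A far edge is also a side of a face just outside the box, where the configuration is initial and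
therefore blue. -/
theorem isBlueEdge_farEdge (hl : IsLoopConfig σ) (hσ : IsInitialOutside σ N) (k : Fin 3) {d : ℤ}
    (hd : d % 2 = 1) (h1 : -2 * N < d) (h2 : d < 2 * N) : IsBlueEdge σ (farEdge N k d) := by
  obtain ⟨p, q, h3, h4, h5, h6, h7, h8, h10, h9⟩ := exists_farEdge_eq k hd h1 h2
  obtain ⟨s, -, hs⟩ := exists_turnMiddle_arc k (p := p - 1) (q := q - 1) (by omega) .blue .blue
  rw [sub_add_cancel, sub_add_cancel] at hs
  have hf : planeFace k ((p - 1) / 2) ((q - 1) / 2) ∈ faces negativeCorner :=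
    planeFace_mem.2 ⟨by omega, by omega⟩
  rw [h9, ← hs, isBlueEdge_iff hl (f := ⟨_, hf⟩), hσ k _ _ hf (by omega)]
  cases s <;> rfl

theorem isBlueEdge_planeEdge (hl : IsLoopConfig σ) (hσ : IsInitialOutside σ N)
    (hc : ConnectsFarEdges σ N) (k : Fin 3) {p q : ℤ} (h : (p + q) % 2 = 1) (hp1 : -2 * N ≤ p)
    (hp2 : p ≤ 0) (hq1 : -2 * N ≤ q) (hq2 : q ≤ 0) : IsBlueEdge σ (planeEdge k p q) := by
  obtain ⟨d, hd, hd1, hd2, hconn⟩ := exists_eqvGen_farEdge hσ hc k h hp1 hp2 hq1 hq2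
  refine (isBlueEdge_congr hl ?_).1 (isBlueEdge_farEdge hl hσ k hd hd1 hd2)
  exact EqvGen.map_le (f := id) (fun _ _ h => .rel _ _ (boxRel.linkRel h)) hconn

/-- In the box all edges are blue, which excludes crossings. An arc around a lowest corner is
excluded because it would join two different edges of the same level. -/
theorem eq_initialConfig (hl : IsLoopConfig σ) (hσ : IsInitialOutside σ N)
    (hc : ConnectsFarEdges σ N) : σ = initialConfig := by
  funext ⟨f, hf⟩
  obtain ⟨k, u, v, rfl⟩ : ∃ k u v, f = planeFace k u v := ⟨_, _, _, eq_planeFace hf⟩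
  by_cases hbox : u ≤ -N - 1 ∨ v ≤ -N - 1
  · exact hσ k u v hf hbox
  have huv := planeFace_mem.1 hf
  have hblue : ∀ s, (σ ⟨_, hf⟩).colour s = .blue := by
    intro s
    rw [← isBlueEdge_iff hl]
    obtain ⟨p, q, h1, h2, h3, h4⟩ := exists_side_planeFace k u v s
    rw [h4]
    exact isBlueEdge_planeEdge hl hσ hc k (by omega) (by omega) (by omega) (by omega) (by omega)
  change _ = LocalConfig.turnMiddle .blue .blue
  cases hloc : σ ⟨_, hf⟩ with
  | turnLowHigh c d =>
    obtain ⟨h1, h2, -, -⟩ := side_planeFace k u v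
    -- Both ends of this arc have level `2 * u + 2 * v + 1`.
    have hrel : boxRel σ N (planeEdge k (2 * u + 1) (2 * v)) (planeEdge k (2 * u) (2 * v + 1)) :=
      ⟨k, u, v, hf, .lowFirst, by omega, by omega, h1.symm, by rw [hloc, LocalConfig.partner, h2]⟩
    have := eq_of_eqvGen_level hσ hc k (by omega) (by omega) (by omega) (by omega) (by omega)
      (by omega) (by omega) (by omega) (by omega) (by omega) (.rel _ _ hrel)
    omega
  | turnMiddle c d =>
    have h1 := hblue .lowFirst
    have h2 := hblue .lowSecond
    rw [hloc] at h1 h2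
    simp only [LocalConfig.colour] at h1 h2
    rw [h1, h2]
  | cross c =>
    have h1 := hblue .lowFirst
    have h2 := hblue .lowSecond
    rw [hloc] at h1 h2
    simp only [LocalConfig.colour] at h1 h2
    rw [h1] at h2
    cases h2

theorem outsideBall_of_le {R : ℝ} (hR : 0 ≤ R) {N : ℕ} (hN : R < N) {x : Point} {j : Fin 3}
    (hx : x j ≤ -N) : OutsideBall R x := by
  have h1 : (x j : ℝ) ≤ -N := by exact_mod_cast hx
  have h2 : R ^ 2 < (x j : ℝ) ^ 2 := by nlinarith
  exact h2.trans_le (Finset.single_le_sum (f := fun i => (x i : ℝ) ^ 2)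
    (fun i _ => sq_nonneg _) (Finset.mem_univ j))

theorem outsideBall_planeEdge {R : ℝ} (hR : 0 ≤ R) {N : ℕ} (hN : R < N) {k : Fin 3} {p q : ℤ}
    (h : (p + q) % 2 = 1) (hpq : p = -2 * N ∨ q = -2 * N) :
    OutsideBall R (planeEdge k p q).1 ∧
      OutsideBall R ((planeEdge k p q).1 + e (planeEdge k p q).2) := by
  obtain ⟨-, h1, h2⟩ := mid_planeEdge (k := k) h
  have key : ∀ j, mid (planeEdge k p q) j = -2 * N → OutsideBall R (planeEdge k p q).1 ∧
      OutsideBall R ((planeEdge k p q).1 + e (planeEdge k p q).2) := by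
    intro j hj
    rw [mid, e_apply] at hj
    refine ⟨outsideBall_of_le hR hN (j := j) ?_, outsideBall_of_le hR hN (j := j) ?_⟩
    · split_ifs at hj <;> omega
    · rw [Pi.add_apply, e_apply]
      split_ifs at hj ⊢ <;> omega
  rcases hpq with hpq | hpq
  · exact key _ (h1.trans hpq)
  · exact key _ (h2.trans hpq)

/-- For an integer `N` larger than the radius, the faces outside the box and the far edges lie
outside the ball, where tautness prescribes the configuration and the connections. -/
theorem tautConfigs_negativeCorner : tautConfigs negativeCorner = {initialConfig} := by
  refine Set.eq_singleton_iff_unique_mem.2 ⟨isTaut_initialConfig, ?_⟩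
  rintro σ ⟨hl, R, hR, -, hout, hconn⟩
  obtain ⟨N, hN⟩ := exists_nat_gt R
  refine eq_initialConfig hl (N := N) ?_ ?_
  · intro k u v h huv
    refine hout _ h h fun w => ?_
    rcases huv with hu | hv
    · refine outsideBall_of_le hR hN (j := k + 1) ?_
      have h1 := planePoint_first k u v
      cases w <;> simp only [corner, planeFace, Corner.offset, Pi.add_apply, Pi.zero_apply, h1,
        e_apply, add_one_ne_add_two, if_true, if_false] <;> omega
    · refine outsideBall_of_le hR hN (j := k + 2) ?_
      have h1 := planePoint_second k u v
      cases w <;> simp only [corner, planeFace, Corner.offset, Pi.add_apply, Pi.zero_apply, h1,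
        e_apply, (add_one_ne_add_two k).symm, if_true, if_false] <;> omega
  · intro k d k' d' hd h1 h2 hd' h1' h2' h
    obtain ⟨p, q, h3, -, h5, h6, -, -, h7, h8⟩ := exists_farEdge_eq k hd h1 h2
    obtain ⟨p', q', h3', -, h5', h6', -, -, h7', h8'⟩ := exists_farEdge_eq k' hd' h1' h2'
    rw [h8, h8'] at h ⊢
    obtain ⟨o1, o2⟩ := outsideBall_planeEdge (k := k) hR hN h3 h7
    obtain ⟨o1', o2'⟩ := outsideBall_planeEdge (k := k') hR hN h3' h7'
    refine ((connectedIn_iff isMonotone_negativeCorner).1 (hconn _ _ o1 o2 o1' o2'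
      ((connectedIn_iff isMonotone_negativeCorner).2 ⟨?_, ?_, h⟩))).2.2
    · exact mem_edges_negativeCorner.2 ⟨k, p, q, by omega, by omega, h3, rfl⟩
    · exact mem_edges_negativeCorner.2 ⟨k', p', q', by omega, by omega, h3', rfl⟩

theorem tautPartition_negativeCorner {g : Point → ℝ} (hg : 0 < g 0) :
    tautPartition negativeCorner g = g 0 := by
  rw [tautPartition, tautConfigs_negativeCorner, finsum_mem_singleton,
    tautWeight_initialConfig hg]

end KashaevLoops

namespace KashaevLoops

variable {U : SteppedSolid}

/-! ### Induction on the number of missing cubes -/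

/-- All cubes strictly below a minimal missing cube are in the solid, so adding that cube keeps it
monotone. -/
theorem exists_isFlip (hU : IsMonotone U) (hreg : IsRegular U)
    (hne : (negativeCorner \ U).Nonempty) :
    ∃ c ∈ negativeCorner \ U, IsFlip U c ∧ IsRegular (insert c U) := by
  obtain ⟨c, hc⟩ := hreg.2.exists_minimal hne
  refine ⟨c, hc.prop, ⟨hU, ?_, hc.prop.2⟩, Set.insert_subset hc.prop.1 hreg.1,
    hreg.2.subset (Set.sdiff_subset_sdiff_right (Set.subset_insert c U))⟩
  rintro d (rfl | hd) x hx
  · by_cases hxU : x ∈ U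
    · exact .inr hxU
    · exact .inl (le_antisymm hx
        (hc.le_of_le ⟨isMonotone_negativeCorner _ hc.prop.1 x hx, hxU⟩ hx))
  · exact .inr (hU d hd x hx)

theorem tautPartition_congr (hU : IsMonotone U) {g g' : Point → ℝ}
    (h : ∀ x ∈ vertices U, g x = g' x) : tautPartition U g = tautPartition U g' := by
  refine finsum_mem_congr rfl fun σ _ => ?_
  have h1 : ∀ x : vertices U, √(g x) ^ vertexExp σ x = √(g' x) ^ vertexExp σ x := fun x => by
    rw [h x x.2]
  have h2 : ∀ f : faces U, faceVar g f ^ (σ f).faceExp = faceVar g' f ^ (σ f).faceExp := fun f => by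
    simp only [faceVar, h _ (corner_mem_vertices hU f.2 _)]
  rw [tautWeight, tautWeight, finprod_congr h1, finprod_congr h2]

/-- The value that the recurrence gives to the highest corner of a cube. -/
noncomputable def recurrenceValue (G : Point → ℝ) (c : Point) : ℝ :=
  (2 * G (c + e 0) * G (c + e 1) * G (c + e 2) + G c * (G (c + e 0) * G (c + e 1 + e 2) +
    G (c + e 1) * G (c + e 0 + e 2) + G (c + e 2) * G (c + e 0 + e 1)) +
    2 * √(G c * G (c + e 1 + e 2) + G (c + e 1) * G (c + e 2)) *
      √(G c * G (c + e 0 + e 2) + G (c + e 0) * G (c + e 2)) *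
      √(G c * G (c + e 0 + e 1) + G (c + e 0) * G (c + e 1))) / G c ^ 2

theorem recurrenceAt_iff {G : Point → ℝ} {c : Point} :
    RecurrenceAt G c ↔ G (c + 1) = recurrenceValue G c := by
  rw [← add_e_e_e]
  rfl

theorem recurrenceValue_congr {G G' : Point → ℝ} {c : Point}
    (h : ∀ x, c ≤ x → x < c + 1 → G x = G' x) : recurrenceValue G c = recurrenceValue G' c := by
  have h1 : ∀ i j, c + e i + e j < c + 1 → G (c + e i + e j) = G' (c + e i + e j) := fun i j hlt =>
    h _ ((le_add_of_nonneg_right (e_nonneg i)).trans (le_add_of_nonneg_right (e_nonneg j))) hlt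
  have h12 : c + e 0 + e 1 < c + 1 := by
    rw [← add_e_e_e]
    exact lt_add_of_pos_right _ (IsFlip.e_pos 2)
  have h13 : c + e 0 + e 2 < c + 1 := by
    rw [← add_e_e_e, add_right_comm (c + e 0)]
    exact lt_add_of_pos_right _ (IsFlip.e_pos 1)
  have h23 : c + e 1 + e 2 < c + 1 := by
    rw [← add_e_e_e, add_right_comm c (e 0), add_right_comm (c + e 1)]
    exact lt_add_of_pos_right _ (IsFlip.e_pos 0)
  have h2 : ∀ i j, c + e i + e j < c + 1 → G (c + e i) = G' (c + e i) := fun i j hlt =>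
    h _ (le_add_of_nonneg_right (e_nonneg i))
      ((le_add_of_nonneg_right (e_nonneg j)).trans_lt hlt)
  have h3 : c + e 2 + e 0 < c + 1 := by rwa [add_right_comm]
  have h0 : G c = G' c := h _ le_rfl
    ((le_add_of_nonneg_right (e_nonneg 0)).trans_lt ((le_add_of_nonneg_right (e_nonneg 1)).trans_lt
      h12))
  simp only [recurrenceValue, h0, h1 _ _ h12, h1 _ _ h13, h1 _ _ h23, h2 _ _ h12, h2 _ _ h23,
    h2 _ _ h3]

theorem recurrenceAt_congr {G G' : Point → ℝ} {c : Point}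
    (h : ∀ x, c ≤ x → x ≤ c + 1 → G x = G' x) (hG : RecurrenceAt G c) : RecurrenceAt G' c := by
  rw [recurrenceAt_iff] at hG ⊢
  rw [← recurrenceValue_congr fun x h1 h2 => h x h1 h2.le, ← hG]
  exact (h _ (le_add_of_nonneg_right zero_le_one) le_rfl).symm

/-- A solution serves as its own initial data on the larger surface, which makes the induction
hypothesis applicable to it. -/
theorem IsSolution.insert {g G : Point → ℝ} {c : Point} (hG : IsSolution U g G) :
    IsSolution (insert c U) G G :=
  ⟨fun _ _ => rfl, fun d hd => hG.2 d ⟨hd.1, fun h => hd.2 (.inr h)⟩⟩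

namespace IsFlip

variable {c : Point}

theorem top_notMem_vertices (h : IsFlip U c) : c + 1 ∉ vertices U := by
  rw [h.mono.mem_vertices, add_sub_cancel_right]
  exact fun h1 => h.notMem h1.1

theorem recurrenceAt_update (g : Point → ℝ) (c : Point) :
    RecurrenceAt (Function.update g (c + 1) (recurrenceValue g c)) c := by
  rw [recurrenceAt_iff, Function.update_self]
  exact recurrenceValue_congr fun x _ hx => (Function.update_of_ne hx.ne _ _).symm

/-- After the flip, `c` is neither a vertex nor a corner of another missing cube, so a solution for
the larger solid may have any value there. Its value at `c` is reset to the prescribed one. -/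
theorem isSolution_update (h : IsFlip U c) {g G : Point → ℝ}
    (hG : IsSolution (insert c U) (Function.update g (c + 1) (recurrenceValue g c)) G) :
    IsSolution U g (Function.update G c (g c)) := by
  have hc1 : c ≠ c + 1 := fun h1 => by simpa using congrFun h1 0
  refine ⟨fun x hx => ?_, fun d hd => ?_⟩
  · rcases (h.mem_vertices false x).1 hx with h1 | rfl
    · have h2 : x ≠ c := by
        rintro rfl
        exact (h.mono_insert.mem_vertices.1 h1.2).2 (Set.mem_insert _ _)
      rw [Function.update_of_ne h2, hG.1 x h1.2,
        Function.update_of_ne (ne_of_mem_of_not_mem hx h.top_notMem_vertices)]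
    · exact Function.update_self ..
  · by_cases hdc : d = c
    · subst hdc
      refine recurrenceAt_congr (fun x h1 h2 => ?_) (recurrenceAt_update g d)
      by_cases hx : x = d
      · rw [hx, Function.update_self, Function.update_of_ne hc1]
      · rw [Function.update_of_ne hx, hG.1 x]
        rw [h.mono_insert.mem_vertices]
        refine ⟨h.mono_insert.mem_of_le (Set.mem_insert _ _) (sub_le_iff_le_add.2 h2), ?_⟩
        rintro (h3 | h3)
        exacts [hx h3, h.notMem_of_le h1 h3]
    · refine recurrenceAt_congr (fun x h1 _ => ?_) (hG.2 d ⟨hd.1, fun h1 => h1.elim hdc hd.2⟩)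
      rw [Function.update_of_ne]
      rintro rfl
      -- If `c` were a corner of another missing cube `d`, then `d < c`, and `d` would be in the
      -- solid.
      exact hd.2 (h.mem_of_lt (lt_of_le_of_ne h1 hdc))

end IsFlip

/-- The solution of the recurrence is the partition function of the taut configurations. -/
theorem wellDefined_and_solution (hU : IsMonotone U) (hreg : IsRegular U) {g : Point → ℝ}
    (hg : ∀ x ∈ vertices U, 0 < g x) : WellDefined U ∧ (∃ G, IsSolution U g G) ∧
      ∀ G, IsSolution U g G → G 0 = tautPartition U g := by
  obtain ⟨n, hn⟩ : ∃ n, (negativeCorner \ U).ncard = n := ⟨_, rfl⟩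
  induction n using Nat.strong_induction_on generalizing U g with
  | _ n ih =>
  rcases (negativeCorner \ U).eq_empty_or_nonempty with h0 | hne
  · obtain rfl : U = negativeCorner := hreg.1.antisymm (Set.sdiff_eq_empty.1 h0)
    refine ⟨wellDefined_negativeCorner tautConfigs_negativeCorner, ⟨g, fun _ _ => rfl, ?_⟩, ?_⟩
    · exact fun c hc => absurd hc.1 hc.2
    · intro G hG
      rw [tautPartition_negativeCorner (hg 0 zero_mem_vertices_negativeCorner)]
      exact hG.1 0 zero_mem_vertices_negativeCorner
  · obtain ⟨c, hc, hflip, hreg'⟩ := exists_isFlip hU hreg hne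
    have hlt : (negativeCorner \ insert c U).ncard < n := by
      rw [← hn]
      refine Set.ncard_lt_ncard ⟨Set.sdiff_subset_sdiff_right (Set.subset_insert c U), fun h => ?_⟩
        hreg.2
      exact (h hc).2 (Set.mem_insert c U)
    -- Finiteness does not involve the values, but its transfer through the flip uses positive
    -- values that satisfy the recurrence at `c`; any such `g'` will do.
    have hflip' : ∀ {g' : Point → ℝ}, (∀ x ∈ vertices U, 0 < g' x) → RecurrenceAt g' c →
        WellDefined U ∧ tautPartition U g' = tautPartition (insert c U) g' := fun hg' hrec =>
      hflip.wellDefined_and_tautPartition hg' hrec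
        (ih _ hlt hflip.mono_insert hreg' (hflip.pos_insert hg' hrec) rfl).1
    have hrec := IsFlip.recurrenceAt_update g c
    have hpos : ∀ x ∈ vertices U, 0 < Function.update g (c + 1) (recurrenceValue g c) x := by
      intro x hx
      rw [Function.update_of_ne (ne_of_mem_of_not_mem hx hflip.top_notMem_vertices)]
      exact hg x hx
    refine ⟨(hflip' hpos hrec).1, ?_, ?_⟩
    · obtain ⟨G, hG⟩ := (ih _ hlt hflip.mono_insert hreg' (hflip.pos_insert hpos hrec) rfl).2.1
      exact ⟨_, hflip.isSolution_update hG⟩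
    · intro G hG
      have hGpos : ∀ x ∈ vertices U, 0 < G x := fun x hx => by rw [hG.1 x hx]; exact hg x hx
      have hGrec := hG.2 c hc
      -- The flip is applied to `G` instead of `g`, since `G` also has the right value at the new
      -- vertex.
      rw [← tautPartition_congr hU hG.1, (hflip' hGpos hGrec).2]
      exact (ih _ hlt hflip.mono_insert hreg' (hflip.pos_insert hGpos hGrec) rfl).2.2 G hG.insert

end KashaevLoops

theorem theorem4p3 (U : KashaevLoops.SteppedSolid) (hmono : KashaevLoops.IsMonotone U)
    (hreg : KashaevLoops.IsRegular U) (g : KashaevLoops.Point → ℝ)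
    (hg : ∀ x ∈ KashaevLoops.vertices U, 0 < g x) :
    -- the partition function is well defined
    ((KashaevLoops.tautConfigs U).Finite ∧
      ∀ σ ∈ KashaevLoops.tautConfigs U,
        (KashaevLoops.loops σ).Finite ∧
        {x | x ∈ KashaevLoops.vertices U ∧ KashaevLoops.vertexExp σ x ≠ 0}.Finite ∧
        {f : KashaevLoops.faces U | (σ f).faceExp ≠ 0}.Finite) ∧
    -- the recurrence has a solution, and its value at the origin is the partition function
    (∃ G : KashaevLoops.Point → ℝ, KashaevLoops.IsSolution U g G) ∧
    ∀ G : KashaevLoops.Point → ℝ, KashaevLoops.IsSolution U g G →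
      G 0 = KashaevLoops.tautPartition U g :=
  KashaevLoops.wellDefined_and_solution hmono hreg hg
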